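/- **Conventions.** Exact categories are exact in the sense of Quillen. Let $\mathsf A$ be an idempotent complete exact category. A full subcategory $\mathsf E\subset\mathsf A$ is *coresolving* if it is closed under extensions, cokernels of admissible monomorphisms and direct summands, and every object $A\in\mathsf A$ admits an admissible monomorphism $A\to E$ with $E\in\mathsf E$; *resolving* subcategories are defined dually (closed under extensions, kernels of admissible epimorphisms and direct summands, and every object is the target of an admissible epimorphism from an object of the subcategory). Such a subcategory carries the induced exact structure. For an exact category $\mathsf C$, $\mathrm{Hot}(\mathsf C)$ is the homotopy category of unbounded complexes, and the derived category $\mathsf D(\mathsf C)$ is the Verdier quotient of $\mathrm{Hot}(\mathsf C)$ by the thick subcategory generated by the acyclic complexes. If set-indexed coproducts exist and are exact in $\mathsf C$, the *coderived category* $\mathsf D^{\mathsf{co}}(\mathsf C)$ is the Verdier quotient of $\mathrm{Hot}(\mathsf C)$ by the smallest full triangulated subcategory closed under coproducts that contains the total complexes of all short exact sequences of complexes over $\mathsf C$. Dually, if set-indexed products exist and are exact in $\mathsf C$, the *contraderived category* $\mathsf D^{\mathsf{ctr}}(\mathsf C)$ is the Verdier quotient of $\mathrm{Hot}(\mathsf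 C)$ by the smallest full triangulated subcategory closed under products that contains these total complexes. A triangulated functor $F\colon\mathsf T\to\mathsf T'$ is a *Verdier quotient functor* if the induced functor $\mathsf T/\ker F\to\mathsf T'$ is an equivalence. **Proposition.** (a) Let $\mathsf A$ be an idempotent complete exact category in which set-indexed coproducts exist and are exact, and let $\mathsf E\subset\mathsf A$ be a coresolving subcategory closed under coproducts. Then the embedding $\mathsf E\to\mathsf A$ induces a functor $\mathsf D^{\mathsf{co}}(\mathsf E)\to\mathsf D^{\mathsf{co}}(\mathsf A)$, and this functor is a triangulated equivalence. The triangulated functor $\mathsf D(\mathsf E)\to\mathsf D(\mathsf A)$ induced by the same embedding is a Verdier quotient functor. (b) Let $\mathsf B$ be an idempotent complete exact category in which set-indexed products exist and are exact, and let $\mathsf F\subset\mathsf B$ be a resolving subcategory closed under products. Then the embedding $\mathsf F\to\mathsf B$ induces a functor $\mathsf D^{\mathsf{ctr}}(\mathsf F)\to\mathsf D^{\mathsf{ctr}}(\mathsf B)$, and this functor is a triangulated equivalence. The triangulated functor $\mathsf D(\mathsf F)\to\mathsf D(\mathsf B)$ induced by the same embedding is a Verdier quotient functor. -/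

import Mathlib

open CategoryTheory Category Limits Pretriangulated

open scoped ZeroObject

universe w v u v' u'

namespace ExactCat

/-! ### Exact categories in the sense of Quillen -/

section Basic

variable {C : Type u} [Category.{v} C] [Preadditive C]

/-- Given a class `K` of short complexes (the conflations), the inflations (= admissible
monomorphisms) are the first morphisms of the conflations. -/
def IsInflation (K : ObjectProperty (ShortComplex C)) {X Y : C} (i : X ⟶ Y) : Prop :=
  ∃ (Z : C) (p : Y ⟶ Z) (w : i ≫ p = 0), K (ShortComplex.mk i p w)

/-- The deflations (= admissible epimorphisms) are the second morphisms of the conflations. -/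
def IsDeflation (K : ObjectProperty (ShortComplex C)) {Y Z : C} (p : Y ⟶ Z) : Prop :=
  ∃ (X : C) (i : X ⟶ Y) (w : i ≫ p = 0), K (ShortComplex.mk i p w)

end Basic

/-- An exact category in the sense of Quillen: an additive category with a class of
kernel-cokernel pairs (the short exact sequences, or conflations), closed under isomorphisms,
such that identities are inflations and deflations, inflations and deflations are closed under
composition, pushouts of inflations along arbitrary morphisms exist and are inflations, and
pullbacks of deflations along arbitrary morphisms exist and are deflations. -/
class ExactCategory (C : Type u) [Category.{v} C] [Preadditive C] [HasZeroObject C]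
    [HasBinaryBiproducts C] where
  conflation : ObjectProperty (ShortComplex C)
  conflation_of_iso {S T : ShortComplex C} (e : S ≅ T) (hS : conflation S) : conflation T
  isKernel (S : ShortComplex C) (hS : conflation S) :
    Nonempty (IsLimit (KernelFork.ofι S.f S.zero))
  isCokernel (S : ShortComplex C) (hS : conflation S) :
    Nonempty (IsColimit (CokernelCofork.ofπ S.g S.zero))
  inflation_id (X : C) : IsInflation conflation (𝟙 X)
  deflation_id (X : C) : IsDeflation conflation (𝟙 X)
  inflation_comp {X Y Z : C} (i : X ⟶ Y) (j : Y ⟶ Z) (hi : IsInflation conflation i)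
    (hj : IsInflation conflation j) : IsInflation conflation (i ≫ j)
  deflation_comp {X Y Z : C} (p : X ⟶ Y) (q : Y ⟶ Z) (hp : IsDeflation conflation p)
    (hq : IsDeflation conflation q) : IsDeflation conflation (p ≫ q)
  inflation_pushout {X Y X' : C} (i : X ⟶ Y) (f : X ⟶ X') (hi : IsInflation conflation i) :
    ∃ (Y' : C) (g : Y ⟶ Y') (i' : X' ⟶ Y'), IsPushout i f g i' ∧ IsInflation conflation i'
  deflation_pullback {Y Z Z' : C} (p : Y ⟶ Z) (f : Z' ⟶ Z) (hp : IsDeflation conflation p) :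
    ∃ (Y' : C) (g : Y' ⟶ Y) (p' : Y' ⟶ Z'), IsPullback g p' p f ∧ IsDeflation conflation p'

section Lemmas

variable {C : Type u} [Category.{v} C] [Preadditive C] [HasZeroObject C]
  [HasBinaryBiproducts C] [ExactCategory C]

variable (C) in
/-- The class of short exact sequences of an exact category. -/
abbrev conflation : ObjectProperty (ShortComplex C) := ExactCategory.conflation

/-- Two cokernels of an inflation give conflations simultaneously. -/
lemma conflation_of_isColimit {X Y Z : C} {i : X ⟶ Y} (hi : IsInflation (conflation C) i)
    (p : Y ⟶ Z) (w : i ≫ p = 0) (hp : IsColimit (CokernelCofork.ofπ p w)) :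
    conflation C (ShortComplex.mk i p w) := by
  obtain ⟨Q, q, wq, hq⟩ := hi
  obtain ⟨hq'⟩ := ExactCategory.isCokernel _ hq
  refine ExactCategory.conflation_of_iso ?_ hq
  refine ShortComplex.isoMk (Iso.refl _) (Iso.refl _) (hq'.coconePointUniqueUpToIso hp)
    (by simp) ?_
  have := hq'.comp_coconePointUniqueUpToIso_hom hp WalkingParallelPair.one
  simpa using this.symm

lemma conflation_of_isLimit {X Y Z : C} {p : Y ⟶ Z} (hp : IsDeflation (conflation C) p)
    (i : X ⟶ Y) (w : i ≫ p = 0) (hi : IsLimit (KernelFork.ofι i w)) :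
    conflation C (ShortComplex.mk i p w) := by
  obtain ⟨Q, q, wq, hq⟩ := hp
  obtain ⟨hq'⟩ := ExactCategory.isKernel _ hq
  refine ExactCategory.conflation_of_iso ?_ hq
  refine ShortComplex.isoMk (hq'.conePointUniqueUpToIso hi) (Iso.refl _) (Iso.refl _)
    ?_ (by simp)
  have := hq'.conePointUniqueUpToIso_hom_comp hi WalkingParallelPair.zero
  simpa using this

/-- The pushout of a conflation `X ⟶ Y ⟶ Z` along `X ⟶ X'` is a conflation `X' ⟶ Y' ⟶ Z`. -/
lemma conflation_pushout {X Y Z X' Y' : C} {i : X ⟶ Y} {p : Y ⟶ Z} {w : i ≫ p = 0}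
    (h : conflation C (ShortComplex.mk i p w)) {f : X ⟶ X'} {g : Y ⟶ Y'} {i' : X' ⟶ Y'}
    (sq : IsPushout i f g i') (hi' : IsInflation (conflation C) i') :
    ∃ (p' : Y' ⟶ Z) (w' : i' ≫ p' = 0), g ≫ p' = p ∧
      conflation C (ShortComplex.mk i' p' w') := by
  obtain ⟨hp⟩ := ExactCategory.isCokernel _ h
  let p' : Y' ⟶ Z := sq.desc p 0 (by simp [w])
  have w' : i' ≫ p' = 0 := sq.inr_desc _ _ _
  have fac : g ≫ p' = p := sq.inl_desc _ _ _
  refine ⟨p', w', fac, conflation_of_isColimit hi' _ _ ?_⟩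
  have hepi : Epi p := Cofork.IsColimit.epi hp
  have hepi' : Epi p' := by
    have : Epi (g ≫ p') := by rw [fac]; exact hepi
    exact epi_of_epi g p'
  refine CokernelCofork.IsColimit.ofπ' _ _ (fun {A} k hk => ?_)
  have hk' : i ≫ g ≫ k = 0 := by rw [sq.w_assoc, hk, comp_zero]
  obtain ⟨l, hl⟩ := CokernelCofork.IsColimit.desc' hp (g ≫ k) hk'
  refine ⟨l, sq.hom_ext ?_ ?_⟩
  · rw [← assoc, fac]; exact hl
  · rw [← assoc, w', zero_comp, hk]

/-- The pullback of a conflation `X ⟶ Y ⟶ Z` along `Z' ⟶ Z` is a conflation `X ⟶ Y' ⟶ Z'`. -/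
lemma conflation_pullback {X Y Z Y' Z' : C} {i : X ⟶ Y} {p : Y ⟶ Z} {w : i ≫ p = 0}
    (h : conflation C (ShortComplex.mk i p w)) {f : Z' ⟶ Z} {g : Y' ⟶ Y} {p' : Y' ⟶ Z'}
    (sq : IsPullback g p' p f) (hp' : IsDeflation (conflation C) p') :
    ∃ (i' : X ⟶ Y') (w' : i' ≫ p' = 0), i' ≫ g = i ∧
      conflation C (ShortComplex.mk i' p' w') := by
  obtain ⟨hi⟩ := ExactCategory.isKernel _ h
  let i' : X ⟶ Y' := sq.lift i 0 (by simp [w])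
  have w' : i' ≫ p' = 0 := sq.lift_snd _ _ _
  have fac : i' ≫ g = i := sq.lift_fst _ _ _
  refine ⟨i', w', fac, conflation_of_isLimit hp' _ _ ?_⟩
  have hmono : Mono i := Fork.IsLimit.mono hi
  have hmono' : Mono i' := by
    have : Mono (i' ≫ g) := by rw [fac]; exact hmono
    exact mono_of_mono i' g
  refine KernelFork.IsLimit.ofι' _ _ (fun {A} k hk => ?_)
  have hk' : (k ≫ g) ≫ p = 0 := by rw [assoc, sq.w, ← assoc, hk, zero_comp]
  obtain ⟨l, hl⟩ := KernelFork.IsLimit.lift' hi (k ≫ g) hk'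
  refine ⟨l, sq.hom_ext ?_ ?_⟩
  · rw [assoc, fac]; exact hl
  · rw [assoc, w', comp_zero, hk]

end Lemmas

/-! ### Extension-closed subcategories -/

section Subcategories

variable {C : Type u} [Category.{v} C] [Preadditive C] [HasZeroObject C]
  [HasBinaryBiproducts C] [ExactCategory C]

/-- A full subcategory (given by a property of objects) which contains a zero object and is
closed under extensions. -/
class IsExtensionClosed (P : ObjectProperty C) : Prop where
  exists_zero : ∃ Z : C, IsZero Z ∧ P Z
  ext (S : ShortComplex C) (hS : conflation C S) (h₁ : P S.X₁) (h₃ : P S.X₃) : P S.X₂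

namespace IsExtensionClosed

section

variable {P : ObjectProperty C}

/-- A morphism of the subcategory is an inflation for the induced structure as soon as
it is part of a conflation of the ambient category with third term in the subcategory. -/
lemma isInflation_iff {X Y : P.FullSubcategory} (i : X ⟶ Y) :
    IsInflation (fun S : ShortComplex P.FullSubcategory => conflation C (S.map P.ι)) i ↔
      ∃ (Z : C) (_ : P Z) (p : Y.obj ⟶ Z) (w : i.hom ≫ p = 0),
        conflation C (ShortComplex.mk i.hom p w) := by
  constructor
  · rintro ⟨Z, p, w, h⟩
    exact ⟨Z.obj, Z.property, p.hom, congrArg (fun f => f.hom) w, h⟩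
  · rintro ⟨Z, hZ, p, w, h⟩
    exact ⟨⟨Z, hZ⟩, ObjectProperty.homMk p, ObjectProperty.hom_ext _ w, h⟩

lemma isDeflation_iff {Y Z : P.FullSubcategory} (p : Y ⟶ Z) :
    IsDeflation (fun S : ShortComplex P.FullSubcategory => conflation C (S.map P.ι)) p ↔
      ∃ (X : C) (_ : P X) (i : X ⟶ Y.obj) (w : i ≫ p.hom = 0),
        conflation C (ShortComplex.mk i p.hom w) := by
  constructor
  · rintro ⟨X, i, w, h⟩
    exact ⟨X.obj, X.property, i.hom, congrArg (fun f => f.hom) w, h⟩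
  · rintro ⟨X, hX, i, w, h⟩
    exact ⟨⟨X, hX⟩, ObjectProperty.homMk i, ObjectProperty.hom_ext _ w, h⟩

end

variable (P : ObjectProperty C) [IsExtensionClosed P]

instance : P.ContainsZero := ⟨exists_zero⟩

instance : P.IsClosedUnderIsomorphisms where
  of_iso {X Y} e hX := by
    obtain ⟨Z₀, hZ₀, hP⟩ := exists_zero (P := P)
    obtain ⟨Z, p, w, h⟩ := ExactCategory.inflation_id X
    obtain ⟨hp⟩ := ExactCategory.isCokernel _ h
    have hp0 : p = 0 := by simpa using w
    have hepi : Epi p := Cofork.IsColimit.epi hp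
    have hZ : IsZero Z := by
      rw [IsZero.iff_id_eq_zero, ← cancel_epi p, hp0, zero_comp, zero_comp]
    have h' : conflation C (ShortComplex.mk e.hom (0 : Y ⟶ Z₀) comp_zero) := by
      refine ExactCategory.conflation_of_iso ?_ h
      exact ShortComplex.isoMk (Iso.refl _) e (hZ.iso hZ₀) (by simp)
        (hZ₀.eq_of_tgt _ _)
    exact ext _ h' hX hP

lemma prop_biprod {X Y : C} (hX : P X) (hY : P Y) : P (X ⊞ Y) := by
  obtain ⟨K, i, w, h⟩ := ExactCategory.deflation_id Y
  obtain ⟨hi⟩ := ExactCategory.isKernel _ h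
  have hi0 : i = 0 := by simpa using w
  have hmono : Mono i := Fork.IsLimit.mono hi
  have hK : IsZero K := by
    rw [IsZero.iff_id_eq_zero, ← cancel_mono i, hi0, comp_zero, comp_zero]
  obtain ⟨Y', g, i', sq, hi'⟩ := ExactCategory.inflation_pushout i (0 : K ⟶ X) ⟨_, _, _, h⟩
  obtain ⟨p', w', -, h'⟩ := conflation_pushout h sq hi'
  have hY' : P Y' := ext _ h' hX hY
  have sq' : IsPushout i (0 : K ⟶ X) (biprod.inr : Y ⟶ X ⊞ Y) (biprod.inl : X ⟶ X ⊞ Y) := by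
    refine ⟨⟨hK.eq_of_src _ _⟩, ⟨PushoutCocone.IsColimit.mk _
      (fun s => biprod.desc s.inr s.inl) (by simp) (by simp) ?_⟩⟩
    intro s m h₁ h₂
    ext <;> simp [h₁, h₂]
  exact P.prop_of_iso (sq.isoIsPushout _ _ sq') hY'

instance : HasBinaryBiproducts P.FullSubcategory where
  has_binary_biproduct X Y := HasBinaryBiproduct.mk
    { bicone :=
        { pt := ⟨X.obj ⊞ Y.obj, prop_biprod P X.property Y.property⟩
          fst := ObjectProperty.homMk biprod.fst
          snd := ObjectProperty.homMk biprod.snd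
          inl := ObjectProperty.homMk biprod.inl
          inr := ObjectProperty.homMk biprod.inr
          inl_fst := by ext; simp
          inl_snd := by ext; simp
          inr_fst := by ext; simp
          inr_snd := by ext; simp }
      isBilimit := isBinaryBilimitOfTotal _ (ObjectProperty.hom_ext _ biprod.total) }

section Induced

variable {P}

/-- The composite of inflations `i : X ⟶ Y` and `j : Y ⟶ Z` with cokernels in the subcategory
has a cokernel in the subcategory. -/
lemma exists_conflation_comp {X Y Z Q R : C} {i : X ⟶ Y} {p : Y ⟶ Q} {w : i ≫ p = 0}
    {j : Y ⟶ Z} {q : Z ⟶ R} {w' : j ≫ q = 0}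
    (h : conflation C (ShortComplex.mk i p w)) (h' : conflation C (ShortComplex.mk j q w'))
    (hQ : P Q) (hR : P R) :
    ∃ (T : C) (_ : P T) (t : Z ⟶ T) (wt : (i ≫ j) ≫ t = 0),
      conflation C (ShortComplex.mk (i ≫ j) t wt) := by
  obtain ⟨T, t, j', sq, hj'⟩ := ExactCategory.inflation_pushout j p ⟨_, _, _, h'⟩
  obtain ⟨q', wq', -, hc⟩ := conflation_pushout h' sq hj'
  have wt : (i ≫ j) ≫ t = 0 := by rw [assoc, sq.w, ← assoc, w, zero_comp]
  obtain ⟨hp⟩ := ExactCategory.isCokernel _ h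
  have hepi : Epi p := Cofork.IsColimit.epi hp
  have hepit : Epi t := ⟨fun {A} a b hab => sq.hom_ext hab (by
    rw [← cancel_epi p, ← assoc, ← assoc, ← sq.w, assoc, assoc, hab])⟩
  refine ⟨T, ext _ hc hQ hR, t, wt, conflation_of_isColimit
    (ExactCategory.inflation_comp i j ⟨_, _, _, h⟩ ⟨_, _, _, h'⟩) _ _
    (CokernelCofork.IsColimit.ofπ' _ _ (fun {A} k hk => ?_))⟩
  obtain ⟨l, hl⟩ := CokernelCofork.IsColimit.desc' hp (j ≫ k) (by rw [← assoc]; exact hk)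
  have hl' : p ≫ l = j ≫ k := hl
  exact ⟨sq.desc k l hl'.symm, sq.inl_desc _ _ _⟩

/-- The composite of deflations `p : X ⟶ Y` and `q : Y ⟶ Z` with kernels in the subcategory
has a kernel in the subcategory. -/
lemma exists_conflation_comp' {X Y Z K L : C} {i : K ⟶ X} {p : X ⟶ Y} {w : i ≫ p = 0}
    {j : L ⟶ Y} {q : Y ⟶ Z} {w' : j ≫ q = 0}
    (h : conflation C (ShortComplex.mk i p w)) (h' : conflation C (ShortComplex.mk j q w'))
    (hK : P K) (hL : P L) :
    ∃ (T : C) (_ : P T) (t : T ⟶ X) (wt : t ≫ p ≫ q = 0),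
      conflation C (ShortComplex.mk t (p ≫ q) wt) := by
  obtain ⟨T, t, p', sq, hp'⟩ := ExactCategory.deflation_pullback p j ⟨_, _, _, h⟩
  obtain ⟨i', wi', -, hc⟩ := conflation_pullback h sq hp'
  have wt : t ≫ p ≫ q = 0 := by rw [← assoc, sq.w, assoc, w', comp_zero]
  obtain ⟨hj⟩ := ExactCategory.isKernel _ h'
  have hmono : Mono j := Fork.IsLimit.mono hj
  have hmonot : Mono t := ⟨fun {A} a b hab => sq.hom_ext hab (by
    rw [← cancel_mono j, assoc, assoc, ← sq.w, ← assoc, ← assoc, hab])⟩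
  refine ⟨T, ext _ hc hK hL, t, wt, conflation_of_isLimit
    (ExactCategory.deflation_comp p q ⟨_, _, _, h⟩ ⟨_, _, _, h'⟩) _ _
    (KernelFork.IsLimit.ofι' _ _ (fun {A} k hk => ?_))⟩
  obtain ⟨l, hl⟩ := KernelFork.IsLimit.lift' hj (k ≫ p) (by rw [assoc]; exact hk)
  have hl' : l ≫ j = k ≫ p := hl
  exact ⟨sq.lift k l hl'.symm, sq.lift_fst _ _ _⟩

end Induced

/-- The exact structure induced on an extension-closed full subcategory: a short complex in the
subcategory is a conflation if and only if it is one in the ambient exact category. -/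
instance : ExactCategory P.FullSubcategory where
  conflation S := conflation C (S.map P.ι)
  conflation_of_iso e hS := ExactCategory.conflation_of_iso (P.ι.mapShortComplex.mapIso e) hS
  isKernel S hS := by
    obtain ⟨hi⟩ := ExactCategory.isKernel _ hS
    have : Mono (P.ι.map S.f) := Fork.IsLimit.mono hi
    have : Mono S.f := P.ι.mono_of_mono_map this
    refine ⟨KernelFork.IsLimit.ofι' _ _ (fun {A} k hk => ?_)⟩
    have hk' : P.ι.map k ≫ P.ι.map S.g = 0 := by rw [← P.ι.map_comp, hk, P.ι.map_zero]
    let l := KernelFork.IsLimit.lift' hi (P.ι.map k) hk'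
    exact ⟨ObjectProperty.homMk l.1, ObjectProperty.hom_ext _ l.2⟩
  isCokernel S hS := by
    obtain ⟨hp⟩ := ExactCategory.isCokernel _ hS
    have : Epi (P.ι.map S.g) := Cofork.IsColimit.epi hp
    have : Epi S.g := P.ι.epi_of_epi_map this
    refine ⟨CokernelCofork.IsColimit.ofπ' _ _ (fun {A} k hk => ?_)⟩
    have hk' : P.ι.map S.f ≫ P.ι.map k = 0 := by rw [← P.ι.map_comp, hk, P.ι.map_zero]
    let l := CokernelCofork.IsColimit.desc' hp (P.ι.map k) hk'
    exact ⟨ObjectProperty.homMk l.1, ObjectProperty.hom_ext _ l.2⟩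
  inflation_id X := by
    rw [isInflation_iff]
    obtain ⟨Z, p, w, h⟩ := ExactCategory.inflation_id X.obj
    obtain ⟨hp⟩ := ExactCategory.isCokernel _ h
    have hp0 : p = 0 := by simpa using w
    have hepi : Epi p := Cofork.IsColimit.epi hp
    have hZ : IsZero Z := by
      rw [IsZero.iff_id_eq_zero, ← cancel_epi p, hp0, zero_comp, zero_comp]
    exact ⟨Z, P.prop_of_isZero hZ, p, w, h⟩
  deflation_id X := by
    rw [isDeflation_iff]
    obtain ⟨Z, i, w, h⟩ := ExactCategory.deflation_id X.obj
    obtain ⟨hi⟩ := ExactCategory.isKernel _ h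
    have hi0 : i = 0 := by simpa using w
    have hmono : Mono i := Fork.IsLimit.mono hi
    have hZ : IsZero Z := by
      rw [IsZero.iff_id_eq_zero, ← cancel_mono i, hi0, comp_zero, comp_zero]
    exact ⟨Z, P.prop_of_isZero hZ, i, w, h⟩
  inflation_comp i j hi hj := by
    rw [isInflation_iff] at hi hj ⊢
    obtain ⟨Q, hQ, p, w, h⟩ := hi
    obtain ⟨R, hR, q, w', h'⟩ := hj
    exact exists_conflation_comp h h' hQ hR
  deflation_comp p q hp hq := by
    rw [isDeflation_iff] at hp hq ⊢
    obtain ⟨K, hK, i, w, h⟩ := hp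
    obtain ⟨L, hL, j, w', h'⟩ := hq
    exact exists_conflation_comp' h h' hK hL
  inflation_pushout {X Y X'} i f hi := by
    rw [isInflation_iff] at hi
    obtain ⟨Q, hQ, p, w, h⟩ := hi
    obtain ⟨Y', g, i', sq, hi'⟩ :=
      ExactCategory.inflation_pushout i.hom f.hom ⟨_, _, _, h⟩
    obtain ⟨p', w', -, h'⟩ := conflation_pushout h sq hi'
    refine ⟨⟨Y', ext _ h' X'.property hQ⟩, ObjectProperty.homMk g, ObjectProperty.homMk i',
      IsPushout.of_map P.ι (ObjectProperty.hom_ext _ sq.w) sq, ?_⟩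
    rw [isInflation_iff]
    exact ⟨Q, hQ, p', w', h'⟩
  deflation_pullback {Y Z Z'} p f hp := by
    rw [isDeflation_iff] at hp
    obtain ⟨K, hK, i, w, h⟩ := hp
    obtain ⟨Y', g, p', sq, hp'⟩ :=
      ExactCategory.deflation_pullback p.hom f.hom ⟨_, _, _, h⟩
    obtain ⟨i', w', -, h'⟩ := conflation_pullback h sq hp'
    refine ⟨⟨Y', ext _ h' hK Z'.property⟩, ObjectProperty.homMk g, ObjectProperty.homMk p',
      IsPullback.of_map P.ι (ObjectProperty.hom_ext _ sq.w) sq, ?_⟩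
    rw [isDeflation_iff]
    exact ⟨K, hK, i', w', h'⟩

end IsExtensionClosed

/-- A coresolving subcategory: closed under extensions, cokernels of admissible monomorphisms
and direct summands, and such that each object of the ambient category admits an admissible
monomorphism into an object of the subcategory. -/
class IsCoresolving (P : ObjectProperty C) : Prop where
  ext (S : ShortComplex C) (hS : conflation C S) (h₁ : P S.X₁) (h₃ : P S.X₃) : P S.X₂
  coker (S : ShortComplex C) (hS : conflation C S) (h₁ : P S.X₁) (h₂ : P S.X₂) : P S.X₃
  retracts : P.IsStableUnderRetracts
  cogenerating (X : C) : ∃ (Y : C) (_ : P Y) (i : X ⟶ Y), IsInflation (conflation C) i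

/-- A resolving subcategory: closed under extensions, kernels of admissible epimorphisms
and direct summands, and such that each object of the ambient category admits an admissible
epimorphism from an object of the subcategory. -/
class IsResolving (P : ObjectProperty C) : Prop where
  ext (S : ShortComplex C) (hS : conflation C S) (h₁ : P S.X₁) (h₃ : P S.X₃) : P S.X₂
  ker (S : ShortComplex C) (hS : conflation C S) (h₂ : P S.X₂) (h₃ : P S.X₃) : P S.X₁
  retracts : P.IsStableUnderRetracts
  generating (X : C) : ∃ (Y : C) (_ : P Y) (p : Y ⟶ X), IsDeflation (conflation C) p

instance (P : ObjectProperty C) [h : IsCoresolving P] : IsExtensionClosed P where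
  exists_zero := by
    obtain ⟨Y, hY, -⟩ := h.cogenerating (0 : C)
    have := h.retracts
    exact ⟨0, isZero_zero C, P.prop_of_retract ((isZero_zero C).retract Y) hY⟩
  ext := h.ext

instance (P : ObjectProperty C) [h : IsResolving P] : IsExtensionClosed P where
  exists_zero := by
    obtain ⟨Y, hY, -⟩ := h.generating 0
    have := h.retracts
    exact ⟨0, isZero_zero C, P.prop_of_retract ((isZero_zero C).retract Y) hY⟩
  ext := h.ext

end Subcategories

/-! ### Exactness of coproducts and products -/

section Products

variable (C : Type u) [Category.{v} C] [Preadditive C] [HasZeroObject C]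
  [HasBinaryBiproducts C] [ExactCategory C]

/-- Coproducts indexed by types in `Type w` are exact: coproducts of conflations are
conflations. -/
class HasExactCoproducts [HasCoproducts.{w} C] : Prop where
  exact {J : Type w} (S : J → ShortComplex C) (hS : ∀ j, conflation C (S j)) :
    conflation C (ShortComplex.mk (Limits.Sigma.map (fun j => (S j).f))
      (Limits.Sigma.map (fun j => (S j).g)) (by ext j; simp))

/-- Products indexed by types in `Type w` are exact: products of conflations are
conflations. -/
class HasExactProducts [HasProducts.{w} C] : Prop where
  exact {J : Type w} (S : J → ShortComplex C) (hS : ∀ j, conflation C (S j)) :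
    conflation C (ShortComplex.mk (Limits.Pi.map (fun j => (S j).f))
      (Limits.Pi.map (fun j => (S j).g)) (by ext j; simp))

end Products

/-! ### Verdier quotients -/

section Verdier

variable {T : Type u} [Category.{v} T] [Preadditive T] [HasZeroObject T] [HasShift T ℤ]
  [∀ n : ℤ, (shiftFunctor T n).Additive] [Pretriangulated T]

/-- An intersection of strictly full triangulated subcategories is triangulated. -/
lemma isTriangulated_sInf (s : Set (ObjectProperty T))
    (hs : ∀ P ∈ s, P.IsTriangulated ∧ P.IsClosedUnderIsomorphisms) :
    ObjectProperty.IsTriangulated (fun X => ∀ P ∈ s, P X : ObjectProperty T) := by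
  let N : ObjectProperty T := fun X => ∀ P ∈ s, P X
  have : N.IsClosedUnderIsomorphisms := ⟨fun {X Y} e hX P hP => by
    obtain ⟨_, _⟩ := hs P hP
    exact P.prop_of_iso e (hX P hP)⟩
  have h₁ : N.ContainsZero := ⟨⟨0, isZero_zero T, fun P hP => by
    obtain ⟨_, _⟩ := hs P hP
    exact P.prop_zero⟩⟩
  have h₂ : N.IsStableUnderShift ℤ := ⟨fun n => ⟨fun X hX P hP => by
    obtain ⟨_, _⟩ := hs P hP
    exact P.le_shift n _ (hX P hP)⟩⟩
  have h₃ : N.IsTriangulatedClosed₂ := ObjectProperty.IsTriangulatedClosed₂.mk'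
    (fun A hA hA₁ hA₃ P hP => by
      obtain ⟨_, _⟩ := hs P hP
      exact P.ext_of_isTriangulatedClosed₂ A hA (hA₁ P hP) (hA₃ P hP))
  exact { toContainsZero := h₁, toIsStableUnderShift := h₂, toIsTriangulatedClosed₂ := h₃ }

variable [IsTriangulated T]

/-- The Verdier quotient `T/N` of a triangulated category by a triangulated subcategory, obtained
by inverting the morphisms with cone in `N`. -/
abbrev VerdierQuotient (N : ObjectProperty T) [N.IsTriangulated] := N.trW.Localization

/-- The canonical functor `T ⥤ T/N`. -/
abbrev verdierQ (N : ObjectProperty T) [N.IsTriangulated] : T ⥤ VerdierQuotient N := N.trW.Q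

variable {T' : Type u'} [Category.{v'} T'] [Preadditive T'] [HasZeroObject T'] [HasShift T' ℤ]
  [∀ n : ℤ, (shiftFunctor T' n).Additive] [Pretriangulated T'] [IsTriangulated T']

/-- A triangulated functor `T/N ⥤ T'/N'` induced by a triangulated functor `Φ : T ⥤ T'`, i.e.
which makes the square with `Φ` and the canonical functors commute up to an isomorphism of
triangulated functors. By the universal property of `T/N`, there is up to isomorphism at most one
such functor. -/
structure InducedFunctor (Φ : T ⥤ T') [Φ.CommShift ℤ] (N : ObjectProperty T) [N.IsTriangulated]
    (N' : ObjectProperty T') [N'.IsTriangulated] where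
  functor : VerdierQuotient N ⥤ VerdierQuotient N'
  commShift : functor.CommShift ℤ
  isTriangulated : functor.IsTriangulated
  iso : verdierQ N ⋙ functor ≅ Φ ⋙ verdierQ N'
  iso_commShift : NatTrans.CommShift iso.hom ℤ

attribute [instance] InducedFunctor.commShift InducedFunctor.isTriangulated

/-- A triangulated functor `F : T ⥤ T'` is a Verdier quotient functor if it identifies `T'` with
the Verdier quotient of `T` by the kernel of `F`. -/
def IsVerdierQuotientFunctor (F : T ⥤ T') [F.CommShift ℤ] [F.IsTriangulated] : Prop :=
  F.IsLocalization F.kernel.trW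

/-- A localizing subcategory: a strictly full triangulated subcategory closed under all
coproducts (indexed by types in `Type w`) that exist in the ambient category. -/
structure IsLocalizing (P : ObjectProperty T) : Prop where
  isTriangulated : P.IsTriangulated
  isClosedUnderIsomorphisms : P.IsClosedUnderIsomorphisms
  coproducts (J : Type w) : P.IsClosedUnderColimitsOfShape (Discrete J)

/-- A colocalizing subcategory: a strictly full triangulated subcategory closed under all
products (indexed by types in `Type w`) that exist in the ambient category. -/
structure IsColocalizing (P : ObjectProperty T) : Prop where
  isTriangulated : P.IsTriangulated
  isClosedUnderIsomorphisms : P.IsClosedUnderIsomorphisms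
  products (J : Type w) : P.IsClosedUnderLimitsOfShape (Discrete J)

end Verdier

/-! ### Derived, coderived and contraderived categories of exact categories -/

section Derived

variable (C : Type u) [Category.{v} C] [Preadditive C] [HasZeroObject C]
  [HasBinaryBiproducts C] [ExactCategory C]

/-- The homotopy category of unbounded complexes. -/
abbrev Hot (C : Type u) [Category.{v} C] [Preadditive C] :=
  HomotopyCategory C (ComplexShape.up ℤ)

variable {C}

/-- A complex `K` over an exact category is acyclic (or exact) if it is spliced from conflations
`Z n ⟶ K.X n ⟶ Z (n + 1)`. -/
def IsAcyclic (K : CochainComplex C ℤ) : Prop :=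
  ∃ (Z : ℤ → C) (i : ∀ n, Z n ⟶ K.X n) (p : ∀ n, K.X n ⟶ Z (n + 1)) (w : ∀ n, i n ≫ p n = 0),
    (∀ n, conflation C (ShortComplex.mk (i n) (p n) (w n))) ∧
      ∀ n, p n ≫ i (n + 1) = K.d n (n + 1)

/-- A short exact sequence of complexes: a short complex of complexes which is a conflation
in each degree. -/
def IsShortExact (S : ShortComplex (CochainComplex C ℤ)) : Prop :=
  ∀ n : ℤ, conflation C (S.map (HomologicalComplex.eval C (ComplexShape.up ℤ) n))

/-- The total complex of a short complex of complexes `K ⟶ L ⟶ M`, realized as the iterated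
cone `cone (cone (K ⟶ L) ⟶ M)`. In degree `n` it is `K^(n+2) ⊞ L^(n+1) ⊞ M^n`. -/
noncomputable def total (S : ShortComplex (CochainComplex C ℤ)) : CochainComplex C ℤ :=
  CochainComplex.mappingCone
    (CochainComplex.mappingCone.desc S.f 0 S.g (by simp) :
      CochainComplex.mappingCone S.f ⟶ S.X₃)

variable (C)

/-- The acyclic complexes, as objects of the homotopy category. -/
def acyclicComplexes : ObjectProperty (Hot C) :=
  fun X => ∃ K : CochainComplex C ℤ, IsAcyclic K ∧
    X = (HomotopyCategory.quotient C (ComplexShape.up ℤ)).obj K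

/-- The total complexes of short exact sequences of complexes, as objects of the homotopy
category. -/
def totalComplexes : ObjectProperty (Hot C) :=
  fun X => ∃ S : ShortComplex (CochainComplex C ℤ), IsShortExact S ∧
    X = (HomotopyCategory.quotient C (ComplexShape.up ℤ)).obj (total S)

instance : (acyclicComplexes C).Nonempty := by
  obtain ⟨Z, p, w, h⟩ := ExactCategory.inflation_id (0 : C)
  obtain ⟨hp⟩ := ExactCategory.isCokernel _ h
  have hepi : Epi p := Cofork.IsColimit.epi hp
  have hZ : IsZero Z := by
    rw [IsZero.iff_id_eq_zero, ← cancel_epi p]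
    exact (isZero_zero C).eq_of_src _ _
  have hX (n : ℤ) : IsZero ((0 : CochainComplex C ℤ).X n) :=
    (HomologicalComplex.eval C (ComplexShape.up ℤ) n).map_isZero (isZero_zero _)
  refine ⟨_, ⟨0, ⟨fun _ => 0, fun _ => 0, fun _ => 0, fun _ => by simp, fun n => ?_,
    fun n => (hX n).eq_of_src _ _⟩, rfl⟩⟩
  refine ExactCategory.conflation_of_iso (S := ShortComplex.mk (𝟙 (0 : C)) p w)
    (ShortComplex.isoMk (Iso.refl _)
    ((isZero_zero C).iso (hX n)) (hZ.iso (isZero_zero C)) ?_ ?_) h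
  · exact (isZero_zero C).eq_of_src _ _
  · exact (isZero_zero C).eq_of_src _ _

/-- The derived category of an exact category: the Verdier quotient of the homotopy category
by the thick subcategory generated by the acyclic complexes. (Over an idempotent complete exact
category the acyclic complexes already form a thick subcategory.) -/
abbrev DerivedCat := VerdierQuotient (acyclicComplexes C).triangEnvelope

/-- The coacyclic complexes: the smallest localizing subcategory of the homotopy category which
contains the total complexes of short exact sequences of complexes. -/
def coacyclic : ObjectProperty (Hot C) :=
  fun X => ∀ P : ObjectProperty (Hot C), IsLocalizing.{w} P ∧ totalComplexes C ≤ P → P X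

/-- The contraacyclic complexes: the smallest colocalizing subcategory of the homotopy category
which contains the total complexes of short exact sequences of complexes. -/
def contraacyclic : ObjectProperty (Hot C) :=
  fun X => ∀ P : ObjectProperty (Hot C), IsColocalizing.{w} P ∧ totalComplexes C ≤ P → P X

instance : (coacyclic.{w} C).IsTriangulated :=
  isTriangulated_sInf {P | IsLocalizing.{w} P ∧ totalComplexes C ≤ P}
    (fun _ hP => ⟨hP.1.isTriangulated, hP.1.isClosedUnderIsomorphisms⟩)

instance : (contraacyclic.{w} C).IsTriangulated :=
  isTriangulated_sInf {P | IsColocalizing.{w} P ∧ totalComplexes C ≤ P}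
    (fun _ hP => ⟨hP.1.isTriangulated, hP.1.isClosedUnderIsomorphisms⟩)

/-- The coderived category. -/
abbrev CoderivedCat := VerdierQuotient (coacyclic.{w} C)

/-- The contraderived category. -/
abbrev ContraderivedCat := VerdierQuotient (contraacyclic.{w} C)

end Derived

section Inclusion

variable {C : Type u} [Category.{v} C] [Preadditive C] [HasZeroObject C]
  [HasBinaryBiproducts C] [ExactCategory C] (P : ObjectProperty C) [IsExtensionClosed P]

/-- The functor between homotopy categories induced by the inclusion of a subcategory. -/
noncomputable abbrev hotInclusion : Hot P.FullSubcategory ⥤ Hot C :=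
  P.ι.mapHomotopyCategory (ComplexShape.up ℤ)

/-- The triangulated functors `D(E) ⥤ D(A)` induced by the exact inclusion `E ⥤ A`. -/
abbrev DerivedInclusion :=
  InducedFunctor (hotInclusion P) (acyclicComplexes P.FullSubcategory).triangEnvelope
    (acyclicComplexes C).triangEnvelope

/-- The triangulated functors `D^co(E) ⥤ D^co(A)` induced by the exact inclusion `E ⥤ A`. -/
abbrev CoderivedInclusion :=
  InducedFunctor (hotInclusion P) (coacyclic.{w} P.FullSubcategory) (coacyclic.{w} C)

/-- The triangulated functors `D^ctr(F) ⥤ D^ctr(B)` induced by the exact inclusion `F ⥤ B`. -/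
abbrev ContraderivedInclusion :=
  InducedFunctor (hotInclusion P) (contraacyclic.{w} P.FullSubcategory) (contraacyclic.{w} C)

end Inclusion

end ExactCat

/-! Let Φ : Hot(E) → Hot(A) be the fully faithful functor induced by a coresolving subcategory E
closed under coproducts. Part (a) rests on two facts. Every complex X over A admits a morphism X →
ΦZ with coacyclic cone (`exists_trW_coacyclic`), and a complex over E is coacyclic over E exactly
when it is coacyclic over A (`coacyclic_fullSubcategory`). By the first fact the localization of
Hot(A) can be computed with fractions inside Hot(E) (`isLocalization_of_trW_right`); by the second
the class inverted there is the one defining the coderived category of E. This gives the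
equivalence.

For derived categories, coacyclic complexes lie in the thick subcategory generated by the acyclic
ones (`coacyclic_le_triangEnvelope`), so the same morphisms X → ΦZ show that Hot(E) → D(A) is a
localization, at the preimage of that thick subcategory. The preimage contains the acyclic complexes
over E, so this localization factors through D(E), and its second half D(E) → D(A) is a Verdier
quotient (`isVerdierQuotientFunctor_inducedFunctor`).

First fact. Embed X_0 = X degreewise into a contractible complex Y_0 with terms in E, write the
cokernel as X_1[1], and iterate. Let Z be the coproduct of the Y_n with differential perturbed by
the composites Y_n → X_{n+1}[1] → Y_{n+1}[1]. Then Z[1] is the cone of a morphism from the coproduct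
of the cone(X_n → Y_n) to the coproduct of the X_n[1], a telescope of the zigzag X_0[1] ← cone(X_0 →
Y_0) → X_1[1] ← ... . The arrows pointing right have total complexes of short exact sequences as
cones, so modulo coacyclic complexes the telescope collapses to X_0[1] (`trW_of_telescope_cofan`,
`exists_trW_of_coresolution`).

Second fact. Only one inclusion is hard. Consider the K in Hot(A) such that every K → ΦZ is
annihilated by some Φφ with φ : Z → Z' of cone coacyclic over E (`rightKilled`). They form a
localizing subcategory. It contains the total complex of a short exact sequence
(`totalComplexes_le_rightKilled`): a morphism out of the total complex is null-homotopic as soon as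
its components on the first complex extend to the second, and pushouts followed by embeddings into E
enlarge the target until they do. So all coacyclic complexes belong to it; applied to the identity
of ΦZ with ΦZ coacyclic, this says that 0 : Z → Z' has cone coacyclic over E, and Z is then
coacyclic over E.

Part (b) is dual: contractible coverings, products, `leftKilled`, and `trW_of_telescope_fan`. -/

namespace ExactCat

/-! ### Localizations and infinite products -/

section LocalizationProducts

variable {C D : Type*} [Category* C] [Category* D] (L : C ⥤ D) (W : MorphismProperty C)
  [L.IsLocalization W] [W.HasLeftCalculusOfFractions] [W.HasRightCalculusOfFractions]
  {J : Type*} [W.IsStableUnderProductsOfShape J] [HasProductsOfShape J C]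

include W

/-- Together with `localization_pi_lift` this says that `L` preserves products of shape `J`. After
clearing denominators on the source, each projected equality is witnessed by some `s j` in `W`, and
the product of the `s j` witnesses all of them at once. -/
lemma localization_pi_hom_ext {X : J → C} {G : D} {f g : G ⟶ L.obj (∏ᶜ X)}
    (h : ∀ j, f ≫ L.map (Pi.π X j) = g ≫ L.map (Pi.π X j)) : f = g := by
  have := Localization.essSurj L W
  suffices H : ∀ (Y : C) (f g : L.obj Y ⟶ L.obj (∏ᶜ X)),
      (∀ j, f ≫ L.map (Pi.π X j) = g ≫ L.map (Pi.π X j)) → f = g by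
    rw [← cancel_epi (L.objObjPreimageIso G).hom]
    exact H _ _ _ fun j => by simp [h j]
  intro Y f g h
  obtain ⟨φ, hφ⟩ := Localization.exists_rightFraction L W f
  obtain ⟨ψ, hψ⟩ := Localization.exists_rightFraction L W (L.map φ.s ≫ g)
  have hψφ : L.map (ψ.s ≫ φ.f) = L.map ψ.f := by
    have h₁ (j : J) : ∃ (Z : C) (s : X j ⟶ Z) (_ : W s),
        (ψ.s ≫ φ.f) ≫ Pi.π X j ≫ s = ψ.f ≫ Pi.π X j ≫ s := by
      have : L.map ((ψ.s ≫ φ.f) ≫ Pi.π X j) = L.map (ψ.f ≫ Pi.π X j) := by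
        have e₁ : L.map φ.f = L.map φ.s ≫ f := by rw [hφ, φ.map_s_comp_map]
        have e₂ : L.map ψ.f = L.map ψ.s ≫ L.map φ.s ≫ g := by rw [hψ, ψ.map_s_comp_map]
        simp only [Functor.map_comp, e₁, e₂, assoc, h]
      obtain ⟨Z, s, hs, eq⟩ := (MorphismProperty.map_eq_iff_postcomp L W _ _).1 this
      exact ⟨Z, s, hs, by simpa using eq⟩
    choose Z s hs eq using h₁
    refine (MorphismProperty.map_eq_iff_postcomp L W _ _).2 ⟨∏ᶜ Z, Limits.Pi.map s, ?_, ?_⟩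
    · exact MorphismProperty.limMap _ (fun ⟨j⟩ => hs j)
    · refine Pi.hom_ext _ _ fun j => ?_
      simpa using eq j
  have e₁ : L.map φ.f = L.map φ.s ≫ f := by rw [hφ, φ.map_s_comp_map]
  have e₂ : L.map ψ.f = L.map ψ.s ≫ L.map φ.s ≫ g := by rw [hψ, ψ.map_s_comp_map]
  have := Localization.inverts L W φ.s φ.hs
  have := Localization.inverts L W ψ.s ψ.hs
  rw [← cancel_epi (L.map φ.s), ← cancel_epi (L.map ψ.s), ← e₂, ← hψφ, Functor.map_comp, e₁]

/-- Each component is a left fraction; the product of the denominators is still in `W`, so it serves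
as a common denominator. -/
lemma localization_pi_lift {X : J → C} {G : D} (f : ∀ j, G ⟶ L.obj (X j)) :
    ∃ g : G ⟶ L.obj (∏ᶜ X), ∀ j, g ≫ L.map (Pi.π X j) = f j := by
  have := Localization.essSurj L W
  suffices H : ∀ (Y : C) (f : ∀ j, L.obj Y ⟶ L.obj (X j)),
      ∃ g : L.obj Y ⟶ L.obj (∏ᶜ X), ∀ j, g ≫ L.map (Pi.π X j) = f j by
    obtain ⟨g, hg⟩ := H _ fun j => (L.objObjPreimageIso G).hom ≫ f j
    exact ⟨(L.objObjPreimageIso G).inv ≫ g, fun j => by simp [hg]⟩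
  intro Y f
  choose φ hφ using fun j => Localization.exists_leftFraction L W (f j)
  have hW : W (Limits.Pi.map fun j => (φ j).s) :=
    MorphismProperty.limMap _ (fun ⟨j⟩ => (φ j).hs)
  have := Localization.inverts L W _ hW
  refine ⟨L.map (Pi.lift fun j => (φ j).f) ≫ inv (L.map (Limits.Pi.map fun j => (φ j).s)),
    fun j => ?_⟩
  have := Localization.inverts L W _ (φ j).hs
  rw [← cancel_mono (L.map (φ j).s), hφ, (φ j).map_comp_map_s, assoc, assoc, ← L.map_comp,
    ← Limits.Pi.map_π (fun j => (φ j).s) j, L.map_comp, IsIso.inv_hom_id_assoc, ← L.map_comp, Pi.lift_π]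

end LocalizationProducts

/-! ### Triangulated subcategories closed under infinite products -/

section TriangulatedProducts

variable {T : Type*} [Category* T] [Preadditive T] [HasZeroObject T] [HasShift T ℤ]
  [∀ n : ℤ, (shiftFunctor T n).Additive] [Pretriangulated T]
  (N : ObjectProperty T) [N.IsTriangulated] [N.IsClosedUnderIsomorphisms]

lemma trW_isStableUnderProductsOfShape (J : Type*) [HasProductsOfShape J T]
    [N.IsClosedUnderLimitsOfShape (Discrete J)] : N.trW.IsStableUnderProductsOfShape J := by
  refine MorphismProperty.IsStableUnderProductsOfShape.mk _ _ ?_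
  intro X₁ X₂ _ _ f hf
  choose Z g h hT hZ using hf
  exact ObjectProperty.trW.mk _ (productTriangle_distinguished _ hT) (N.prop_limit _ fun ⟨j⟩ => hZ j)

/-- A triangulated subcategory closed under countable products is closed under direct
summands. -/
lemma isStableUnderRetracts_of_products [HasProductsOfShape ℕ T]
    [N.IsClosedUnderLimitsOfShape (Discrete ℕ)] : N.IsStableUnderRetracts where
  of_retract {X M} r hM := by
    let P : T := ∏ᶜ fun _ : ℕ => M
    have hP : N P := N.prop_limit _ fun _ => hM
    -- Eilenberg swindle without splitting off the complement of `X`. On the countable power `P` of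
    -- `M`, `t` keeps the `1 - e` parts and moves the `e` parts down one index, while `s` moves them
    -- back up; the `e` part lost at index 0 is exactly `X`, whence `P ≅ X ⊞ P`.
    let e : M ⟶ M := r.r ≫ r.i
    have hre : r.i ≫ e = r.i := by simp [e]
    have her : e ≫ r.r = r.r := by simp [e]
    have hee : e ≫ e = e := by simp [e]
    let t : P ⟶ P := Pi.lift fun n => Pi.π _ n ≫ (𝟙 M - e) + Pi.π _ (n + 1) ≫ e
    let u : X ⟶ P := Pi.lift fun n => if n = 0 then r.i else 0
    let s : P ⟶ P := Pi.lift fun n => Pi.π _ n ≫ (𝟙 M - e) +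
      (if n = 0 then 0 else Pi.π _ (n - 1) ≫ e)
    let φ : P ⟶ X ⊞ P := biprod.lift (Pi.π _ 0 ≫ r.r) t
    let ψ : X ⊞ P ⟶ P := biprod.desc u s
    have h₁ : φ ≫ ψ = 𝟙 P := by
      refine Pi.hom_ext _ _ fun n => ?_
      cases n with
      | zero => simp [φ, ψ, u, s, t, hee, e]
      | succ n => simp [φ, ψ, u, s, t, hee, Preadditive.comp_sub]
    have h₂ : ψ ≫ φ = 𝟙 _ := by
      ext n
      · simp [φ, ψ, u]
      · simp [φ, ψ, u, t, Preadditive.comp_sub]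
        split_ifs <;> simp [hre]
      · simp [φ, ψ, s, her, Preadditive.comp_sub, Preadditive.sub_comp]
      · cases n <;> simp [φ, ψ, s, t, hee, Preadditive.comp_sub, Preadditive.sub_comp]
    have hXP : N (X ⊞ P) := N.prop_of_iso ⟨φ, ψ, h₁, h₂⟩ hP
    exact N.ext_of_isTriangulatedClosed₁ _ (binaryBiproductTriangle_distinguished X P) hXP hP

variable [IsTriangulated T] [N.IsStableUnderRetracts]

/-- If the zero morphism from an object is inverted, the object belongs to the (thick)
subcategory. -/
lemma prop_of_trW_zero {X Y : T} (h : N.trW (0 : X ⟶ Y)) : N X := by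
  obtain ⟨Z, g, k, hT, hZ⟩ := h
  -- A zero first morphism makes the connecting morphism a split epimorphism, so `X⟦1⟧` is a retract
  -- of the cone.
  obtain ⟨r, hr⟩ := Triangle.coyoneda_exact₁ _ hT (𝟙 (X⟦(1 : ℤ)⟧))
    (by
    show 𝟙 _ ≫ (0 : X ⟶ Y)⟦(1 : ℤ)⟧' = 0
    simp)
  have : N (X⟦(1 : ℤ)⟧) := N.prop_of_retract ⟨r, k, hr.symm⟩ hZ
  exact (N.prop_shift_iff_of_isStableUnderShift _ _).1 this

lemma prop_of_isZero_verdierQ {X : T} (h : IsZero ((verdierQ N).obj X)) : N X := by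
  have : (verdierQ N).map (𝟙 X) = (verdierQ N).map (0 : X ⟶ X) := h.eq_of_src _ _
  obtain ⟨Y, s, hs, eq⟩ := (MorphismProperty.map_eq_iff_postcomp _ N.trW _ _).1 this
  have : s = 0 := by simpa using eq
  subst this
  exact prop_of_trW_zero N hs

/-- Thickness makes `N.trW` saturated: the cone becomes zero in the quotient, hence lies in `N`. -/
lemma trW_of_isIso_verdierQ {X Y : T} (f : X ⟶ Y) [IsIso ((verdierQ N).map f)] : N.trW f := by
  obtain ⟨Z, g, h, hT⟩ := distinguished_cocone_triangle f
  refine ⟨Z, g, h, hT, prop_of_isZero_verdierQ N ?_⟩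
  have := (verdierQ N).map_distinguished _ hT
  exact (Triangle.isZero₃_iff_isIso₁ _ this).2
    (inferInstanceAs (IsIso ((verdierQ N).map f)))

/-- The five lemma for triangles is applied in the quotient, where `N.trW` can be detected. -/
lemma trW₁_of_trW₂₃ {T₁ T₂ : Triangle T} (h₁ : T₁ ∈ distTriang T) (h₂ : T₂ ∈ distTriang T)
    (φ : T₁ ⟶ T₂) [IsIso ((verdierQ N).map φ.hom₂)] [IsIso ((verdierQ N).map φ.hom₃)] :
    N.trW φ.hom₁ := by
  have : IsIso ((verdierQ N).map φ.hom₁) :=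
    isIso₁_of_isIso₂₃ ((verdierQ N).mapTriangle.map φ) ((verdierQ N).map_distinguished _ h₁)
      ((verdierQ N).map_distinguished _ h₂) 
      (inferInstanceAs (IsIso ((verdierQ N).map φ.hom₂)))
      (inferInstanceAs (IsIso ((verdierQ N).map φ.hom₃)))
  exact trW_of_isIso_verdierQ N _

/-- A mapping telescope lemma: the "homotopy limit" of a zigzag
`A 0 ⟶ M 0 ⟵ A 1 ⟶ M 1 ⟵ A 2 ⟶ ...` in which the morphisms pointing to the left
have cones in `N` is isomorphic to `A 0` modulo `N`. -/
lemma trW_of_telescope [HasProductsOfShape ℕ T] [N.IsClosedUnderLimitsOfShape (Discrete ℕ)]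
    {A M : ℕ → T} (b : ∀ n, A (n + 1) ⟶ M n) (hb : ∀ n, N.trW (b n)) (c : ∀ n, A n ⟶ M n)
    (Ψ : ∏ᶜ A ⟶ ∏ᶜ M) (hΨ : ∀ n, Ψ ≫ Pi.π M n = Pi.π A n ≫ c n + Pi.π A (n + 1) ≫ b n)
    {K : T} (f : K ⟶ ∏ᶜ A) (h : ∏ᶜ M ⟶ K⟦(1 : ℤ)⟧) (hT : Triangle.mk f Ψ h ∈ distTriang T) :
    N.trW (f ≫ Pi.π A 0) := by
  let L := verdierQ N
  have := trW_isStableUnderProductsOfShape N ℕ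
  -- Modulo `N` this is invertible: since the `b n` are, the component in `A 0` and the image under
  -- `Ψ` determine all components of a morphism to `∏ᶜ A` recursively.
  let κ : ∏ᶜ A ⟶ A 0 ⊞ ∏ᶜ M := Pi.π A 0 ≫ biprod.inl + Ψ ≫ biprod.inr
  have hLb (n : ℕ) : IsIso (L.map (b n)) := Localization.inverts L N.trW _ (hb n)
  have hκ : IsIso (L.map κ) := by
    rw [isIso_iff_yoneda_map_bijective]
    intro G
    constructor
    · intro g g' hg
      dsimp at hg
      have h₀ : g ≫ L.map (Pi.π A 0) = g' ≫ L.map (Pi.π A 0) := by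
        simpa [κ, ← Functor.map_comp] using hg =≫ L.map biprod.fst
      have h₁ (n : ℕ) : g ≫ L.map (Ψ ≫ Pi.π M n) = g' ≫ L.map (Ψ ≫ Pi.π M n) := by
        simpa [κ, ← Functor.map_comp] using hg =≫ L.map (biprod.snd ≫ Pi.π M n)
      refine localization_pi_hom_ext L N.trW fun n => ?_
      induction n with
      | zero => exact h₀
      | succ n hn =>
        have := h₁ n
        simp only [hΨ, Functor.map_add, Functor.map_comp, Preadditive.comp_add,
          reassoc_of% hn, add_right_inj] at this
        simpa only [← assoc, cancel_mono] using this
    · intro y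
      -- Solves `Ψ g = y` one index at a time, dividing by `b n` to find the component in `A (n +
      -- 1)`.
      let g : ∀ n, G ⟶ L.obj (A n) := fun n => Nat.rec (y ≫ L.map biprod.fst)
        (fun n gn => (y ≫ L.map (biprod.snd ≫ Pi.π M n) - gn ≫ L.map (c n)) ≫
          inv (L.map (b n))) n
      obtain ⟨g', hg'⟩ := localization_pi_lift L N.trW g
      refine ⟨g', ?_⟩
      have h₁ : g' ≫ L.map (Pi.π A 0) = y ≫ L.map biprod.fst := hg' 0
      have h₂ : g' ≫ L.map Ψ = y ≫ L.map biprod.snd := by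
        refine localization_pi_hom_ext L N.trW fun n => ?_
        have h₃ : g' ≫ L.map (Pi.π A (n + 1)) = (y ≫ L.map (biprod.snd ≫ Pi.π M n) -
          g' ≫ L.map (Pi.π A n) ≫ L.map (c n)) ≫ inv (L.map (b n)) := by
          rw [← assoc g', hg' n, hg' (n + 1)]
        rw [assoc, ← L.map_comp, hΨ, L.map_add, L.map_comp, L.map_comp, Preadditive.comp_add,
          reassoc_of% h₃]
        simp
      dsimp
      simp only [κ, Functor.map_add, Functor.map_comp, Preadditive.comp_add, reassoc_of% h₁,
        reassoc_of% h₂]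
      simp only [← Functor.map_comp, ← Preadditive.comp_add, ← Functor.map_add, biprod.total]
      simp
  have hfΨ : f ≫ Ψ = 0 := comp_distTriang_mor_zero₁₂ _ hT
  have hhf : h ≫ f⟦(1 : ℤ)⟧' = 0 := comp_distTriang_mor_zero₃₁ _ hT
  -- Compares the telescope with the split triangle on `A 0` and `∏ᶜ M`; two of its three components
  -- are invertible modulo `N`.
  let φ : Triangle.mk f Ψ h ⟶ binaryBiproductTriangle (A 0) (∏ᶜ M) :=
    { hom₁ := f ≫ Pi.π A 0
      hom₂ := κ
      hom₃ := 𝟙 _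
      comm₁ := by
        show f ≫ κ = (f ≫ Pi.π A 0) ≫ biprod.inl
        simp [κ, reassoc_of% hfΨ]
      comm₂ := by
        show Ψ ≫ 𝟙 _ = κ ≫ biprod.snd
        simp [κ]
      comm₃ := by
        show h ≫ (f ≫ Pi.π A 0)⟦(1 : ℤ)⟧' = 𝟙 _ ≫ 0
        simp [reassoc_of% hhf] }
  have h₂ : IsIso ((verdierQ N).map φ.hom₂) := hκ
  have h₃ : IsIso ((verdierQ N).map φ.hom₃) := inferInstanceAs (IsIso ((verdierQ N).map (𝟙 (∏ᶜ M))))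
  exact trW₁_of_trW₂₃ N hT (binaryBiproductTriangle_distinguished _ _) φ

end TriangulatedProducts

/-! ### Telescopes for chosen products, and for coproducts through the opposite category -/

section TriangulatedCoproducts

variable {T : Type*} [Category* T] [Preadditive T] [HasZeroObject T] [HasShift T ℤ]
  [∀ n : ℤ, (shiftFunctor T n).Additive] [Pretriangulated T] [IsTriangulated T]
  (N : ObjectProperty T) [N.IsTriangulated] [N.IsClosedUnderIsomorphisms]

/-- The variant of `trW_of_telescope` for chosen products. -/
lemma trW_of_telescope_fan [N.IsStableUnderRetracts] [HasProductsOfShape ℕ T]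
    [N.IsClosedUnderLimitsOfShape (Discrete ℕ)]
    {A M : ℕ → T} (b : ∀ n, A (n + 1) ⟶ M n) (hb : ∀ n, N.trW (b n)) (c : ∀ n, A n ⟶ M n)
    {a : Fan A} (ha : IsLimit a) {m : Fan M} (hm : IsLimit m)
    (Ψ : a.pt ⟶ m.pt) (hΨ : ∀ n, Ψ ≫ m.proj n = a.proj n ≫ c n + a.proj (n + 1) ≫ b n)
    {K : T} (f : K ⟶ a.pt) (h : m.pt ⟶ K⟦(1 : ℤ)⟧) (hT : Triangle.mk f Ψ h ∈ distTriang T) :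
    N.trW (f ≫ a.proj 0) := by
  let eA : a.pt ≅ ∏ᶜ A := ha.conePointUniqueUpToIso (limit.isLimit _)
  let eM : m.pt ≅ ∏ᶜ M := hm.conePointUniqueUpToIso (limit.isLimit _)
  have hA (n : ℕ) : eA.hom ≫ Pi.π A n = a.proj n :=
    ha.conePointUniqueUpToIso_hom_comp (limit.isLimit _) ⟨n⟩
  have hA' (n : ℕ) : eA.inv ≫ a.proj n = Pi.π A n := by rw [← hA, eA.inv_hom_id_assoc]
  have hM (n : ℕ) : eM.hom ≫ Pi.π M n = m.proj n :=
    hm.conePointUniqueUpToIso_hom_comp (limit.isLimit _) ⟨n⟩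
  have hT' : Triangle.mk (f ≫ eA.hom) (eA.inv ≫ Ψ ≫ eM.hom) (eM.inv ≫ h) ∈ distTriang T := by
    refine isomorphic_distinguished _ hT _
      (Triangle.isoMk _ _ (Iso.refl _) eA.symm eM.symm ?_ ?_ ?_)
    · show (f ≫ eA.hom) ≫ eA.inv = 𝟙 _ ≫ f
      simp
    · show (eA.inv ≫ Ψ ≫ eM.hom) ≫ eM.inv = eA.inv ≫ Ψ
      simp
    · show (eM.inv ≫ h) ≫ (𝟙 K)⟦(1 : ℤ)⟧' = eM.inv ≫ h
      simp
  have := trW_of_telescope N b hb c _ (fun n => by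
    rw [assoc, assoc, hM, hΨ, Preadditive.comp_add, reassoc_of% hA', reassoc_of% hA']) _ _ hT'
  rwa [assoc, hA] at this

open Pretriangulated.Opposite

omit [IsTriangulated T] [N.IsTriangulated] [N.IsClosedUnderIsomorphisms] in
lemma op_isClosedUnderLimitsOfShape_discrete (J : Type*)
    [N.IsClosedUnderColimitsOfShape (Discrete J)] :
    N.op.IsClosedUnderLimitsOfShape (Discrete J) := by
  have : N.IsClosedUnderColimitsOfShape (Discrete J)ᵒᵖ :=
    ObjectProperty.IsClosedUnderColimitsOfShape.of_equivalence (Discrete.opposite J).symm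
  infer_instance

/-- A triangulated subcategory closed under countable coproducts is closed under direct
summands. -/
lemma isStableUnderRetracts_of_coproducts [HasCoproductsOfShape ℕ T]
    [N.IsClosedUnderColimitsOfShape (Discrete ℕ)] : N.IsStableUnderRetracts where
  of_retract {X Y} r hY := by
    have := op_isClosedUnderLimitsOfShape_discrete N ℕ
    have := isStableUnderRetracts_of_products N.op
    exact N.op.prop_of_retract (Y := Opposite.op Y) (X := Opposite.op X)
      ⟨r.r.op, r.i.op, by rw [← op_comp, r.retract, op_id]⟩ hY

/-- The dual of `trW_of_telescope_fan`. -/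
lemma trW_of_telescope_cofan [HasCoproductsOfShape ℕ T]
    [N.IsClosedUnderColimitsOfShape (Discrete ℕ)]
    {A M : ℕ → T} (b : ∀ n, M n ⟶ A (n + 1)) (hb : ∀ n, N.trW (b n)) (c : ∀ n, M n ⟶ A n)
    {a : Cofan A} (ha : IsColimit a) {m : Cofan M} (hm : IsColimit m)
    (Ψ : m.pt ⟶ a.pt) (hΨ : ∀ n, m.inj n ≫ Ψ = c n ≫ a.inj n + b n ≫ a.inj (n + 1))
    {K : T} (f : a.pt ⟶ K) (h : K ⟶ m.pt⟦(1 : ℤ)⟧) (hT : Triangle.mk Ψ f h ∈ distTriang T) :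
    N.trW (a.inj 0 ≫ f) := by
  have := op_isClosedUnderLimitsOfShape_discrete N ℕ
  have := isStableUnderRetracts_of_products N.op
  have := trW_of_telescope_fan N.op (fun n => (b n).op) (fun n => by
      rw [ObjectProperty.trW_op_iff]; exact hb n) (fun n => (c n).op)
      (Cofan.IsColimit.op ha) (Cofan.IsColimit.op hm) Ψ.op (fun n => by
        exact congrArg Quiver.Hom.op (hΨ n)) f.op _ (op_distinguished _ hT)
  rw [ObjectProperty.trW_op_iff] at this
  exact this

end TriangulatedCoproducts

/-! ### Localizing on a full subcategory that admits resolutions -/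

section FullSubcategoryLocalization

variable {C C' D : Type*} [Category* C] [Category* C'] [Category* D] (F : C' ⥤ C) [F.Full]
  [F.Faithful] (L : C ⥤ D) (W : MorphismProperty C) [L.IsLocalization W]

/-- The localization of a category can be computed on a full subcategory which is "right
localizing". -/
lemma isLocalization_of_right_resolutions [W.HasLeftCalculusOfFractions]
    [(W.inverseImage F).HasLeftCalculusOfFractions]
    (h : ∀ X : C, ∃ (Z : C') (s : X ⟶ F.obj Z), W s) :
    (F ⋙ L).IsLocalization (W.inverseImage F) := by
  have hinv : (W.inverseImage F).IsInvertedBy (F ⋙ L) := fun _ _ f hf =>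
    Localization.inverts L W _ hf
  let Q := (W.inverseImage F).Q
  let G := Localization.lift (F ⋙ L) hinv Q
  let e : Q ⋙ G ≅ F ⋙ L := Localization.fac _ hinv Q
  have hQ := Localization.essSurj Q (W.inverseImage F)
  have hL := Localization.essSurj L W
  have : G.EssSurj := ⟨fun Y => by
    obtain ⟨Z, s, hs⟩ := h (L.objPreimage Y)
    have := Localization.inverts L W s hs
    exact ⟨Q.obj Z, ⟨e.app Z ≪≫ (asIso (L.map s)).symm ≪≫ L.objObjPreimageIso Y⟩⟩⟩
  -- A left fraction between objects of the subcategory may have its middle term outside; composing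
  -- with a resolution of that term moves the fraction inside.
  have key {X Y : C'} (g : L.obj (F.obj X) ⟶ L.obj (F.obj Y)) :
      ∃ φ : (W.inverseImage F).LeftFraction X Y,
        g ≫ L.map (F.map φ.s) = L.map (F.map φ.f) := by
    obtain ⟨φ, rfl⟩ := Localization.exists_leftFraction L W g
    obtain ⟨Z, s, hs⟩ := h φ.Y'
    refine ⟨⟨F.preimage (φ.f ≫ s), F.preimage (φ.s ≫ s), ?_⟩, ?_⟩
    · simpa using W.comp_mem _ _ φ.hs hs
    · simp
  have : G.Full := ⟨fun {X Y} g => by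
    let X₀ := Q.objPreimage X
    let Y₀ := Q.objPreimage Y
    let eX : Q.obj X₀ ≅ X := Q.objObjPreimageIso X
    let eY : Q.obj Y₀ ≅ Y := Q.objObjPreimageIso Y
    obtain ⟨φ, hφ⟩ := key (e.inv.app X₀ ≫ G.map eX.hom ≫ g ≫ G.map eY.inv ≫ e.hom.app Y₀)
    have := Localization.inverts Q _ φ.s φ.hs
    refine ⟨eX.inv ≫ Q.map φ.f ≫ inv (Q.map φ.s) ≫ eY.hom, ?_⟩
    have h₁ : G.map (Q.map φ.f) =
        (G.map eX.hom ≫ g ≫ G.map eY.inv) ≫ G.map (Q.map φ.s) := by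
      have n₁ := e.hom.naturality φ.f
      have n₂ := e.hom.naturality φ.s
      dsimp at n₁ n₂
      rw [← cancel_mono (e.hom.app _), n₁, ← hφ]
      simp [n₂]
    simp only [Functor.map_comp, h₁, assoc]
    simp only [← Functor.map_comp_assoc, ← Functor.map_comp]
    simp⟩
  have : G.Faithful := ⟨fun {X Y} g g' hg => by
    let X₀ := Q.objPreimage X
    let Y₀ := Q.objPreimage Y
    let eX : Q.obj X₀ ≅ X := Q.objObjPreimageIso X
    let eY : Q.obj Y₀ ≅ Y := Q.objObjPreimageIso Y
    suffices H : ∀ (a b : Q.obj X₀ ⟶ Q.obj Y₀), G.map a = G.map b → a = b by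
      have := H (eX.hom ≫ g ≫ eY.inv) (eX.hom ≫ g' ≫ eY.inv) (by simp [hg])
      simpa using this
    intro a b hab
    obtain ⟨φ, ψ, eq, hs, ha, hb⟩ : ∃ (φ : (W.inverseImage F).LeftFraction X₀ Y₀)
      (g : X₀ ⟶ φ.Y') (_ : True) (_ : True), a ≫ Q.map φ.s = Q.map φ.f ∧ b ≫ Q.map φ.s = Q.map g := by
      obtain ⟨φ, rfl, rfl⟩ := Localization.exists_leftFraction₂ Q (W.inverseImage F) a b
      have := Localization.inverts Q _ φ.s φ.hs
      exact ⟨φ.fst, φ.f', trivial, trivial, φ.fst.map_comp_map_s Q _, φ.snd.map_comp_map_s Q _⟩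
    have := Localization.inverts Q _ φ.s φ.hs
    have hE : L.map (F.map φ.f) = L.map (F.map ψ) := by
      have : G.map (Q.map φ.f) = G.map (Q.map ψ) := by rw [← ha, ← hb]; simp [hab]
      have n₁ := e.hom.naturality φ.f
      have n₂ := e.hom.naturality ψ
      dsimp at n₁ n₂
      rw [← cancel_epi (e.hom.app _), ← n₁, ← n₂, this]
    -- An equality in the localization is witnessed by a morphism in `W`, whose target is again
    -- replaced by one from the subcategory.
    obtain ⟨Z, t, ht, hZ⟩ := (MorphismProperty.map_eq_iff_postcomp L W _ _).1 hE
    obtain ⟨Z', s, hs⟩ := h Z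
    have hZ' : φ.f ≫ F.preimage (t ≫ s) = ψ ≫ F.preimage (t ≫ s) :=
      F.map_injective (by simp [reassoc_of% hZ])
    rw [← cancel_mono (Q.map φ.s), ha, hb]
    exact (MorphismProperty.map_eq_iff_postcomp Q (W.inverseImage F) _ _).2
      ⟨_, F.preimage (t ≫ s), by simpa using W.comp_mem _ _ ht hs, hZ'⟩⟩
  have : G.IsEquivalence := { }
  exact Functor.IsLocalization.of_equivalence_target Q _ _ G.asEquivalence e

lemma isLocalization_of_left_resolutions [W.HasRightCalculusOfFractions]
    [(W.inverseImage F).HasRightCalculusOfFractions]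
    (h : ∀ X : C, ∃ (Z : C') (s : F.obj Z ⟶ X), W s) :
    (F ⋙ L).IsLocalization (W.inverseImage F) := by
  rw [← Functor.IsLocalization.op_iff]
  have : (W.op.inverseImage F.op).HasLeftCalculusOfFractions :=
    inferInstanceAs ((W.inverseImage F).op.HasLeftCalculusOfFractions)
  exact isLocalization_of_right_resolutions F.op L.op W.op fun X => by
    obtain ⟨Z, s, hs⟩ := h X.unop
    exact ⟨.op Z, s.op, hs⟩

end FullSubcategoryLocalization

/-! ### Functors induced on Verdier quotients -/

section Induced

variable {T : Type u} [Category.{v} T] [Preadditive T] [HasZeroObject T] [HasShift T ℤ]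
  [∀ n : ℤ, (shiftFunctor T n).Additive] [Pretriangulated T] [IsTriangulated T]
  {T' : Type u'} [Category.{v'} T'] [Preadditive T'] [HasZeroObject T'] [HasShift T' ℤ]
  [∀ n : ℤ, (shiftFunctor T' n).Additive] [Pretriangulated T'] [IsTriangulated T']
  (Φ : T ⥤ T') [Φ.CommShift ℤ] [Φ.IsTriangulated] (N : ObjectProperty T) [N.IsTriangulated]
  (N' : ObjectProperty T') [N'.IsTriangulated]

include N N' in
lemma isInvertedBy_of_le [N'.IsClosedUnderIsomorphisms] (h : N ≤ N'.inverseImage Φ) :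
    N.trW.IsInvertedBy (Φ ⋙ verdierQ N') := fun _ _ f hf =>
  N'.inverseImage_trW_isInverted Φ _ f (ObjectProperty.trW_monotone h _ hf)

lemma nonempty_inducedFunctor [N'.IsClosedUnderIsomorphisms] (h : N ≤ N'.inverseImage Φ) :
    Nonempty (InducedFunctor Φ N N') := by
  have hinv := isInvertedBy_of_le Φ N N' h
  let G := Localization.lift (Φ ⋙ verdierQ N') hinv (verdierQ N)
  let _ : G.CommShift ℤ :=
    Functor.commShiftOfLocalization (verdierQ N) N.trW ℤ (Φ ⋙ verdierQ N') G
  have hc : NatTrans.CommShift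
      (Localization.Lifting.iso (verdierQ N) N.trW (Φ ⋙ verdierQ N') G).hom ℤ :=
    NatTrans.commShift_iso_hom_of_localization _ _ _ _ _
  have := Localization.essSurj_mapArrow (verdierQ N) N.trW
  have : G.IsTriangulated := Functor.isTriangulated_of_precomp_iso
    (Localization.Lifting.iso (verdierQ N) N.trW (Φ ⋙ verdierQ N') G)
  exact ⟨⟨G, inferInstance, this, _, hc⟩⟩

variable {Φ N N'} in
-- Source and target are then both localizations of `T` at the same class, compatibly with the
-- functor.
lemma isEquivalence_inducedFunctor (G : InducedFunctor Φ N N')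
    [(Φ ⋙ verdierQ N').IsLocalization N.trW] : G.functor.IsEquivalence := by
  have := Functor.IsLocalization.of_iso N.trW G.iso.symm
  let e := Localization.uniq (verdierQ N) (verdierQ N ⋙ G.functor) N.trW
  exact Functor.isEquivalence_of_iso (F := e.functor) (Localization.liftNatIso (verdierQ N) N.trW
    (verdierQ N ⋙ G.functor) (verdierQ N ⋙ G.functor) _ _ (Iso.refl _))

variable {Φ N N'} in
-- The composite `T ⥤ T/N ⥤ T'/N'` is a localization and so is its first factor, hence so is the
-- second, at the image of the larger class. That image is the class of morphisms inverted by
-- `G.functor`, which are those with cone in its kernel.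
lemma isVerdierQuotientFunctor_inducedFunctor (G : InducedFunctor Φ N N')
    [N'.IsClosedUnderIsomorphisms] [N'.IsStableUnderRetracts] (h : N ≤ N'.inverseImage Φ)
    [(Φ ⋙ verdierQ N').IsLocalization (N'.inverseImage Φ).trW] :
    IsVerdierQuotientFunctor G.functor := by
  have := Functor.IsLocalization.of_iso (N'.inverseImage Φ).trW G.iso.symm
  have hker {X Y : VerdierQuotient N} (f : X ⟶ Y) :
      G.functor.kernel.trW f ↔ IsIso (G.functor.map f) := by
    obtain ⟨Z, g, k, hT⟩ := distinguished_cocone_triangle f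
    refine (G.functor.kernel.trW_iff_of_distinguished _ hT).trans ?_
    exact Triangle.isZero₃_iff_isIso₁ _ (G.functor.map_distinguished _ hT)
  have hiso {X Y : T} (f : X ⟶ Y) :
      IsIso (G.functor.map ((verdierQ N).map f)) ↔ (N'.inverseImage Φ).trW f := by
    rw [← Functor.comp_map, NatIso.isIso_map_iff G.iso]
    refine ⟨fun hf => ?_, fun hf => ?_⟩
    · have : IsIso ((verdierQ N').map (Φ.map f)) := hf
      rw [ObjectProperty.inverseImage_trW_iff]
      exact trW_of_isIso_verdierQ N' _
    · exact Localization.inverts (Φ ⋙ verdierQ N') (N'.inverseImage Φ).trW f hf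
  refine Functor.IsLocalization.of_comp (verdierQ N) G.functor N.trW _ (N'.inverseImage Φ).trW
    (ObjectProperty.trW_monotone h) ?_
  have := Localization.essSurj_mapArrow (verdierQ N) N.trW
  ext X Y f
  rw [hker]
  constructor
  · intro hf
    -- Every morphism of `T/N` is, up to isomorphism of arrows, the image of one of `T`, where
    -- invertibility can be tested by `hiso`.
    let f' := (verdierQ N).mapArrow.objPreimage (Arrow.mk f)
    let e : Arrow.mk ((verdierQ N).map f'.hom) ≅ Arrow.mk f :=
      (verdierQ N).mapArrow.objObjPreimageIso (Arrow.mk f)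
    refine ⟨_, _, f'.hom, ?_, ⟨e⟩⟩
    rw [← hiso]
    exact ((MorphismProperty.isomorphisms _).arrow_mk_iso_iff
      (G.functor.mapArrow.mapIso e)).2 hf
  · rintro ⟨_, _, f', hf', ⟨e⟩⟩
    rw [← hiso] at hf'
    exact ((MorphismProperty.isomorphisms _).arrow_mk_iso_iff
      (G.functor.mapArrow.mapIso e)).1 hf'

variable [Φ.Full] [Φ.Faithful] [N'.IsClosedUnderIsomorphisms]

lemma isLocalization_of_trW_right (h : ∀ X : T', ∃ (Z : T) (s : X ⟶ Φ.obj Z), N'.trW s) :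
    (Φ ⋙ verdierQ N').IsLocalization (N'.inverseImage Φ).trW := by
  have e : (N'.inverseImage Φ).trW = N'.trW.inverseImage Φ := by
    ext X Y f
    exact N'.inverseImage_trW_iff Φ f
  have : (N'.trW.inverseImage Φ).HasLeftCalculusOfFractions := by
    rw [← e]
    infer_instance
  rw [e]
  exact isLocalization_of_right_resolutions Φ _ _ h

lemma isLocalization_of_trW_left (h : ∀ X : T', ∃ (Z : T) (s : Φ.obj Z ⟶ X), N'.trW s) :
    (Φ ⋙ verdierQ N').IsLocalization (N'.inverseImage Φ).trW := by
  have e : (N'.inverseImage Φ).trW = N'.trW.inverseImage Φ := by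
    ext X Y f
    exact N'.inverseImage_trW_iff Φ f
  have : (N'.trW.inverseImage Φ).HasRightCalculusOfFractions := by
    rw [← e]
    infer_instance
  rw [e]
  exact isLocalization_of_left_resolutions Φ _ _ h

end Induced

/-! ### Products and coproducts in the homotopy category -/

section HotProducts

variable {C : Type u} [Category.{v} C] [Preadditive C]

open CochainComplex HomComplex

/-- The quotient functor from complexes to the homotopy category. -/
abbrev hotQ (C : Type u) [Category.{v} C] [Preadditive C] : CochainComplex C ℤ ⥤ Hot C :=
  HomotopyCategory.quotient C (ComplexShape.up ℤ)

variable [HasBinaryBiproducts C]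

lemma isZero_hotQ_mappingCone_id (K : CochainComplex C ℤ) :
    IsZero ((hotQ C).obj (mappingCone (𝟙 K))) := by
  rw [IsZero.iff_id_eq_zero, ← (hotQ C).map_id]
  exact (HomotopyCategory.quotient_map_eq_zero_iff _).2 ⟨mappingCone.homotopyToZeroOfId K⟩

lemma isZero_hotQ_mappingCocone_id [HasZeroObject C] (K : CochainComplex C ℤ) :
    IsZero ((hotQ C).obj (mappingCocone (𝟙 K))) :=
  (((CategoryTheory.shiftFunctor (Hot C) (-1 : ℤ)).map_isZero (isZero_hotQ_mappingCone_id K)).of_iso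
    (((hotQ C).commShiftIso (-1 : ℤ)).app _))

/-- A null-homotopy is an actual factorization through a contractible complex. In this form
infinitely many null-homotopies can be assembled by the universal property of a product;
`exists_mappingCocone_id_fac` serves coproducts. -/
lemma exists_mappingCone_id_fac {K L : CochainComplex C ℤ} {f : K ⟶ L}
    (hf : (hotQ C).map f = 0) :
    ∃ g : mappingCone (𝟙 K) ⟶ L, mappingCone.inr (𝟙 K) ≫ g = f := by
  obtain ⟨h⟩ := (HomotopyCategory.quotient_map_eq_zero_iff _).1 hf
  obtain ⟨z, hz⟩ := Cochain.equivHomotopy _ _ h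
  exact ⟨mappingCone.desc _ z f (by rw [id_comp, hz, Cochain.ofHom_zero, add_zero]),
    mappingCone.inr_desc _ _ _ _⟩

lemma exists_mappingCocone_id_fac {K L : CochainComplex C ℤ} {f : K ⟶ L}
    (hf : (hotQ C).map f = 0) :
    ∃ g : K ⟶ mappingCocone (𝟙 L), g ≫ mappingCocone.fst (𝟙 L) = f := by
  obtain ⟨h⟩ := (HomotopyCategory.quotient_map_eq_zero_iff _).1 hf
  obtain ⟨z, hz⟩ := Cochain.equivHomotopy _ _ h
  exact ⟨mappingCocone.lift (𝟙 L) f (-z) (by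
      rw [δ_neg, comp_id, hz, Cochain.ofHom_zero, add_zero, neg_add_cancel]),
    mappingCocone.lift_fst _ _ _ _⟩

variable {J : Type w} {K : J → CochainComplex C ℤ}

/-- Coproducts of complexes are coproducts in the homotopy category. -/
lemma nonempty_isColimit_hotQ_cofan [HasZeroObject C] {c : Cofan K} (hc : IsColimit c) :
    Nonempty (IsColimit (Cofan.mk ((hotQ C).obj c.pt) fun j => (hotQ C).map (c.inj j))) := by
  have hom_ext {L : Hot C} (f g : (hotQ C).obj c.pt ⟶ L)
      (h : ∀ j, (hotQ C).map (c.inj j) ≫ f = (hotQ C).map (c.inj j) ≫ g) : f = g := by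
    suffices H : ∀ (L : CochainComplex C ℤ) (f : (hotQ C).obj c.pt ⟶ (hotQ C).obj L),
        (∀ j, (hotQ C).map (c.inj j) ≫ f = 0) → f = 0 by
      rw [← sub_eq_zero]
      obtain ⟨L, rfl⟩ := HomotopyCategory.quotient_obj_surjective L
      exact H L _ fun j => by rw [Preadditive.comp_sub, h, sub_self]
    intro L f hf
    obtain ⟨f, rfl⟩ := (hotQ C).map_surjective f
    choose g hg using fun j => exists_mappingCocone_id_fac
      (f := c.inj j ≫ f) (by rw [Functor.map_comp, hf])
    -- The factorizations on the summands share the contractible target `mappingCocone (𝟙 L)`, so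
    -- they glue to one factorization of `f`.
    have hf' : Cofan.IsColimit.desc hc g ≫ mappingCocone.fst (𝟙 L) = f :=
      Cofan.IsColimit.hom_ext hc _ _ fun j => by
        rw [Cofan.IsColimit.fac_assoc, hg]
    rw [← hf', Functor.map_comp, (isZero_hotQ_mappingCocone_id L).eq_of_tgt
      ((hotQ C).map (Cofan.IsColimit.desc hc g)) 0, zero_comp]
  have hdesc {L : Hot C} (f : ∀ j, (hotQ C).obj (K j) ⟶ L) :
      ∃ g : (hotQ C).obj c.pt ⟶ L, ∀ j, (hotQ C).map (c.inj j) ≫ g = f j := by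
    obtain ⟨L, rfl⟩ := HomotopyCategory.quotient_obj_surjective L
    choose f' hf' using fun j => (hotQ C).map_surjective (f j)
    refine ⟨(hotQ C).map (Cofan.IsColimit.desc hc f'), fun j => ?_⟩
    rw [← Functor.map_comp, Cofan.IsColimit.fac, hf']
  refine ⟨Cofan.IsColimit.mk _ (fun s => (hdesc s.inj).choose) (fun s j => (hdesc s.inj).choose_spec j)
    fun s m hm => hom_ext _ _ fun j => ?_⟩
  exact (hm j).trans ((hdesc s.inj).choose_spec j).symm

/-- Products of complexes are products in the homotopy category. -/
lemma nonempty_isLimit_hotQ_fan {c : Fan K} (hc : IsLimit c) :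
    Nonempty (IsLimit (Fan.mk ((hotQ C).obj c.pt) fun j => (hotQ C).map (c.proj j))) := by
  have hom_ext {L : Hot C} (f g : L ⟶ (hotQ C).obj c.pt)
      (h : ∀ j, f ≫ (hotQ C).map (c.proj j) = g ≫ (hotQ C).map (c.proj j)) : f = g := by
    suffices H : ∀ (L : CochainComplex C ℤ) (f : (hotQ C).obj L ⟶ (hotQ C).obj c.pt),
        (∀ j, f ≫ (hotQ C).map (c.proj j) = 0) → f = 0 by
      rw [← sub_eq_zero]
      obtain ⟨L, rfl⟩ := HomotopyCategory.quotient_obj_surjective L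
      exact H L _ fun j => by rw [Preadditive.sub_comp, h, sub_self]
    intro L f hf
    obtain ⟨f, rfl⟩ := (hotQ C).map_surjective f
    choose g hg using fun j => exists_mappingCone_id_fac
      (f := f ≫ c.proj j) (by rw [Functor.map_comp, hf])
    have hf' : mappingCone.inr (𝟙 L) ≫ Fan.IsLimit.lift hc g = f :=
      Fan.IsLimit.hom_ext hc _ _ fun j => by
        rw [assoc, Fan.IsLimit.fac, hg]
    rw [← hf', Functor.map_comp, (isZero_hotQ_mappingCone_id L).eq_of_src
      ((hotQ C).map (Fan.IsLimit.lift hc g)) 0, comp_zero]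
  have hdesc {L : Hot C} (f : ∀ j, L ⟶ (hotQ C).obj (K j)) :
      ∃ g : L ⟶ (hotQ C).obj c.pt, ∀ j, g ≫ (hotQ C).map (c.proj j) = f j := by
    obtain ⟨L, rfl⟩ := HomotopyCategory.quotient_obj_surjective L
    choose f' hf' using fun j => (hotQ C).map_surjective (f j)
    refine ⟨(hotQ C).map (Fan.IsLimit.lift hc f'), fun j => ?_⟩
    rw [← Functor.map_comp, Fan.IsLimit.fac, hf']
  refine ⟨Fan.IsLimit.mk _ (fun s => (hdesc s.proj).choose) (fun s j => (hdesc s.proj).choose_spec j)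
    fun s m hm => hom_ext _ _ fun j => ?_⟩
  exact (hm j).trans ((hdesc s.proj).choose_spec j).symm

variable (C)

instance hasCoproductsOfShape_hot [HasZeroObject C] (J : Type w) [HasCoproductsOfShape J C] :
    HasCoproductsOfShape J (Hot C) where
  has_colimit F := by
    let K : J → CochainComplex C ℤ := fun j => (F.obj ⟨j⟩).as
    have : HasColimit (Discrete.functor (F.obj ∘ Discrete.mk)) :=
      ⟨⟨_, (nonempty_isColimit_hotQ_cofan (colimit.isColimit (Discrete.functor K))).some⟩⟩
    exact hasColimit_of_iso Discrete.natIsoFunctor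

instance hasProductsOfShape_hot (J : Type w) [HasProductsOfShape J C] :
    HasProductsOfShape J (Hot C) where
  has_limit F := by
    let K : J → CochainComplex C ℤ := fun j => (F.obj ⟨j⟩).as
    have : HasLimit (Discrete.functor (F.obj ∘ Discrete.mk)) :=
      ⟨⟨_, (nonempty_isLimit_hotQ_fan (limit.isLimit (Discrete.functor K))).some⟩⟩
    exact hasLimit_of_iso Discrete.natIsoFunctor.symm

variable {C}

lemma hot_isClosedUnderColimitsOfShape [HasZeroObject C] {J : Type w} [HasCoproductsOfShape J C]
    (P : ObjectProperty (Hot C)) [P.IsClosedUnderIsomorphisms]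
    (h : ∀ (K : J → CochainComplex C ℤ), (∀ j, P ((hotQ C).obj (K j))) →
      P ((hotQ C).obj (∐ K))) : P.IsClosedUnderColimitsOfShape (Discrete J) where
  colimitsOfShape_le := by
    rintro X ⟨hX⟩
    let K : J → CochainComplex C ℤ := fun j => (hX.diag.obj ⟨j⟩).as
    obtain ⟨hc⟩ := nonempty_isColimit_hotQ_cofan (coproductIsCoproduct K)
    exact P.prop_of_iso (IsColimit.coconePointsIsoOfNatIso hc hX.isColimit
      Discrete.natIsoFunctor.symm) (h K fun j => hX.prop_diag_obj ⟨j⟩)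

lemma hot_isClosedUnderLimitsOfShape {J : Type w} [HasProductsOfShape J C]
    (P : ObjectProperty (Hot C)) [P.IsClosedUnderIsomorphisms]
    (h : ∀ (K : J → CochainComplex C ℤ), (∀ j, P ((hotQ C).obj (K j))) →
      P ((hotQ C).obj (∏ᶜ K))) : P.IsClosedUnderLimitsOfShape (Discrete J) where
  limitsOfShape_le := by
    rintro X ⟨hX⟩
    let K : J → CochainComplex C ℤ := fun j => (hX.diag.obj ⟨j⟩).as
    obtain ⟨hc⟩ := nonempty_isLimit_hotQ_fan (productIsProduct K)
    exact P.prop_of_iso (IsLimit.conePointsIsoOfNatIso hc hX.isLimit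
      Discrete.natIsoFunctor.symm) (h K fun j => hX.prop_diag_obj ⟨j⟩)

lemma prop_hotQ_of_isColimit [HasZeroObject C] {J : Type w} (P : ObjectProperty (Hot C))
    [P.IsClosedUnderColimitsOfShape (Discrete J)] {K : J → CochainComplex C ℤ} {c : Cofan K}
    (hc : IsColimit c) (h : ∀ j, P ((hotQ C).obj (K j))) : P ((hotQ C).obj c.pt) := by
  obtain ⟨hc'⟩ := nonempty_isColimit_hotQ_cofan hc
  exact P.prop_of_isColimit hc' fun ⟨j⟩ => h j

lemma prop_hotQ_of_isLimit {J : Type w} (P : ObjectProperty (Hot C))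
    [P.IsClosedUnderLimitsOfShape (Discrete J)] {K : J → CochainComplex C ℤ} {c : Fan K}
    (hc : IsLimit c) (h : ∀ j, P ((hotQ C).obj (K j))) : P ((hotQ C).obj c.pt) := by
  obtain ⟨hc'⟩ := nonempty_isLimit_hotQ_fan hc
  exact P.prop_of_isLimit hc' fun ⟨j⟩ => h j

end HotProducts

/-! ### Compatibility of the inclusion with products and coproducts -/

section HotInclusion

variable {C : Type u} [Category.{v} C] [Preadditive C] [HasZeroObject C]
  [HasBinaryBiproducts C] [ExactCategory C] (E : ObjectProperty C) [IsExtensionClosed E]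

/-- The inclusion functor on complexes. -/
abbrev chInclusion : CochainComplex E.FullSubcategory ℤ ⥤ CochainComplex C ℤ :=
  E.ι.mapHomologicalComplex (ComplexShape.up ℤ)

instance preservesColimits_chInclusion (J : Type w) [HasCoproductsOfShape J C]
    [E.IsClosedUnderColimitsOfShape (Discrete J)] :
    PreservesColimitsOfShape (Discrete J) (chInclusion E) :=
  HomologicalComplex.preservesColimitsOfShape_of_eval _ fun i =>
    inferInstanceAs (PreservesColimitsOfShape (Discrete J)
      (HomologicalComplex.eval _ (ComplexShape.up ℤ) i ⋙ E.ι))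

instance preservesLimits_chInclusion (J : Type w) [HasProductsOfShape J C]
    [E.IsClosedUnderLimitsOfShape (Discrete J)] :
    PreservesLimitsOfShape (Discrete J) (chInclusion E) :=
  HomologicalComplex.preservesLimitsOfShape_of_eval _ fun i =>
    inferInstanceAs (PreservesLimitsOfShape (Discrete J)
      (HomologicalComplex.eval _ (ComplexShape.up ℤ) i ⋙ E.ι))

variable (P : ObjectProperty (Hot C)) [P.IsClosedUnderIsomorphisms] (J : Type w)

lemma inverseImage_hotInclusion_isClosedUnderColimitsOfShape [HasCoproductsOfShape J C]
    [E.IsClosedUnderColimitsOfShape (Discrete J)] [P.IsClosedUnderColimitsOfShape (Discrete J)] :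
    (P.inverseImage (hotInclusion E)).IsClosedUnderColimitsOfShape (Discrete J) :=
  hot_isClosedUnderColimitsOfShape _ fun K hK =>
    prop_hotQ_of_isColimit P (isColimitCofanMkObjOfIsColimit (chInclusion E) _ _
      (coproductIsCoproduct K)) hK

lemma inverseImage_hotInclusion_isClosedUnderLimitsOfShape [HasProductsOfShape J C]
    [E.IsClosedUnderLimitsOfShape (Discrete J)] [P.IsClosedUnderLimitsOfShape (Discrete J)] :
    (P.inverseImage (hotInclusion E)).IsClosedUnderLimitsOfShape (Discrete J) :=
  hot_isClosedUnderLimitsOfShape _ fun K hK =>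
    prop_hotQ_of_isLimit P (isLimitFanMkObjOfIsLimit (chInclusion E) _ _
      (productIsProduct K)) hK

end HotInclusion

/-! ### Closure properties of coacyclic and contraacyclic complexes -/

section Coacyclic

variable (C : Type u) [Category.{v} C] [Preadditive C] [HasZeroObject C]
  [HasBinaryBiproducts C] [ExactCategory C]

lemma isLocalizing_coacyclic : IsLocalizing.{w} (coacyclic.{w} C) where
  isTriangulated := inferInstance
  isClosedUnderIsomorphisms := ⟨fun e hX P hP =>
    have := hP.1.isClosedUnderIsomorphisms
    P.prop_of_iso e (hX P hP)⟩
  coproducts J := ⟨by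
    rintro X ⟨hX⟩ P hP
    have := hP.1.coproducts J
    exact P.prop_of_isColimit hX.isColimit fun j => hX.prop_diag_obj j P hP⟩

lemma isColocalizing_contraacyclic : IsColocalizing.{w} (contraacyclic.{w} C) where
  isTriangulated := inferInstance
  isClosedUnderIsomorphisms := ⟨fun e hX P hP =>
    have := hP.1.isClosedUnderIsomorphisms
    P.prop_of_iso e (hX P hP)⟩
  products J := ⟨by
    rintro X ⟨hX⟩ P hP
    have := hP.1.products J
    exact P.prop_of_isLimit hX.isLimit fun j => hX.prop_diag_obj j P hP⟩

instance : (coacyclic.{w} C).IsClosedUnderIsomorphisms :=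
  (isLocalizing_coacyclic C).isClosedUnderIsomorphisms

instance : (contraacyclic.{w} C).IsClosedUnderIsomorphisms :=
  (isColocalizing_contraacyclic C).isClosedUnderIsomorphisms

instance (J : Type w) : (coacyclic.{w} C).IsClosedUnderColimitsOfShape (Discrete J) :=
  (isLocalizing_coacyclic C).coproducts J

instance (J : Type w) : (contraacyclic.{w} C).IsClosedUnderLimitsOfShape (Discrete J) :=
  (isColocalizing_contraacyclic C).products J

instance : (coacyclic.{w} C).IsClosedUnderColimitsOfShape (Discrete ℕ) :=
  .of_equivalence (Discrete.equivalence Equiv.ulift.{w})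

instance : (contraacyclic.{w} C).IsClosedUnderLimitsOfShape (Discrete ℕ) :=
  .of_equivalence (Discrete.equivalence Equiv.ulift.{w})

lemma totalComplexes_le_coacyclic : totalComplexes C ≤ coacyclic.{w} C :=
  fun _ hX _ hP => hP.2 _ hX

lemma totalComplexes_le_contraacyclic : totalComplexes C ≤ contraacyclic.{w} C :=
  fun _ hX _ hP => hP.2 _ hX

end Coacyclic

/-! ### Inflations and deflations -/

section Exact

variable {C : Type u} [Category.{v} C] [Preadditive C] [HasZeroObject C]
  [HasBinaryBiproducts C] [ExactCategory C]

lemma isInflation_of_iso {X Y : C} (e : X ≅ Y) : IsInflation (conflation C) e.hom := by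
  obtain ⟨Z, p, w, h⟩ := ExactCategory.inflation_id X
  exact ⟨Z, e.inv ≫ p, by simpa using w,
    ExactCategory.conflation_of_iso (S := ShortComplex.mk (𝟙 X) p w)
      (T := ShortComplex.mk e.hom (e.inv ≫ p) (by simpa using w))
      (ShortComplex.isoMk (Iso.refl _) e (Iso.refl _)) h⟩

lemma isDeflation_of_iso {X Y : C} (e : X ≅ Y) : IsDeflation (conflation C) e.hom := by
  obtain ⟨Z, p, w, h⟩ := ExactCategory.deflation_id X
  have hp : p = 0 := by simpa using w
  subst hp
  exact ⟨Z, 0, zero_comp, ExactCategory.conflation_of_iso (S := ShortComplex.mk 0 (𝟙 X) w)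
    (T := ShortComplex.mk 0 e.hom zero_comp)
    (ShortComplex.isoMk (Iso.refl _) (Iso.refl _) e) h⟩

/-- Pushouts of inflations are inflations. -/
lemma isInflation_of_isPushout {X Y X' Y' : C} {i : X ⟶ Y} {f : X ⟶ X'} {g : Y ⟶ Y'} {i' : X' ⟶ Y'}
    (sq : IsPushout i f g i') (hi : IsInflation (conflation C) i) :
    IsInflation (conflation C) i' := by
  obtain ⟨Y'', g', i'', sq', hi''⟩ := ExactCategory.inflation_pushout i f hi
  rw [← sq'.inr_isoIsPushout_hom _ _ sq]
  exact ExactCategory.inflation_comp _ _ hi'' (isInflation_of_iso _)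

/-- Pullbacks of deflations are deflations. -/
lemma isDeflation_of_isPullback {Y Z Y' Z' : C} {p : Y ⟶ Z} {f : Z' ⟶ Z} {g : Y' ⟶ Y} {p' : Y' ⟶ Z'}
    (sq : IsPullback g p' p f) (hp : IsDeflation (conflation C) p) :
    IsDeflation (conflation C) p' := by
  obtain ⟨Y'', g', p'', sq', hp''⟩ := ExactCategory.deflation_pullback p f hp
  rw [← sq.isoIsPullback_hom_snd _ _ sq']
  exact ExactCategory.deflation_comp _ _ (isDeflation_of_iso _) hp''

lemma isPushout_biprod_map_id {X Y : C} (i : X ⟶ Y) (Z : C) :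
    IsPushout i (biprod.inl : X ⟶ X ⊞ Z) biprod.inl (biprod.map i (𝟙 Z)) :=
  ⟨⟨by simp⟩, ⟨PushoutCocone.IsColimit.mk _ (fun s => biprod.desc s.inl (biprod.inr ≫ s.inr))
    (by simp) (fun s => by ext <;> simp [s.condition]) (fun s m h₁ h₂ => by
      ext
      · simp [h₁]
      · simp [← h₂])⟩⟩

lemma isPullback_biprod_map_id {X Y : C} (p : X ⟶ Y) (Z : C) :
    IsPullback (biprod.fst : X ⊞ Z ⟶ X) (biprod.map p (𝟙 Z)) p biprod.fst :=
  ⟨⟨by simp⟩, ⟨PullbackCone.IsLimit.mk _ (fun s => biprod.lift s.fst (s.snd ≫ biprod.snd))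
    (by simp) (fun s => by ext <;> simp [s.condition]) (fun s m h₁ h₂ => by
      ext
      · simp [h₁]
      · simp [← h₂])⟩⟩

lemma isInflation_inl (X Y : C) : IsInflation (conflation C) (biprod.inl : X ⟶ X ⊞ Y) := by
  obtain ⟨K, i, w, h⟩ := ExactCategory.deflation_id Y
  obtain ⟨hi⟩ := ExactCategory.isKernel _ h
  have hi0 : i = 0 := by simpa using w
  have hmono : Mono i := Fork.IsLimit.mono hi
  have hK : IsZero K := by
    rw [IsZero.iff_id_eq_zero, ← cancel_mono i, hi0, comp_zero, comp_zero]
  refine isInflation_of_isPushout (i := i) (f := 0) (g := biprod.inr) ?_ ⟨_, _, _, h⟩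
  refine ⟨⟨hK.eq_of_src _ _⟩, ⟨PushoutCocone.IsColimit.mk _
    (fun s => biprod.desc s.inr s.inl) (by simp) (by simp) ?_⟩⟩
  intro s m h₁ h₂
  ext <;> simp [h₁, h₂]

lemma isDeflation_fst (X Y : C) : IsDeflation (conflation C) (biprod.fst : X ⊞ Y ⟶ X) := by
  obtain ⟨K, i, w, h⟩ := ExactCategory.inflation_id Y
  obtain ⟨hi⟩ := ExactCategory.isCokernel _ h
  have hi0 : i = 0 := by simpa using w
  have hepi : Epi i := Cofork.IsColimit.epi hi
  have hK : IsZero K := by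
    rw [IsZero.iff_id_eq_zero, ← cancel_epi i, hi0, zero_comp, zero_comp]
  refine isDeflation_of_isPullback (p := i) (f := 0) (g := biprod.snd) ?_ ⟨_, _, _, h⟩
  refine ⟨⟨hK.eq_of_tgt _ _⟩, ⟨PullbackCone.IsLimit.mk _
    (fun s => biprod.lift s.snd s.fst) (by simp) (by simp) ?_⟩⟩
  intro s m h₁ h₂
  ext <;> simp [h₁, h₂]

/-- The morphism factors as the inclusion of a summand, a shear automorphism of `X ⊞ Z`, and a
pushout of `i`. -/
lemma isInflation_biprod_lift {X Y Z : C} {i : X ⟶ Y} (hi : IsInflation (conflation C) i)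
    (f : X ⟶ Z) : IsInflation (conflation C) (biprod.lift i f) := by
  let e : X ⊞ Z ≅ X ⊞ Z :=
    { hom := biprod.desc (biprod.lift (𝟙 _) f) biprod.inr
      inv := biprod.desc (biprod.lift (𝟙 _) (-f)) biprod.inr }
  have : biprod.lift i f = biprod.inl ≫ e.hom ≫ biprod.map i (𝟙 Z) := by
    ext <;> simp [e]
  rw [this]
  exact ExactCategory.inflation_comp _ _ (isInflation_inl _ _)
    (ExactCategory.inflation_comp _ _ (isInflation_of_iso e)
      (isInflation_of_isPushout (isPushout_biprod_map_id i Z) hi))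

lemma isDeflation_biprod_desc {X Y Z : C} {p : X ⟶ Y} (hp : IsDeflation (conflation C) p)
    (f : Z ⟶ Y) : IsDeflation (conflation C) (biprod.desc p f) := by
  let e : Y ⊞ Z ≅ Y ⊞ Z :=
    { hom := biprod.desc biprod.inl (biprod.lift f (𝟙 _))
      inv := biprod.desc biprod.inl (biprod.lift (-f) (𝟙 _)) }
  have : biprod.desc p f = biprod.map p (𝟙 Z) ≫ e.hom ≫ biprod.fst := by
    ext <;> simp [e]
  rw [this]
  exact ExactCategory.deflation_comp _ _
    (isDeflation_of_isPullback (isPullback_biprod_map_id p Z) hp)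
    (ExactCategory.deflation_comp _ _ (isDeflation_of_iso e) (isDeflation_fst _ _))

lemma isDeflation_biprod_desc' {X Y Z : C} {p : X ⟶ Y} (hp : IsDeflation (conflation C) p)
    (f : Z ⟶ Y) : IsDeflation (conflation C) (biprod.desc f p) := by
  have : biprod.desc f p = (biprod.braiding _ _).hom ≫ biprod.desc p f := by
    ext <;> simp
  rw [this]
  exact ExactCategory.deflation_comp _ _ (isDeflation_of_iso _) (isDeflation_biprod_desc hp f)

end Exact

/-! ### Embeddings into and coverings by contractible complexes -/

section Contractible

variable {C : Type u} [Category.{v} C] [Preadditive C] [HasBinaryBiproducts C]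

/-- The contractible complex `G k ⊞ G (k + 1)`. -/
noncomputable def contractible (G : ℤ → C) : CochainComplex C ℤ :=
  CochainComplex.of (fun k => G k ⊞ G (k + 1)) (fun _ => biprod.snd ≫ biprod.inl) (by simp)

lemma contractible_d (G : ℤ → C) (k : ℤ) : (contractible G).d k (k + 1) =
    (biprod.snd ≫ biprod.inl : G k ⊞ G (k + 1) ⟶ G (k + 1) ⊞ G (k + 1 + 1)) :=
  CochainComplex.of_d (fun k => G k ⊞ G (k + 1)) (fun _ => biprod.snd ≫ biprod.inl) k

variable {G : ℤ → C} {X : CochainComplex C ℤ}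

/-- The morphism `X ⟶ contractible G` induced by `X.X k ⟶ G k`. -/
noncomputable def toContractible (j : ∀ k, X.X k ⟶ G k) : X ⟶ contractible G where
  f k := biprod.lift (j k) (X.d k (k + 1) ≫ j (k + 1))
  comm' := by
    rintro k _ rfl
    have : (biprod.lift (j k) (X.d k (k + 1) ≫ j (k + 1))) ≫
        (biprod.snd ≫ biprod.inl : G k ⊞ G (k + 1) ⟶ G (k + 1) ⊞ G (k + 1 + 1)) =
        X.d k (k + 1) ≫ biprod.lift (j (k + 1)) (X.d (k + 1) (k + 1 + 1) ≫ j (k + 1 + 1)) := by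
      ext <;> simp
    rwa [← contractible_d] at this

/-- The morphism `contractible G ⟶ X` induced by `G (k + 1) ⟶ X.X k`. -/
noncomputable def ofContractible (b : ∀ k m : ℤ, k + 1 = m → (G m ⟶ X.X k)) : contractible G ⟶ X where
  f k := biprod.desc (b (k - 1) k (by omega) ≫ X.d (k - 1) k) (b k (k + 1) rfl)
  comm' := by
    rintro k _ rfl
    have h (l : ℤ) (hl : l + 1 = k + 1) :
        b l (k + 1) hl ≫ X.d l (k + 1) = b k (k + 1) rfl ≫ X.d k (k + 1) := by
      obtain rfl : l = k := by omega
      rfl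
    have : biprod.desc (b (k - 1) k (by omega) ≫ X.d (k - 1) k) (b k (k + 1) rfl) ≫ X.d k (k + 1) =
        (biprod.snd ≫ biprod.inl : G k ⊞ G (k + 1) ⟶ G (k + 1) ⊞ G (k + 1 + 1)) ≫
        biprod.desc (b (k + 1 - 1) (k + 1) (by omega) ≫ X.d (k + 1 - 1) (k + 1))
          (b (k + 1) (k + 1 + 1) rfl) := by
      ext <;> simp [h]
    rwa [← contractible_d] at this

end Contractible

section ShortExact

variable {C : Type u} [Category.{v} C] [Preadditive C] [HasZeroObject C]
  [HasBinaryBiproducts C] [ExactCategory C]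

lemma exists_isShortExact_of_isInflation {X Y : CochainComplex C ℤ} (i : X ⟶ Y)
    (hi : ∀ n, IsInflation (conflation C) (i.f n)) :
    ∃ (Z : CochainComplex C ℤ) (p : Y ⟶ Z) (w : i ≫ p = 0),
      IsShortExact (ShortComplex.mk i p w) := by
  choose Z p w h using hi
  have hp (n : ℤ) := (ExactCategory.isCokernel _ (h n)).some
  have hepi (n : ℤ) : Epi (p n) := Cofork.IsColimit.epi (hp n)
  have hd (n m : ℤ) : ∃ d : Z n ⟶ Z m, p n ≫ d = Y.d n m ≫ p m := by
    obtain ⟨l, hl⟩ := CokernelCofork.IsColimit.desc' (hp n) (Y.d n m ≫ p m) (by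
      simp [w])
    exact ⟨l, hl⟩
  choose d hd using hd
  let Z' : CochainComplex C ℤ :=
    { X := Z
      d := d
      shape := fun n m hnm => by rw [← cancel_epi (p n), hd, Y.shape n m hnm]; simp
      d_comp_d' := fun n m k _ _ => by
        rw [← cancel_epi (p n), ← assoc, hd, assoc, hd]; simp }
  exact ⟨Z', { f := p, comm' := fun n m _ => hd n m }, by ext n; exact w n, h⟩

lemma exists_isShortExact_of_isDeflation {Y Z : CochainComplex C ℤ} (p : Y ⟶ Z)
    (hp : ∀ n, IsDeflation (conflation C) (p.f n)) :
    ∃ (X : CochainComplex C ℤ) (i : X ⟶ Y) (w : i ≫ p = 0),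
      IsShortExact (ShortComplex.mk i p w) := by
  choose X i w h using hp
  have hi (n : ℤ) := (ExactCategory.isKernel _ (h n)).some
  have hmono (n : ℤ) : Mono (i n) := Fork.IsLimit.mono (hi n)
  have hd (n m : ℤ) : ∃ d : X n ⟶ X m, d ≫ i m = i n ≫ Y.d n m := by
    obtain ⟨l, hl⟩ := KernelFork.IsLimit.lift' (hi m) (i n ≫ Y.d n m) (by
      rw [assoc, ← p.comm, reassoc_of% w, zero_comp])
    exact ⟨l, hl⟩
  choose d hd using hd
  let X' : CochainComplex C ℤ :=
    { X := X
      d := d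
      shape := fun n m hnm => by rw [← cancel_mono (i m), hd, Y.shape n m hnm]; simp
      d_comp_d' := fun n m k _ _ => by
        rw [← cancel_mono (i k), assoc, hd, ← assoc, hd]; simp }
  exact ⟨X', { f := i, comm' := fun n m _ => (hd n m).symm }, by ext n; exact w n, h⟩

lemma isInflation_toContractible {G : ℤ → C} {X : CochainComplex C ℤ} {j : ∀ k, X.X k ⟶ G k}
    (hj : ∀ k, IsInflation (conflation C) (j k)) (n : ℤ) :
    IsInflation (conflation C) ((toContractible j).f n) :=
  isInflation_biprod_lift (hj n) _

lemma isDeflation_ofContractible {G : ℤ → C} {X : CochainComplex C ℤ}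
    {b : ∀ k m : ℤ, k + 1 = m → (G m ⟶ X.X k)}
    (hb : ∀ k, IsDeflation (conflation C) (b k (k + 1) rfl)) (n : ℤ) :
    IsDeflation (conflation C) ((ofContractible b).f n) :=
  isDeflation_biprod_desc' (hb n) _

end ShortExact

/-! ### Perturbation of differentials -/

section Perturbation

open CochainComplex HomComplex

variable {C : Type u} [Category.{v} C] [Preadditive C] [HasBinaryBiproducts C]

/-- The morphism `mappingCone φ ⟶ K⟦1⟧` in the standard triangle of `φ : K ⟶ L`. -/
noncomputable def coneδ {K L : CochainComplex C ℤ} (φ : K ⟶ L) : mappingCone φ ⟶ K⟦(1 : ℤ)⟧ :=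
  (mappingCone.triangle φ).mor₃

/-- The component `Y.X n ⟶ P.X (n + 1)` of a morphism `v : Y ⟶ P⟦1⟧`. -/
def shiftComponent {Y P : CochainComplex C ℤ} (v : Y ⟶ P⟦(1 : ℤ)⟧) (n : ℤ) : Y.X n ⟶ P.X (n + 1) := v.f n

section

variable {K L : CochainComplex C ℤ} (φ : K ⟶ L)

omit [HasBinaryBiproducts C] in
lemma shiftComponent_add (v v' : L ⟶ K⟦(1 : ℤ)⟧) (n : ℤ) :
    shiftComponent (v + v') n = shiftComponent v n + shiftComponent v' n := rfl

lemma inl_v_shiftComponent_coneδ (n : ℤ) :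
    (mappingCone.inl φ).v (n + 1) n (by omega) ≫ shiftComponent (coneδ φ) n = -𝟙 _ :=
  mappingCone.inl_v_triangle_mor₃_f φ (n + 1) n (by omega)

lemma inr_f_shiftComponent_coneδ (n : ℤ) :
    (mappingCone.inr φ).f n ≫ shiftComponent (coneδ φ) n = 0 :=
  mappingCone.inr_f_triangle_mor₃_f φ n

end

section

variable {Y P : CochainComplex C ℤ} {u : P ⟶ Y} {v : Y ⟶ P⟦(1 : ℤ)⟧}

lemma shiftComponent_comp_d (v : Y ⟶ P⟦(1 : ℤ)⟧) (n : ℤ) :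
    shiftComponent v n ≫ P.d (n + 1) (n + 1 + 1) =
      -(Y.d n (n + 1) ≫ shiftComponent v (n + 1)) := by
  have h₁ : shiftComponent v n ≫ (-P.d (n + 1) (n + 1 + 1)) =
      Y.d n (n + 1) ≫ shiftComponent v (n + 1) := by
    have := v.comm n (n + 1)
    rw [CochainComplex.shiftFunctor_obj_d', Int.negOnePow_one, Units.neg_smul, one_smul] at this
    exact this
  rw [← h₁, Preadditive.comp_neg, neg_neg]

lemma comp_shiftComponent (h : u ≫ v = 0) (n : ℤ) : u.f n ≫ shiftComponent v n = 0 :=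
  (HomologicalComplex.congr_hom h n)

/-- The complex `Y` with the perturbed differential `d + v u`. -/
noncomputable def perturbation (u : P ⟶ Y) (v : Y ⟶ P⟦(1 : ℤ)⟧) (h : u ≫ v = 0) :
    CochainComplex C ℤ :=
  CochainComplex.of Y.X (fun n => Y.d n (n + 1) + shiftComponent v n ≫ u.f (n + 1)) (fun n => by
    -- The square of the perturbation vanishes since `u ≫ v = 0`; the cross terms cancel because the
    -- differential of `P⟦1⟧` carries a sign.
    simp only [Preadditive.add_comp, Preadditive.comp_add, assoc, HomologicalComplex.d_comp_d,
      reassoc_of% (comp_shiftComponent h), zero_comp, comp_zero, add_zero, zero_add, u.comm,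
      reassoc_of% (shiftComponent_comp_d v), Preadditive.neg_comp]
    exact neg_add_cancel _)

lemma perturbation_d (h : u ≫ v = 0) (n : ℤ) : (perturbation u v h).d n (n + 1) =
    (Y.d n (n + 1) + shiftComponent v n ≫ u.f (n + 1) : Y.X n ⟶ Y.X (n + 1)) :=
  CochainComplex.of_d Y.X (fun n => Y.d n (n + 1) + shiftComponent v n ≫ u.f (n + 1)) n

/-- The inclusion of the perturbed complex in the cone. -/
noncomputable def perturbationι (h : u ≫ v = 0) : perturbation u v h ⟶ mappingCone u where
  f n := shiftComponent v n ≫ (mappingCone.inl u).v (n + 1) n (by omega) +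
    (mappingCone.inr u).f n
  comm' := by
    rintro n _ rfl
    have : (shiftComponent v n ≫ (mappingCone.inl u).v (n + 1) n (by omega) +
        (mappingCone.inr u).f n) ≫ (mappingCone u).d n (n + 1) =
        (Y.d n (n + 1) + shiftComponent v n ≫ u.f (n + 1)) ≫
        (shiftComponent v (n + 1) ≫ (mappingCone.inl u).v (n + 1 + 1) (n + 1) (by omega) +
        (mappingCone.inr u).f (n + 1)) := by
      rw [Preadditive.add_comp, assoc, mappingCone.inl_v_d u (n + 1) n (n + 1 + 1) (by omega)
        (by omega), mappingCone.inr_f_d, Preadditive.comp_sub, reassoc_of% (shiftComponent_comp_d v)]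
      simp only [Preadditive.add_comp, Preadditive.comp_add, assoc,
        reassoc_of% (comp_shiftComponent h), Preadditive.neg_comp, zero_comp, comp_zero]
      abel
    rwa [← perturbation_d h] at this

/-- The projection from the cone with kernel the perturbed complex. -/
noncomputable def perturbationπ (h : u ≫ v = 0) : mappingCone u ⟶ P⟦(1 : ℤ)⟧ :=
  coneδ u + mappingCone.desc u 0 v (by simp [h])

lemma inl_v_shiftComponent_perturbationπ (h : u ≫ v = 0) (n : ℤ) :
    (mappingCone.inl u).v (n + 1) n (by omega) ≫ shiftComponent (perturbationπ h) n = -𝟙 _ := by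
  have : (mappingCone.inl u).v (n + 1) n (by omega) ≫
      shiftComponent (mappingCone.desc u 0 v (by simp [h])) n = 0 :=
    mappingCone.inl_v_desc_f u (0 : Cochain P _ (-1)) v _ (n + 1) n (by omega)
  rw [perturbationπ, shiftComponent_add, Preadditive.comp_add, inl_v_shiftComponent_coneδ,
    this, add_zero]

lemma inr_f_shiftComponent_perturbationπ (h : u ≫ v = 0) (n : ℤ) :
    (mappingCone.inr u).f n ≫ shiftComponent (perturbationπ h) n = shiftComponent v n := by
  have : (mappingCone.inr u).f n ≫
      shiftComponent (mappingCone.desc u 0 v (by simp [h])) n = shiftComponent v n :=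
    mappingCone.inr_f_desc_f u (0 : Cochain P _ (-1)) v _ n
  rw [perturbationπ, shiftComponent_add, Preadditive.comp_add, inr_f_shiftComponent_coneδ,
    this, zero_add]

lemma perturbationι_π_f (h : u ≫ v = 0) (n : ℤ) :
    (shiftComponent v n ≫ (mappingCone.inl u).v (n + 1) n (by omega) +
      (mappingCone.inr u).f n) ≫ shiftComponent (perturbationπ h) n = 0 := by
  rw [Preadditive.add_comp, assoc, inl_v_shiftComponent_perturbationπ,
    inr_f_shiftComponent_perturbationπ, Preadditive.comp_neg, comp_id, neg_add_cancel]

lemma perturbationι_π (h : u ≫ v = 0) : perturbationι h ≫ perturbationπ h = 0 := by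
  ext n
  exact perturbationι_π_f h n

variable [HasZeroObject C]

/-- On the summand `P⟦1⟧` of the cone the projection is `-1` and on `Y` it is `v`, so it is
degreewise split and its kernel is the graph of `v`. The differential of the cone restricted to this
graph is the perturbed one. -/
lemma perturbation_distinguished (h : u ≫ v = 0) :
    ∃ δ, Triangle.mk ((hotQ C).map (perturbationι h)) ((hotQ C).map (perturbationπ h)) δ ∈
      distTriang (Hot C) := by
  let S := ShortComplex.mk _ _ (perturbationι_π h)
  let σ (n : ℤ) : (S.map (HomologicalComplex.eval C (ComplexShape.up ℤ) n)).Splitting :=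
    { r := (mappingCone.snd u).v n n (add_zero n)
      s := (-(mappingCone.inl u).v (n + 1) n (by omega) : P.X (n + 1) ⟶ _)
      f_r := by
        have : (shiftComponent v n ≫ (mappingCone.inl u).v (n + 1) n (by omega) +
          (mappingCone.inr u).f n) ≫ (mappingCone.snd u).v n n (add_zero n) = 𝟙 _ := by simp
        exact this
      s_g := by
        have : (-(mappingCone.inl u).v (n + 1) n (by omega)) ≫
            shiftComponent (perturbationπ h) n = 𝟙 _ := by
          rw [Preadditive.neg_comp, inl_v_shiftComponent_perturbationπ, neg_neg]
        exact this
      id := by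
        have : (mappingCone.snd u).v n n (add_zero n) ≫
              (shiftComponent v n ≫ (mappingCone.inl u).v (n + 1) n (by omega) +
              (mappingCone.inr u).f n) + shiftComponent (perturbationπ h) n ≫
              (-(mappingCone.inl u).v (n + 1) n (by omega)) = 𝟙 _ := by
          rw [mappingCone.ext_from_iff u (n + 1) n (by omega)]
          constructor
          · rw [Preadditive.comp_add, reassoc_of% (inl_v_shiftComponent_perturbationπ h n)]
            simp
          · rw [Preadditive.comp_add, reassoc_of% (inr_f_shiftComponent_perturbationπ h n)]
            simp
        exact this }
  exact ⟨_, (HomotopyCategory.distinguished_iff_iso_trianglehOfDegreewiseSplit _).2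
    ⟨S, σ, ⟨Iso.refl _⟩⟩⟩

end

end Perturbation

/-! ### Products and coproducts of cones -/

section ConeProducts

open CochainComplex HomComplex

variable {C : Type u} [Category.{v} C] [Preadditive C] [HasBinaryBiproducts C] {J : Type w}
  {K L : J → CochainComplex C ℤ} (φ : ∀ j, K j ⟶ L j) {P Q : CochainComplex C ℤ} (ψ : P ⟶ Q)

section

variable (a : ∀ j, K j ⟶ P) (b : ∀ j, L j ⟶ Q) (comm : ∀ j, φ j ≫ b j = a j ≫ ψ)

/-- A coproduct of cones is a cone of a coproduct. -/
lemma nonempty_isColimit_mappingCone_cofan [HasCoproductsOfShape J C]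
    (ha : IsColimit (Cofan.mk P a)) (hb : IsColimit (Cofan.mk Q b)) :
    Nonempty (IsColimit (Cofan.mk (mappingCone ψ)
      fun j => mappingCone.map (φ j) ψ (a j) (b j) (comm j))) := by
  refine ⟨HomologicalComplex.isColimitOfEval _ _ fun n => ?_⟩
  refine (isColimitMapCoconeCofanMkEquiv _ _ _).symm ?_
  have ha' := isColimitCofanMkObjOfIsColimit
    (HomologicalComplex.eval C (ComplexShape.up ℤ) (n + 1)) _ _ ha
  have hb' := isColimitCofanMkObjOfIsColimit
    (HomologicalComplex.eval C (ComplexShape.up ℤ) n) _ _ hb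
  have ha_ext {T : C} {f g : P.X (n + 1) ⟶ T}
      (h : ∀ j, (a j).f (n + 1) ≫ f = (a j).f (n + 1) ≫ g) : f = g :=
    Cofan.IsColimit.hom_ext ha' _ _ h
  have hb_ext {T : C} {f g : Q.X n ⟶ T}
      (h : ∀ j, (b j).f n ≫ f = (b j).f n ≫ g) : f = g :=
    Cofan.IsColimit.hom_ext hb' _ _ h
  have ha_desc {T : C} (f : ∀ j, (K j).X (n + 1) ⟶ T) :
      ∃ g : P.X (n + 1) ⟶ T, ∀ j, (a j).f (n + 1) ≫ g = f j :=
    ⟨Cofan.IsColimit.desc ha' f, fun j => Cofan.IsColimit.fac ha' f j⟩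
  have hb_desc {T : C} (f : ∀ j, (L j).X n ⟶ T) :
      ∃ g : Q.X n ⟶ T, ∀ j, (b j).f n ≫ g = f j :=
    ⟨Cofan.IsColimit.desc hb' f, fun j => Cofan.IsColimit.fac hb' f j⟩
  have h₁ (j : J) : (mappingCone.inl (φ j)).v (n + 1) n (by omega) ≫
      (mappingCone.map (φ j) ψ (a j) (b j) (comm j)).f n =
      (a j).f (n + 1) ≫ (mappingCone.inl ψ).v (n + 1) n (by omega) := by
    simp [mappingCone.map]
  have h₂ (j : J) : (mappingCone.inr (φ j)).f n ≫
      (mappingCone.map (φ j) ψ (a j) (b j) (comm j)).f n =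
      (b j).f n ≫ (mappingCone.inr ψ).f n := by
    simp [mappingCone.map]
  have hdesc {T : C} (f : ∀ j, (mappingCone (φ j)).X n ⟶ T) : ∃ g : (mappingCone ψ).X n ⟶ T,
      ∀ j, (mappingCone.map (φ j) ψ (a j) (b j) (comm j)).f n ≫ g = f j := by
    obtain ⟨g₁, hg₁⟩ := ha_desc fun j =>
      (mappingCone.inl (φ j)).v (n + 1) n (by omega) ≫ f j
    obtain ⟨g₂, hg₂⟩ := hb_desc fun j => (mappingCone.inr (φ j)).f n ≫ f j
    refine ⟨(mappingCone.fst ψ).1.v n (n + 1) rfl ≫ g₁ +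
      (mappingCone.snd ψ).v n n (add_zero n) ≫ g₂, fun j => ?_⟩
    rw [mappingCone.ext_from_iff (φ j) (n + 1) n rfl, reassoc_of% (h₁ j), reassoc_of% (h₂ j)]
    simp [hg₁, hg₂]
  have hext {T : C} {f g : (mappingCone ψ).X n ⟶ T}
      (h : ∀ j, (mappingCone.map (φ j) ψ (a j) (b j) (comm j)).f n ≫ f =
        (mappingCone.map (φ j) ψ (a j) (b j) (comm j)).f n ≫ g) : f = g := by
    rw [mappingCone.ext_from_iff ψ (n + 1) n rfl]
    refine ⟨ha_ext fun j => ?_, hb_ext fun j => ?_⟩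
    · rw [← reassoc_of% (h₁ j), h, reassoc_of% (h₁ j)]
    · rw [← reassoc_of% (h₂ j), h, reassoc_of% (h₂ j)]
  exact Cofan.IsColimit.mk _ (fun s => (hdesc s.inj).choose)
    (fun s j => (hdesc s.inj).choose_spec j)
    (fun s m hm => hext fun j => (hm j).trans ((hdesc s.inj).choose_spec j).symm)

end

section

variable (a : ∀ j, P ⟶ K j) (b : ∀ j, Q ⟶ L j) (comm : ∀ j, ψ ≫ b j = a j ≫ φ j)

/-- A product of cones is a cone of a product. -/
lemma nonempty_isLimit_mappingCone_fan [HasProductsOfShape J C]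
    (ha : IsLimit (Fan.mk P a)) (hb : IsLimit (Fan.mk Q b)) :
    Nonempty (IsLimit (Fan.mk (mappingCone ψ)
      fun j => mappingCone.map ψ (φ j) (a j) (b j) (comm j))) := by
  refine ⟨HomologicalComplex.isLimitOfEval _ _ fun n => ?_⟩
  refine (isLimitMapConeFanMkEquiv _ _ _).symm ?_
  have ha' := isLimitFanMkObjOfIsLimit
    (HomologicalComplex.eval C (ComplexShape.up ℤ) (n + 1)) _ _ ha
  have hb' := isLimitFanMkObjOfIsLimit
    (HomologicalComplex.eval C (ComplexShape.up ℤ) n) _ _ hb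
  have ha_ext {T : C} {f g : T ⟶ P.X (n + 1)}
      (h : ∀ j, f ≫ (a j).f (n + 1) = g ≫ (a j).f (n + 1)) : f = g :=
    Fan.IsLimit.hom_ext ha' _ _ h
  have hb_ext {T : C} {f g : T ⟶ Q.X n}
      (h : ∀ j, f ≫ (b j).f n = g ≫ (b j).f n) : f = g :=
    Fan.IsLimit.hom_ext hb' _ _ h
  have ha_lift {T : C} (f : ∀ j, T ⟶ (K j).X (n + 1)) :
      ∃ g : T ⟶ P.X (n + 1), ∀ j, g ≫ (a j).f (n + 1) = f j :=
    ⟨Fan.IsLimit.lift ha' f, fun j => Fan.IsLimit.fac ha' f j⟩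
  have hb_lift {T : C} (f : ∀ j, T ⟶ (L j).X n) :
      ∃ g : T ⟶ Q.X n, ∀ j, g ≫ (b j).f n = f j :=
    ⟨Fan.IsLimit.lift hb' f, fun j => Fan.IsLimit.fac hb' f j⟩
  have h₁ (j : J) : (mappingCone.map ψ (φ j) (a j) (b j) (comm j)).f n ≫
      (mappingCone.fst (φ j)).1.v n (n + 1) rfl =
      (mappingCone.fst ψ).1.v n (n + 1) rfl ≫ (a j).f (n + 1) := by
    rw [mappingCone.ext_from_iff ψ (n + 1) n rfl]
    simp [mappingCone.map]
  have h₂ (j : J) : (mappingCone.map ψ (φ j) (a j) (b j) (comm j)).f n ≫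
      (mappingCone.snd (φ j)).v n n (add_zero n) =
      (mappingCone.snd ψ).v n n (add_zero n) ≫ (b j).f n := by
    rw [mappingCone.ext_from_iff ψ (n + 1) n rfl]
    simp [mappingCone.map]
  have hlift {T : C} (f : ∀ j, T ⟶ (mappingCone (φ j)).X n) : ∃ g : T ⟶ (mappingCone ψ).X n,
      ∀ j, g ≫ (mappingCone.map ψ (φ j) (a j) (b j) (comm j)).f n = f j := by
    obtain ⟨g₁, hg₁⟩ := ha_lift fun j => f j ≫ (mappingCone.fst (φ j)).1.v n (n + 1) rfl
    obtain ⟨g₂, hg₂⟩ := hb_lift fun j => f j ≫ (mappingCone.snd (φ j)).v n n (add_zero n)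
    refine ⟨g₁ ≫ (mappingCone.inl ψ).v (n + 1) n (by omega) +
      g₂ ≫ (mappingCone.inr ψ).f n, fun j => ?_⟩
    rw [mappingCone.ext_to_iff (φ j) n (n + 1) rfl, assoc, assoc, h₁, h₂]
    simp [hg₁, hg₂]
  have hext {T : C} {f g : T ⟶ (mappingCone ψ).X n}
      (h : ∀ j, f ≫ (mappingCone.map ψ (φ j) (a j) (b j) (comm j)).f n =
        g ≫ (mappingCone.map ψ (φ j) (a j) (b j) (comm j)).f n) : f = g := by
    rw [mappingCone.ext_to_iff ψ n (n + 1) rfl]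
    refine ⟨ha_ext fun j => ?_, hb_ext fun j => ?_⟩
    · simp only [assoc, ← h₁]
      rw [reassoc_of% (h j)]
    · simp only [assoc, ← h₂]
      rw [reassoc_of% (h j)]
  exact Fan.IsLimit.mk _ (fun s => (hlift s.proj).choose)
    (fun s j => (hlift s.proj).choose_spec j)
    (fun s m hm => hext fun j => (hm j).trans ((hlift s.proj).choose_spec j).symm)

end

end ConeProducts

/-! ### Resolutions of unbounded complexes -/

section Resolutions

open CochainComplex HomComplex

variable {C : Type u} [Category.{v} C] [Preadditive C] [HasZeroObject C] [HasBinaryBiproducts C]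
  [ExactCategory C]

section

omit [HasZeroObject C] [ExactCategory C]

variable {K₁ L₁ K₂ L₂ : CochainComplex C ℤ} (φ₁ : K₁ ⟶ L₁) (φ₂ : K₂ ⟶ L₂)
  (a : K₁ ⟶ K₂) (b : L₁ ⟶ L₂) (comm : φ₁ ≫ b = a ≫ φ₂)

lemma mappingCone_map_coneδ :
    mappingCone.map φ₁ φ₂ a b comm ≫ coneδ φ₂ = coneδ φ₁ ≫ a⟦(1 : ℤ)⟧' := by
  rw [mappingCone.map_eq_mapOfHomotopy]
  exact mappingCone.triangleMapOfHomotopy_comm₃ _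

variable {M : CochainComplex C ℤ} {φ₁ φ₂}

lemma mappingCone_hom_ext {f g : mappingCone φ₁ ⟶ M}
    (h₁ : ∀ n, (mappingCone.inl φ₁).v (n + 1) n (by omega) ≫ f.f n =
      (mappingCone.inl φ₁).v (n + 1) n (by omega) ≫ g.f n)
    (h₂ : mappingCone.inr φ₁ ≫ f = mappingCone.inr φ₁ ≫ g) : f = g := by
  ext n
  rw [mappingCone.ext_from_iff φ₁ (n + 1) n rfl]
  exact ⟨h₁ n, HomologicalComplex.congr_hom h₂ n⟩

lemma perturbation_condition {v : L₁ ⟶ M} (h : φ₁ ≫ v = 0) :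
    δ (-1) 0 (0 : Cochain K₁ M (-1)) = Cochain.ofHom (φ₁ ≫ v) := by simp [h]

lemma mappingCone_map_desc {v₁ : L₁ ⟶ M} (h₁ : φ₁ ≫ v₁ = 0)
    {M₂ : CochainComplex C ℤ} {v₂ : L₂ ⟶ M₂} (h₂ : φ₂ ≫ v₂ = 0) (c : M ⟶ M₂)
    (hc : b ≫ v₂ = v₁ ≫ c) :
    mappingCone.map φ₁ φ₂ a b comm ≫ mappingCone.desc φ₂ 0 v₂ (perturbation_condition h₂) =
      mappingCone.desc φ₁ 0 v₁ (perturbation_condition h₁) ≫ c :=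
  mappingCone_hom_ext (fun n => by simp [mappingCone.map]) (by simp [mappingCone.map, hc])

end

omit [HasBinaryBiproducts C] [HasZeroObject C] in
lemma IsShortExact.of_iso [HasZeroObject C] [HasBinaryBiproducts C] [ExactCategory C]
    {S T : ShortComplex (CochainComplex C ℤ)} (e : S ≅ T) (h : IsShortExact S) :
    IsShortExact T := fun n =>
  ExactCategory.conflation_of_iso
    ((HomologicalComplex.eval C (ComplexShape.up ℤ) n).mapShortComplex.mapIso e) (h n)

lemma hotQ_mappingCone_distinguished {K L : CochainComplex C ℤ} (φ : K ⟶ L) :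
    Triangle.mk ((hotQ C).map φ) ((hotQ C).map (mappingCone.inr φ))
      ((hotQ C).map (coneδ φ) ≫ ((hotQ C).commShiftIso (1 : ℤ)).hom.app K) ∈
        distTriang (Hot C) :=
  HomotopyCategory.mappingCone_triangleh_distinguished φ

lemma trW_hotQ_iff (N : ObjectProperty (Hot C)) [N.IsTriangulated] [N.IsClosedUnderIsomorphisms]
    {K L : CochainComplex C ℤ} (φ : K ⟶ L) :
    N.trW ((hotQ C).map φ) ↔ N ((hotQ C).obj (mappingCone φ)) :=
  N.trW_iff_of_distinguished _ (hotQ_mappingCone_distinguished φ)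

variable (N : ObjectProperty (Hot C)) [N.IsTriangulated] [N.IsClosedUnderIsomorphisms]

/-- The cone of this morphism is by definition the total complex. -/
lemma trW_desc_of_isShortExact (hN : totalComplexes C ≤ N) {X Y Z : CochainComplex C ℤ}
    {i : X ⟶ Y} {p : Y ⟶ Z} (w : i ≫ p = 0) (h : IsShortExact (ShortComplex.mk i p w)) :
    N.trW ((hotQ C).map (mappingCone.desc i 0 p (perturbation_condition w))) := by
  rw [trW_hotQ_iff]
  exact hN _ ⟨_, h, rfl⟩

/-- The telescope produces a morphism between shifted objects; the shift is full and both preserves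
and reflects `N.trW`. -/
lemma exists_trW_of_trW_shift {X Z : CochainComplex C ℤ}
    {s : (hotQ C).obj (X⟦(1 : ℤ)⟧) ⟶ ((hotQ C).obj Z)⟦(1 : ℤ)⟧} (hs : N.trW s) :
    ∃ t : (hotQ C).obj X ⟶ (hotQ C).obj Z, N.trW t := by
  obtain ⟨t, ht⟩ := (CategoryTheory.shiftFunctor (Hot C) (1 : ℤ)).map_surjective
    (((hotQ C).commShiftIso (1 : ℤ)).inv.app X ≫ s)
  refine ⟨t, ?_⟩
  rw [← MorphismProperty.IsCompatibleWithShift.iff N.trW t (1 : ℤ), ht]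
  exact MorphismProperty.RespectsIso.precomp _ _ _ hs

/-- Given short exact sequences `X n ⟶ Y n ⟶ X (n + 1)⟦1⟧`, the complex `X 0` is isomorphic, up to
coacyclic complexes, to a complex with the same terms as `∐ Y`. -/
lemma exists_trW_of_coresolution [HasCoproductsOfShape ℕ C]
    [N.IsClosedUnderColimitsOfShape (Discrete ℕ)]
    (hN : totalComplexes C ≤ N) (X Y : ℕ → CochainComplex C ℤ) (i : ∀ n, X n ⟶ Y n)
    (p : ∀ n, Y n ⟶ (X (n + 1))⟦(1 : ℤ)⟧) (w : ∀ n, i n ≫ p n = 0)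
    (h : ∀ n, IsShortExact (ShortComplex.mk (i n) (p n) (w n))) :
    ∃ Z : CochainComplex C ℤ, (∀ n, Z.X n = (∐ Y).X n) ∧
      ∃ s : (hotQ C).obj (X 0) ⟶ (hotQ C).obj Z, N.trW s := by
  -- `u` preserves the index and `v` raises it by one, so the perturbation `v u` glues each `Y n` to
  -- `Y (n + 1)`.
  let u : ∐ X ⟶ ∐ Y := Limits.Sigma.map i
  let v : ∐ Y ⟶ (∐ X)⟦(1 : ℤ)⟧ := Sigma.desc fun n => p n ≫ (Sigma.ι X (n + 1))⟦(1 : ℤ)⟧'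
  have hu (n : ℕ) : i n ≫ Sigma.ι Y n = Sigma.ι X n ≫ u := (Sigma.ι_map i n).symm
  have hv (n : ℕ) : Sigma.ι Y n ≫ v = p n ≫ (Sigma.ι X (n + 1))⟦(1 : ℤ)⟧' := Sigma.ι_desc _ _
  have huv : u ≫ v = 0 := Sigma.hom_ext _ _ fun n => by
    rw [← reassoc_of% (hu n), hv, reassoc_of% (w n), zero_comp, comp_zero]
  refine ⟨perturbation u v huv, fun _ => rfl, ?_⟩
  obtain ⟨ha⟩ := nonempty_isColimit_hotQ_cofan (isColimitCofanMkObjOfIsColimit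
    (CategoryTheory.shiftFunctor (CochainComplex C ℤ) (1 : ℤ)) _ _ (coproductIsCoproduct X))
  obtain ⟨hm'⟩ := nonempty_isColimit_mappingCone_cofan i u (Sigma.ι X) (Sigma.ι Y) hu
    (coproductIsCoproduct X) (coproductIsCoproduct Y)
  obtain ⟨hm⟩ := nonempty_isColimit_hotQ_cofan hm'
  obtain ⟨δ, hδ⟩ := perturbation_distinguished huv
  -- On the cone of `i n` the projection has two components: the connecting morphism to `(X n)⟦1⟧`
  -- and the comparison with `(X (n + 1))⟦1⟧`, the latter lying in `N.trW`. This is the telescope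
  -- shape.
  have key (n : ℕ) : mappingCone.map (i n) u (Sigma.ι X n) (Sigma.ι Y n) (hu n) ≫
      perturbationπ huv = coneδ (i n) ≫ (Sigma.ι X n)⟦(1 : ℤ)⟧' +
        mappingCone.desc (i n) 0 (p n) (perturbation_condition (w n)) ≫
          (Sigma.ι X (n + 1))⟦(1 : ℤ)⟧' := by
    rw [perturbationπ, Preadditive.comp_add, mappingCone_map_coneδ,
      mappingCone_map_desc _ _ _ (w n) huv _ (hv n)]
  -- After rotation the perturbed complex appears, shifted, as the cone of the telescope morphism.
  have hT : Triangle.mk ((hotQ C).map (perturbationπ huv)) δ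
      (-((hotQ C).map (perturbationι huv))⟦(1 : ℤ)⟧') ∈ distTriang (Hot C) :=
    rot_of_distTriang _ hδ
  have hs := trW_of_telescope_cofan N (A := fun n => (hotQ C).obj ((X n)⟦(1 : ℤ)⟧))
    (M := fun n => (hotQ C).obj (mappingCone (i n)))
    (fun n => (hotQ C).map (mappingCone.desc (i n) 0 (p n) (perturbation_condition (w n))))
    (fun n => trW_desc_of_isShortExact N hN (w n) (h n))
    (fun n => (hotQ C).map (coneδ (i n))) ha hm ((hotQ C).map (perturbationπ huv))
    (fun n => by
      have := congrArg (hotQ C).map (key n)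
      rw [Functor.map_add, Functor.map_comp, Functor.map_comp, Functor.map_comp] at this
      exact this) δ _ hT
  exact exists_trW_of_trW_shift N hs

/-- Given short exact sequences `X' 0 ⟶ Y 0 ⟶ X` and `X' (n + 1) ⟶ Y (n + 1) ⟶ (X' n)⟦1⟧`, the
complex `X` is isomorphic, up to contraacyclic complexes, to a complex with the same terms as
`∏ᶜ Y`. -/
lemma exists_trW_of_resolution [HasProductsOfShape ℕ C]
    [N.IsClosedUnderLimitsOfShape (Discrete ℕ)] (hN : totalComplexes C ≤ N)
    (X : CochainComplex C ℤ) (X' Y : ℕ → CochainComplex C ℤ) (i : ∀ n, X' n ⟶ Y n)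
    (p₀ : Y 0 ⟶ X) (p : ∀ n, Y (n + 1) ⟶ (X' n)⟦(1 : ℤ)⟧) (w₀ : i 0 ≫ p₀ = 0)
    (w : ∀ n, i (n + 1) ≫ p n = 0) (h₀ : IsShortExact (ShortComplex.mk (i 0) p₀ w₀))
    (h : ∀ n, IsShortExact (ShortComplex.mk (i (n + 1)) (p n) (w n))) :
    ∃ Z : CochainComplex C ℤ, (∀ n, Z.X n = (∏ᶜ Y).X n) ∧
      ∃ s : (hotQ C).obj Z ⟶ (hotQ C).obj X, N.trW s := by
  have hP := isLimitFanMkObjOfIsLimit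
    (CategoryTheory.shiftFunctor (CochainComplex C ℤ) (1 : ℤ)) _ _ (productIsProduct X')
  let u : ∏ᶜ X' ⟶ ∏ᶜ Y := Limits.Pi.map i
  -- The factor `Y 0` does not contribute to `v`: its morphism `p₀` goes to `X` itself and is used
  -- only at the very end.
  let v : ∏ᶜ Y ⟶ (∏ᶜ X')⟦(1 : ℤ)⟧ := Fan.IsLimit.lift hP fun n => Pi.π Y (n + 1) ≫ p n
  have hu (n : ℕ) : u ≫ Pi.π Y n = Pi.π X' n ≫ i n := Limits.Pi.map_π i n
  have hv (n : ℕ) : v ≫ (Pi.π X' n)⟦(1 : ℤ)⟧' = Pi.π Y (n + 1) ≫ p n :=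
    Fan.IsLimit.fac hP _ n
  have huv : u ≫ v = 0 := Fan.IsLimit.hom_ext hP _ _ fun n => by
    show (u ≫ v) ≫ (Pi.π X' n)⟦(1 : ℤ)⟧' = 0 ≫ (Pi.π X' n)⟦(1 : ℤ)⟧'
    rw [assoc, hv, reassoc_of% (hu (n + 1)), w, comp_zero, zero_comp]
  refine ⟨perturbation u v huv, fun _ => rfl, ?_⟩
  obtain ⟨hm⟩ := nonempty_isLimit_hotQ_fan hP
  obtain ⟨ha'⟩ := nonempty_isLimit_mappingCone_fan i u (Pi.π X') (Pi.π Y) hu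
    (productIsProduct X') (productIsProduct Y)
  obtain ⟨ha⟩ := nonempty_isLimit_hotQ_fan ha'
  obtain ⟨δ, hδ⟩ := perturbation_distinguished huv
  have key (n : ℕ) : perturbationπ huv ≫ (Pi.π X' n)⟦(1 : ℤ)⟧' =
      mappingCone.map u (i n) (Pi.π X' n) (Pi.π Y n) (hu n) ≫ coneδ (i n) +
      mappingCone.map u (i (n + 1)) (Pi.π X' (n + 1)) (Pi.π Y (n + 1)) (hu (n + 1)) ≫
        mappingCone.desc (i (n + 1)) 0 (p n) (perturbation_condition (w n)) := by
    rw [perturbationπ, Preadditive.add_comp, mappingCone_map_coneδ,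
      mappingCone_map_desc _ _ _ huv (w n) _ (hv n).symm]
  have := isStableUnderRetracts_of_products N
  have hs := trW_of_telescope_fan N
    (fun n => (hotQ C).map
      (mappingCone.desc (i (n + 1)) 0 (p n) (perturbation_condition (w n))))
    (fun n => trW_desc_of_isShortExact N hN (w n) (h n))
    (fun n => (hotQ C).map (coneδ (i n))) ha hm ((hotQ C).map (perturbationπ huv))
    (fun n => by
      have := congrArg (hotQ C).map (key n)
      rw [Functor.map_add, Functor.map_comp, Functor.map_comp, Functor.map_comp] at this
      exact this) _ _ hδ
  -- The telescope ends at the cone of `i 0`, which `p₀` identifies with `X` modulo `N`.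
  exact ⟨_, N.trW.comp_mem _ _ hs (trW_desc_of_isShortExact N hN w₀ h₀)⟩

end Resolutions

/-! ### Resolutions with terms in the subcategory -/

section Coresolving

open CochainComplex HomComplex

variable {C : Type u} [Category.{v} C] [Preadditive C] [HasZeroObject C] [HasBinaryBiproducts C]
  [ExactCategory C] (E : ObjectProperty C)

/-- Objectwise embeddings of the terms into `E` need not commute with differentials; the
contractible complex on the targets repairs this, and its terms are biproducts of objects of `E`. -/
lemma exists_coresolution_step [IsCoresolving E] (X : CochainComplex C ℤ) :
    ∃ (Y X' : CochainComplex C ℤ) (i : X ⟶ Y) (p : Y ⟶ X'⟦(1 : ℤ)⟧) (w : i ≫ p = 0),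
      IsShortExact (ShortComplex.mk i p w) ∧ ∀ n, E (Y.X n) := by
  choose G hG j hj using fun k : ℤ => IsCoresolving.cogenerating (P := E) (X.X k)
  obtain ⟨Q, p, w, h⟩ := exists_isShortExact_of_isInflation (toContractible j)
    (isInflation_toContractible hj)
  let e : (Q⟦(-1 : ℤ)⟧)⟦(1 : ℤ)⟧ ≅ Q := (shiftFunctorCompIsoId _ (-1 : ℤ) 1 (by omega)).app Q
  have w' : toContractible j ≫ p ≫ e.inv = 0 := by rw [reassoc_of% w, zero_comp]
  let e' : ShortComplex.mk (toContractible j) p w ≅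
      ShortComplex.mk (toContractible j) (p ≫ e.inv) w' :=
    ShortComplex.isoMk (Iso.refl _) (Iso.refl _) e.symm (by simp) (by simp)
  exact ⟨contractible G, Q⟦(-1 : ℤ)⟧, toContractible j, p ≫ e.inv, w', h.of_iso e',
    fun n => IsExtensionClosed.prop_biprod E (hG n) (hG (n + 1))⟩

lemma exists_resolution_step [IsResolving E] (X : CochainComplex C ℤ) :
    ∃ (Y X' : CochainComplex C ℤ) (i : X' ⟶ Y) (p : Y ⟶ X) (w : i ≫ p = 0),
      IsShortExact (ShortComplex.mk i p w) ∧ ∀ n, E (Y.X n) := by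
  choose G hG π hπ using fun k : ℤ => IsResolving.generating (P := E) (X.X k)
  -- `ofContractible` attaches to degree `k` the object with index `k + 1`, so the chosen coverings
  -- are reindexed by one.
  let b (k m : ℤ) (h : k + 1 = m) : G (m - 1) ⟶ X.X k :=
    eqToHom (congrArg G (by omega : m - 1 = k)) ≫ π k
  obtain ⟨X', i, w, h⟩ := exists_isShortExact_of_isDeflation (ofContractible b)
    (isDeflation_ofContractible fun k => ExactCategory.deflation_comp _ _
      (isDeflation_of_iso (eqToIso (congrArg G (by omega : k + 1 - 1 = k)))) (hπ k))
  exact ⟨_, X', i, _, w, h, fun n => IsExtensionClosed.prop_biprod E (hG _) (hG _)⟩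

variable {E} in
lemma exists_chInclusion_iso [IsExtensionClosed E] {Z : CochainComplex C ℤ}
    (hZ : ∀ n, E (Z.X n)) : ∃ Z' : CochainComplex E.FullSubcategory ℤ,
      Nonempty ((chInclusion E).obj Z' ≅ Z) :=
  ⟨{  X := fun n => ⟨Z.X n, hZ n⟩
      d := fun n m => ObjectProperty.homMk (Z.d n m)
      shape := fun n m h => ObjectProperty.hom_ext _ (Z.shape n m h)
      d_comp_d' := fun n m k _ _ => ObjectProperty.hom_ext _ (Z.d_comp_d n m k) },
    ⟨HomologicalComplex.Hom.isoOfComponents (fun _ => Iso.refl _) (fun n m _ => by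
      show 𝟙 _ ≫ Z.d n m = Z.d n m ≫ 𝟙 _
      rw [id_comp, comp_id])⟩⟩

/-- Any complex is isomorphic, up to coacyclic complexes, to a complex of objects in a given
coresolving subcategory closed under coproducts. -/
lemma exists_trW_coacyclic [IsCoresolving E] [HasCoproducts.{w} C]
    [∀ J : Type w, E.IsClosedUnderColimitsOfShape (Discrete J)] (X : Hot C) :
    ∃ (Z : Hot E.FullSubcategory) (s : X ⟶ (hotInclusion E).obj Z), (coacyclic.{w} C).trW s := by
  obtain ⟨X, rfl⟩ := HomotopyCategory.quotient_obj_surjective X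
  choose Y X' i p w h hE using exists_coresolution_step E
  -- The successive cokernels, already desuspended by `exists_coresolution_step`.
  let K : ℕ → CochainComplex C ℤ := fun n => Nat.rec X (fun _ => X') n
  obtain ⟨Z, hZ, s, hs⟩ := exists_trW_of_coresolution (coacyclic.{w} C)
    (totalComplexes_le_coacyclic C) K (fun n => Y (K n)) (fun n => i (K n)) (fun n => p (K n))
    (fun n => w (K n)) (fun n => h (K n))
  have : E.IsClosedUnderColimitsOfShape (Discrete ℕ) :=
    .of_equivalence (Discrete.equivalence Equiv.ulift.{w})
  obtain ⟨Z', ⟨e⟩⟩ := exists_chInclusion_iso (E := E) (Z := Z) (fun n => by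
    rw [hZ]
    exact E.prop_of_isColimit (isColimitCofanMkObjOfIsColimit
      (HomologicalComplex.eval C (ComplexShape.up ℤ) n) _ _ (coproductIsCoproduct _))
      fun ⟨k⟩ => hE (K k) n)
  have := MorphismProperty.RespectsIso.postcomp _ ((hotQ C).map e.inv) s hs
  exact ⟨(hotQ _).obj Z', _, this⟩

/-- Any complex is isomorphic, up to contraacyclic complexes, to a complex of objects in a given
resolving subcategory closed under products. -/
lemma exists_trW_contraacyclic [IsResolving E] [HasProducts.{w} C]
    [∀ J : Type w, E.IsClosedUnderLimitsOfShape (Discrete J)] (X : Hot C) :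
    ∃ (Z : Hot E.FullSubcategory) (s : (hotInclusion E).obj Z ⟶ X),
      (contraacyclic.{w} C).trW s := by
  obtain ⟨X, rfl⟩ := HomotopyCategory.quotient_obj_surjective X
  choose Y X' i p w h hE using exists_resolution_step E
  -- Each kernel is suspended before being covered again, so the next covering has target `(X' (K
  -- n))⟦1⟧`, as the resolution lemma demands.
  let K : ℕ → CochainComplex C ℤ := fun n => Nat.rec X (fun _ K => (X' K)⟦(1 : ℤ)⟧) n
  obtain ⟨Z, hZ, s, hs⟩ := exists_trW_of_resolution (contraacyclic.{w} C)
    (totalComplexes_le_contraacyclic C) X (fun n => X' (K n)) (fun n => Y (K n))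
    (fun n => i (K n)) (p X) (fun n => p (K (n + 1))) (w X) (fun n => w (K (n + 1)))
    (h X) (fun n => h (K (n + 1)))
  have : E.IsClosedUnderLimitsOfShape (Discrete ℕ) :=
    .of_equivalence (Discrete.equivalence Equiv.ulift.{w})
  obtain ⟨Z', ⟨e⟩⟩ := exists_chInclusion_iso (E := E) (Z := Z) (fun n => by
    rw [hZ]
    exact E.prop_of_isLimit (isLimitFanMkObjOfIsLimit
      (HomologicalComplex.eval C (ComplexShape.up ℤ) n) _ _ (productIsProduct _))
      fun ⟨k⟩ => hE (K k) n)
  have := MorphismProperty.RespectsIso.precomp _ ((hotQ C).map e.hom) s hs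
  exact ⟨(hotQ _).obj Z', _, this⟩

end Coresolving

/-! ### Acyclic complexes -/

section Acyclic

open CochainComplex HomComplex

variable {C : Type u} [Category.{v} C] [Preadditive C] [HasZeroObject C] [HasBinaryBiproducts C]
  [ExactCategory C]

/-- The complex `K` has an object of cycles in degree `j`, and the differential induces a deflation
from `K.X i` to this object. -/
structure CyclesAt (K : CochainComplex C ℤ) (i j k : ℤ) where
  Z : C
  ι : Z ⟶ K.X j
  p : K.X i ⟶ Z
  mono : Mono ι
  ι_d : ι ≫ K.d j k = 0
  p_ι : p ≫ ι = K.d i j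
  deflation : IsDeflation (conflation C) p
  exists_lift {T : C} (f : T ⟶ K.X j) (hf : f ≫ K.d j k = 0) : ∃ l : T ⟶ Z, l ≫ ι = f

attribute [instance] CyclesAt.mono

namespace CyclesAt

variable {K : CochainComplex C ℤ} {i j k : ℤ} (z : CyclesAt K i j k)

/-- The lift to the cycles. -/
noncomputable def lift {T : C} (f : T ⟶ K.X j) (hf : f ≫ K.d j k = 0) : T ⟶ z.Z :=
  (z.exists_lift f hf).choose

@[simp]
lemma lift_ι {T : C} (f : T ⟶ K.X j) (hf : f ≫ K.d j k = 0) : z.lift f hf ≫ z.ι = f :=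
  (z.exists_lift f hf).choose_spec

end CyclesAt

lemma IsAcyclic.nonempty_cyclesAt {K : CochainComplex C ℤ} (hK : IsAcyclic K) {i j k : ℤ}
    (hij : i + 1 = j) (hjk : j + 1 = k) : Nonempty (CyclesAt K i j k) := by
  obtain ⟨Z, ι, p, w, h, fac⟩ := hK
  subst hij hjk
  have hmono (n : ℤ) : Mono (ι n) := Fork.IsLimit.mono (ExactCategory.isKernel _ (h n)).some
  refine ⟨⟨Z (i + 1), ι (i + 1), p i, hmono _, ?_, fac i, ⟨_, _, _, h i⟩, fun f hf => ?_⟩⟩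
  · rw [← fac, reassoc_of% w, zero_comp]
  · obtain ⟨l, hl⟩ := KernelFork.IsLimit.lift' (ExactCategory.isKernel _ (h (i + 1))).some f (by
      have := hmono (i + 1 + 1)
      rw [← cancel_mono (ι (i + 1 + 1)), assoc, fac, hf, zero_comp])
    exact ⟨l, hl⟩

/-- Local criterion: it suffices that each differential factors as a deflation onto a kernel of the
next one. The splicing objects need no compatible choice, since kernels are unique. -/
lemma isAcyclic_of_cyclesAt {K : CochainComplex C ℤ}
    (h : ∀ i j k : ℤ, i + 1 = j → j + 1 = k → Nonempty (CyclesAt K i j k)) : IsAcyclic K := by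
  let z (n : ℤ) : CyclesAt K (n - 1) n (n + 1) := (h _ _ _ (by omega) (by omega)).some
  have hp (n m : ℤ) (hnm : n + 1 = m) :
      ∃ p : K.X n ⟶ (z m).Z, p ≫ (z m).ι = K.d n m ∧ IsDeflation (conflation C) p := by
    obtain rfl : n = m - 1 := by omega
    exact ⟨(z m).p, (z m).p_ι, (z m).deflation⟩
  choose p hp₁ hp₂ using fun n => hp n (n + 1) rfl
  have w (n : ℤ) : (z n).ι ≫ p n = 0 := by
    rw [← cancel_mono (z (n + 1)).ι, assoc, hp₁, (z n).ι_d, zero_comp]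
  refine ⟨fun n => (z n).Z, fun n => (z n).ι, p, w, fun n => ?_, hp₁⟩
  refine conflation_of_isLimit (hp₂ n) _ _ (KernelFork.IsLimit.ofι' _ _ (fun f hf => ?_))
  have hf' : f ≫ K.d n (n + 1) = 0 := by rw [← hp₁, reassoc_of% hf, zero_comp]
  exact ⟨(z n).lift f hf', (z n).lift_ι f hf'⟩

lemma IsAcyclic.shift {K : CochainComplex C ℤ} (hK : IsAcyclic K) (n : ℤ) :
    IsAcyclic (K⟦n⟧) := by
  refine isAcyclic_of_cyclesAt fun i j k hij hjk => ?_
  obtain ⟨z⟩ := hK.nonempty_cyclesAt (i := i + n) (j := j + n) (k := k + n) (by omega) (by omega)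
  have hsq {X Y : C} (f : X ⟶ Y) : n.negOnePow • n.negOnePow • f = f := by
    rw [smul_smul, Int.units_mul_self, one_smul]
  have hlift {T : C} (f : T ⟶ K.X (j + n)) (hf : f ≫ (n.negOnePow • K.d (j + n) (k + n)) = 0) :
      ∃ l : T ⟶ z.Z, l ≫ z.ι = f := by
    rw [Linear.comp_units_smul] at hf
    have : f ≫ K.d (j + n) (k + n) = 0 := by rw [← hsq (f ≫ _), hf, smul_zero]
    exact ⟨z.lift f this, z.lift_ι f this⟩
  refine ⟨⟨z.Z, z.ι, n.negOnePow • z.p, z.mono, ?_, ?_, ?_, fun {T} f hf => hlift f hf⟩⟩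
  · show z.ι ≫ (n.negOnePow • K.d (j + n) (k + n)) = 0
    rw [Linear.comp_units_smul, z.ι_d, smul_zero]
  · show (n.negOnePow • z.p) ≫ z.ι = n.negOnePow • K.d (i + n) (j + n)
    rw [Linear.units_smul_comp, z.p_ι]
  · let e : z.Z ≅ z.Z := ⟨n.negOnePow • 𝟙 _, n.negOnePow • 𝟙 _, by simp [hsq], by simp [hsq]⟩
    have : n.negOnePow • z.p = z.p ≫ e.hom := by simp [e]
    rw [this]
    exact ExactCategory.deflation_comp _ _ z.deflation (isDeflation_of_iso e)

lemma isDeflation_neg {X Y : C} {p : X ⟶ Y} (hp : IsDeflation (conflation C) p) :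
    IsDeflation (conflation C) (-p) := by
  let e : Y ≅ Y := ⟨-𝟙 _, -𝟙 _, by simp, by simp⟩
  have : -p = p ≫ e.hom := by simp [e]
  rw [this]
  exact ExactCategory.deflation_comp _ _ hp (isDeflation_of_iso e)

lemma isDeflation_biprod_map_id_left {X Y : C} {p : X ⟶ Y} (hp : IsDeflation (conflation C) p)
    (Z : C) : IsDeflation (conflation C) (biprod.map (𝟙 Z) p) := by
  have : biprod.map (𝟙 Z) p = (biprod.braiding Z X).hom ≫ biprod.map p (𝟙 Z) ≫
      (biprod.braiding Y Z).hom := by ext <;> simp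
  rw [this]
  exact ExactCategory.deflation_comp _ _ (isDeflation_of_iso _)
    (ExactCategory.deflation_comp _ _
      (isDeflation_of_isPullback (isPullback_biprod_map_id p Z) hp) (isDeflation_of_iso _))

/-- The cone of a morphism between acyclic complexes is acyclic. -/
lemma IsAcyclic.mappingCone {K L : CochainComplex C ℤ} (f : K ⟶ L) (hK : IsAcyclic K)
    (hL : IsAcyclic L) : IsAcyclic (mappingCone f) := by
  refine isAcyclic_of_cyclesAt fun i j k hij hjk => ?_
  obtain ⟨zK⟩ := hK.nonempty_cyclesAt hjk (k := k + 1) rfl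
  obtain ⟨zL⟩ := hL.nonempty_cyclesAt hjk (k := k + 1) rfl
  obtain ⟨zL'⟩ := hL.nonempty_cyclesAt hij hjk
  let fZ : zK.Z ⟶ zL.Z := zL.lift (zK.ι ≫ f.f k) (by
    rw [assoc, f.comm, reassoc_of% zK.ι_d, zero_comp])
  have hfZ : fZ ≫ zL.ι = zK.ι ≫ f.f k := zL.lift_ι _ _
  have hpf : zK.p ≫ fZ = f.f j ≫ zL.p := by
    rw [← cancel_mono zL.ι, assoc, hfZ, reassoc_of% zK.p_ι, assoc, zL.p_ι, f.comm]
  have hdp : L.d i j ≫ zL.p = 0 := by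
    rw [← cancel_mono zL.ι, assoc, zL.p_ι, L.d_comp_d, zero_comp]
  have hιp : zL'.ι ≫ zL.p = 0 := by
    rw [← cancel_mono zL.ι, assoc, zL.p_ι, zL'.ι_d, zero_comp]
  -- A cycle of the cone is a cycle of `K` together with an element of `L` whose differential is
  -- minus its image. The cycles therefore form the pullback of `-zL.p` along the map `fZ` on
  -- cycles.
  obtain ⟨Z, b, a, sq, hZ⟩ := ExactCategory.deflation_pullback (-zL.p) fZ (isDeflation_neg zL.deflation)
  have hab : b ≫ zL.p = -(a ≫ fZ) := by rw [← sq.w, Preadditive.comp_neg, neg_neg]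
  let r : K.X j ⊞ zL'.Z ⟶ Z := sq.lift (biprod.desc (f.f j) zL'.ι) (biprod.desc (-zK.p) 0) (by
    ext <;> simp [hpf, hιp])
  -- The map of the cone onto these cycles splits into two deflations: `zL'.p` on the second
  -- summand, then `r`, a base change of `-zK.p`.
  have hr : IsPullback biprod.fst r (-zK.p) a := by
    refine ⟨⟨?_⟩, ⟨PullbackCone.IsLimit.mk _ (fun s => biprod.lift s.fst
      (zL'.lift (s.snd ≫ b - s.fst ≫ f.f j) ?_)) (fun s => by simp) (fun s => ?_) ?_⟩⟩
    · rw [sq.lift_snd]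
      ext <;> simp
    · have hs : s.fst ≫ zK.p = -(s.snd ≫ a) := by
        rw [← s.condition, Preadditive.comp_neg, neg_neg]
      rw [← zL.p_ι, ← assoc, Preadditive.sub_comp, assoc, assoc, hab, ← hpf, reassoc_of% hs]
      simp
    · refine sq.hom_ext ?_ ?_
      · rw [assoc, sq.lift_fst, biprod.lift_desc, zL'.lift_ι, add_sub_cancel]
      · rw [assoc, sq.lift_snd, biprod.lift_desc, comp_zero, add_zero, s.condition]
    · intro s m h₁ h₂
      ext
      · simpa using h₁
      · rw [← cancel_mono zL'.ι, biprod.lift_snd, zL'.lift_ι, ← h₂, ← h₁, assoc m r b, sq.lift_fst]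
        have : biprod.desc (f.f j) zL'.ι =
          biprod.fst ≫ f.f j + biprod.snd ≫ zL'.ι := by ext <;> simp
        rw [this]
        simp
  let fst (n m : ℤ) (h : n + 1 = m) := (mappingCone.fst f).1.v n m h
  let snd (n : ℤ) := (mappingCone.snd f).v n n (add_zero n)
  have hwp : (fst i j hij ≫ f.f j + snd i ≫ L.d i j) ≫ (-zL.p) =
      (-(fst i j hij ≫ zK.p)) ≫ fZ := by
    simp [hdp, hpf]
  let p : (CochainComplex.mappingCone f).X i ⟶ Z :=
    sq.lift (fst i j hij ≫ f.f j + snd i ≫ L.d i j) (-(fst i j hij ≫ zK.p)) hwp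
  let e : (CochainComplex.mappingCone f).X i ≅ K.X j ⊞ L.X i :=
    { hom := biprod.lift (fst i j hij) (snd i)
      inv := biprod.desc ((mappingCone.inl f).v j i (by omega)) ((mappingCone.inr f).f i)
      hom_inv_id := by
        rw [biprod.lift_desc, ← mappingCone.id_X f i j hij]
      inv_hom_id := by ext <;> simp [fst, snd] }
  have hmd {W₁ W₂ W₃ W : C} (q : W₁ ⟶ W₂) (x : W₃ ⟶ W) (y : W₂ ⟶ W) :
      biprod.map (𝟙 W₃) q ≫ biprod.desc x y = biprod.desc x (q ≫ y) := by ext <;> simp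
  have hp : p = e.hom ≫ biprod.map (𝟙 _) zL'.p ≫ r := by
    refine sq.hom_ext ?_ ?_
    · rw [sq.lift_fst, assoc, assoc, sq.lift_fst, hmd, biprod.lift_desc, zL'.p_ι]
    · rw [sq.lift_snd, assoc, assoc, sq.lift_snd, hmd, biprod.lift_desc]
      simp
  let ι : Z ⟶ (CochainComplex.mappingCone f).X j :=
    (a ≫ zK.ι) ≫ (mappingCone.inl f).v k j (by omega) + b ≫ (mappingCone.inr f).f j
  have hι₁ : ι ≫ (mappingCone.fst f).1.v j k hjk = a ≫ zK.ι := by simp [ι]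
  have hι₂ : ι ≫ (mappingCone.snd f).v j j (add_zero j) = b := by simp [ι]
  refine ⟨⟨Z, ι, p, ⟨fun x y hxy => sq.hom_ext ?_ ?_⟩, ?_, ?_, ?_, fun {T} x hx => ?_⟩⟩
  · rw [← hι₂, reassoc_of% hxy]
  · rw [← cancel_mono zK.ι, assoc, assoc, ← hι₁, reassoc_of% hxy]
  · rw [mappingCone.ext_to_iff f k (k + 1) rfl]
    constructor
    · rw [assoc, mappingCone.d_fst_v f j k (k + 1) hjk rfl, Preadditive.comp_neg, reassoc_of% hι₁, zK.ι_d]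
      simp
    · rw [assoc, mappingCone.d_snd_v f j k hjk, Preadditive.comp_add, reassoc_of% hι₁,
        reassoc_of% hι₂, ← zL.p_ι, reassoc_of% hab, ← hfZ]
      simp
  · rw [mappingCone.ext_to_iff f j k hjk]
    constructor
    · rw [assoc, hι₁, ← assoc, sq.lift_snd, mappingCone.d_fst_v f i j k hij hjk,
        Preadditive.neg_comp, assoc, zK.p_ι]
    · rw [assoc, hι₂, sq.lift_fst, mappingCone.d_snd_v f i j hij]
  · rw [hp]
    exact ExactCategory.deflation_comp _ _ (isDeflation_of_iso e)
      (ExactCategory.deflation_comp _ _ (isDeflation_biprod_map_id_left zL'.deflation _)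
        (isDeflation_of_isPullback hr (isDeflation_neg zK.deflation)))
  · have h₁ : (x ≫ fst j k hjk) ≫ K.d k (k + 1) = 0 := by
      have := hx =≫ (mappingCone.fst f).1.v k (k + 1) rfl
      rw [assoc, mappingCone.d_fst_v f j k (k + 1) hjk rfl] at this
      simpa [fst] using this
    have h₂ : x ≫ fst j k hjk ≫ f.f k + x ≫ snd j ≫ L.d j k = 0 := by
      have := hx =≫ (mappingCone.snd f).v k k (add_zero k)
      rw [assoc, mappingCone.d_snd_v f j k hjk] at this
      simpa [fst, snd] using this
    refine ⟨sq.lift (x ≫ snd j) (zK.lift _ h₁) ?_, ?_⟩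
    · rw [← cancel_mono zL.ι]
      simp only [Preadditive.comp_neg, Preadditive.neg_comp, assoc, zL.p_ι, hfZ, reassoc_of% (zK.lift_ι _ h₁)]
      rw [eq_comm, ← sub_eq_zero, sub_neg_eq_add, h₂]
    · rw [mappingCone.ext_to_iff f j k hjk]
      constructor
      · rw [assoc]
        erw [hι₁]
        rw [reassoc_of% (sq.lift_snd _ _ _), zK.lift_ι]
      · rw [assoc]
        erw [hι₂]
        rw [sq.lift_fst]

end Acyclic

/-! ### The total complex in coordinates -/

section Total

open CochainComplex HomComplex

variable {C : Type u} [Category.{v} C] [Preadditive C] [HasBinaryBiproducts C]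
  (S : ShortComplex (CochainComplex C ℤ))

/-- The morphism whose cone is the total complex. -/
noncomputable abbrev totalDesc : CochainComplex.mappingCone S.f ⟶ S.X₃ :=
  mappingCone.desc S.f 0 S.g (by simp)

/-- The projection of the total complex to the first complex. -/
noncomputable def totalX (n j k : ℤ) (hj : n + 1 = j) (hk : j + 1 = k) :
    (total S).X n ⟶ S.X₁.X k :=
  (mappingCone.fst (totalDesc S)).1.v n j hj ≫ (mappingCone.fst S.f).1.v j k hk

/-- The projection of the total complex to the second complex. -/
noncomputable def totalY (n j : ℤ) (hj : n + 1 = j) : (total S).X n ⟶ S.X₂.X j :=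
  (mappingCone.fst (totalDesc S)).1.v n j hj ≫ (mappingCone.snd S.f).v j j (add_zero j)

/-- The projection of the total complex to the third complex. -/
noncomputable def totalZ (n : ℤ) : (total S).X n ⟶ S.X₃.X n :=
  (mappingCone.snd (totalDesc S)).v n n (add_zero n)

variable {S}

lemma total_hom_ext {W : C} {n j k : ℤ} (hj : n + 1 = j) (hk : j + 1 = k)
    {s t : W ⟶ (total S).X n} (hX : s ≫ totalX S n j k hj hk = t ≫ totalX S n j k hj hk)
    (hY : s ≫ totalY S n j hj = t ≫ totalY S n j hj) (hZ : s ≫ totalZ S n = t ≫ totalZ S n) :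
    s = t := by
  refine (mappingCone.ext_to_iff (totalDesc S) n j hj s t).2 ⟨?_, hZ⟩
  refine (mappingCone.ext_to_iff S.f j k hk _ _).2 ⟨?_, ?_⟩
  · exact (assoc _ _ _).trans (hX.trans (assoc _ _ _).symm)
  · exact (assoc _ _ _).trans (hY.trans (assoc _ _ _).symm)

lemma exists_total_lift {W : C} {n j k : ℤ} (hj : n + 1 = j) (hk : j + 1 = k)
    (x : W ⟶ S.X₁.X k) (y : W ⟶ S.X₂.X j) (z : W ⟶ S.X₃.X n) :
    ∃ t : W ⟶ (total S).X n, t ≫ totalX S n j k hj hk = x ∧ t ≫ totalY S n j hj = y ∧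
      t ≫ totalZ S n = z := by
  let t : W ⟶ (CochainComplex.mappingCone (totalDesc S)).X n :=
    (x ≫ (mappingCone.inl S.f).v k j (by omega) + y ≫ (mappingCone.inr S.f).f j) ≫
      (mappingCone.inl (totalDesc S)).v j n (by omega) + z ≫ (mappingCone.inr (totalDesc S)).f n
  have h : t ≫ (mappingCone.fst (totalDesc S)).1.v n j hj =
      x ≫ (mappingCone.inl S.f).v k j (by omega) + y ≫ (mappingCone.inr S.f).f j := by
    simp only [t, Preadditive.add_comp, assoc, mappingCone.inl_v_fst_v,
      mappingCone.inr_f_fst_v, comp_id, comp_zero, add_zero]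
  have h' : t ≫ (mappingCone.snd (totalDesc S)).v n n (add_zero n) = z := by
    simp only [t, Preadditive.add_comp, assoc, mappingCone.inl_v_snd_v,
      mappingCone.inr_f_snd_v, comp_id, comp_zero, add_zero, zero_add]
  refine ⟨t, ?_, ?_, h'⟩
  · exact (assoc _ _ _).symm.trans ((h =≫ _).trans (by simp))
  · exact (assoc _ _ _).symm.trans ((h =≫ _).trans (by simp))

/-- Each of the two nested cones contributes a sign: they cancel on the first complex, and a single
one remains on the second in `total_d_totalY`. -/
lemma total_d_totalX {n j k l : ℤ} (hj : n + 1 = j) (hk : j + 1 = k) (hl : k + 1 = l) :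
    (total S).d n j ≫ totalX S j k l hk hl = totalX S n j k hj hk ≫ S.X₁.d k l := by
  have h := mappingCone.d_fst_v (totalDesc S) n j k hj hk
  have h' := mappingCone.d_fst_v S.f j k l hk hl
  refine (assoc _ _ _).symm.trans ((h =≫ _).trans ?_)
  rw [Preadditive.neg_comp, assoc, h', Preadditive.comp_neg, neg_neg]
  exact (assoc _ _ _).symm

lemma total_d_totalY {n j k : ℤ} (hj : n + 1 = j) (hk : j + 1 = k) :
    (total S).d n j ≫ totalY S j k hk =
      -(totalX S n j k hj hk ≫ S.f.f k) - totalY S n j hj ≫ S.X₂.d j k := by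
  have h := mappingCone.d_fst_v (totalDesc S) n j k hj hk
  have h' := mappingCone.d_snd_v S.f j k hk
  refine (assoc _ _ _).symm.trans ((h =≫ _).trans ?_)
  rw [Preadditive.neg_comp, assoc, h', Preadditive.comp_add, neg_add, ← sub_eq_add_neg,
    ← assoc, ← assoc]
  rfl

lemma total_d_totalZ {n j : ℤ} (hj : n + 1 = j) :
    (total S).d n j ≫ totalZ S j = totalY S n j hj ≫ S.g.f j + totalZ S n ≫ S.X₃.d n j := by
  have h := mappingCone.d_snd_v (totalDesc S) n j hj
  have h' : (totalDesc S).f j = (mappingCone.snd S.f).v j j (add_zero j) ≫ S.g.f j := by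
    rw [mappingCone.desc_f _ _ _ _ j (j + 1) rfl]
    simp
  refine h.trans ?_
  rw [h', ← assoc]
  rfl

end Total

section Acyclic

variable {C : Type u} [Category.{v} C] [Preadditive C] [HasZeroObject C] [HasBinaryBiproducts C]
  [ExactCategory C]

omit [Preadditive C] [HasZeroObject C] [HasBinaryBiproducts C] [ExactCategory C] in
lemma isPullback_of_exists_lift {P X Y Z : C} {fst : P ⟶ X} {snd : P ⟶ Y} {f : X ⟶ Z} {g : Y ⟶ Z}
    (w : fst ≫ f = snd ≫ g)
    (hl : ∀ {W : C} (a : W ⟶ X) (b : W ⟶ Y), a ≫ f = b ≫ g →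
      ∃ l : W ⟶ P, l ≫ fst = a ∧ l ≫ snd = b)
    (hu : ∀ {W : C} (s t : W ⟶ P), s ≫ fst = t ≫ fst → s ≫ snd = t ≫ snd → s = t) :
    IsPullback fst snd f g :=
  ⟨⟨w⟩, ⟨PullbackCone.IsLimit.mk _ (fun s => (hl s.fst s.snd s.condition).choose)
    (fun s => (hl s.fst s.snd s.condition).choose_spec.1)
    (fun s => (hl s.fst s.snd s.condition).choose_spec.2)
    (fun s _ h₁ h₂ => hu _ _ (h₁.trans (hl s.fst s.snd s.condition).choose_spec.1.symm)
      (h₂.trans (hl s.fst s.snd s.condition).choose_spec.2.symm))⟩⟩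

/-- A cycle (x, y, z) satisfies `f x = -dy` and `g y = -dz`. Since `f` is a kernel of `g`, the
coordinate x exists and is unique once the second equation holds, so the cycles form the pullback of
the deflation `g` along `-d`. -/
lemma IsAcyclic.total {S : ShortComplex (CochainComplex C ℤ)} (hS : IsShortExact S) :
    IsAcyclic (total S) := by
  refine isAcyclic_of_cyclesAt fun i j k hij hjk => ?_
  have hlim (n : ℤ) : IsLimit (KernelFork.ofι (S.f.f n) (by
      rw [← HomologicalComplex.comp_f, S.zero, HomologicalComplex.zero_f])) :=
    (ExactCategory.isKernel _ (hS n)).some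
  have hmono (n : ℤ) : Mono (S.f.f n) := Fork.IsLimit.mono (hlim n)
  have hdefl (n : ℤ) : IsDeflation (conflation C) (S.g.f n) := ⟨_, _, _, hS n⟩
  have hfg (n : ℤ) : S.f.f n ≫ S.g.f n = 0 := by
    rw [← HomologicalComplex.comp_f, S.zero, HomologicalComplex.zero_f]
  have hker {W : C} {n : ℤ} (y : W ⟶ S.X₂.X n) (hy : y ≫ S.g.f n = 0) :
      ∃ x : W ⟶ S.X₁.X n, x ≫ S.f.f n = y := by
    obtain ⟨l, hl⟩ := KernelFork.IsLimit.lift' (hlim n) y hy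
    exact ⟨l, hl⟩
  obtain ⟨Z, a, b, sq, -⟩ :=
    ExactCategory.deflation_pullback (S.g.f k) (-S.X₃.d j k) (hdefl k)
  have sqw : a ≫ S.g.f k = -(b ≫ S.X₃.d j k) := by rw [sq.w, Preadditive.comp_neg]
  -- The first coordinate is recovered from the second: `-dy` is killed by `g` because `g y` is a
  -- boundary up to sign.
  obtain ⟨x, hx⟩ := hker (-(a ≫ S.X₂.d k (k + 1))) (by
    rw [Preadditive.neg_comp, assoc, ← S.g.comm, reassoc_of% sqw]
    simp)
  obtain ⟨ι, hι₁, hι₂, hι₃⟩ := exists_total_lift hjk rfl x a b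
  obtain ⟨p, hp₁, hp₂⟩ : ∃ p : (ExactCat.total S).X i ⟶ Z,
      p ≫ a = -(totalX S i j k hij hjk ≫ S.f.f k) - totalY S i j hij ≫ S.X₂.d j k ∧
      p ≫ b = totalY S i j hij ≫ S.g.f j + totalZ S i ≫ S.X₃.d i j :=
    ⟨sq.lift _ _ (by
      simp only [Preadditive.sub_comp, Preadditive.neg_comp, assoc, hfg, comp_zero, neg_zero,
        zero_sub, Preadditive.comp_neg, Preadditive.add_comp, HomologicalComplex.d_comp_d,
        add_zero, HomologicalComplex.Hom.comm]), sq.lift_fst _ _ _, sq.lift_snd _ _ _⟩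
  refine ⟨⟨Z, ι, p, ⟨fun s t hst => sq.hom_ext ?_ ?_⟩, ?_, ?_, ?_, fun {T} t ht => ?_⟩⟩
  · rw [← hι₂, reassoc_of% hst]
  · rw [← hι₃, reassoc_of% hst]
  · apply total_hom_ext rfl rfl
    · rw [assoc, total_d_totalX hjk rfl rfl, reassoc_of% hι₁, zero_comp,
        ← cancel_mono (S.f.f _), assoc, ← S.f.comm, reassoc_of% hx]
      simp
    · rw [assoc, total_d_totalY hjk rfl, Preadditive.comp_sub, Preadditive.comp_neg,
        reassoc_of% hι₁, reassoc_of% hι₂, hx]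
      simp
    · rw [assoc, total_d_totalZ hjk, Preadditive.comp_add, reassoc_of% hι₂, reassoc_of% hι₃, sqw]
      simp
  · apply total_hom_ext hjk rfl
    · rw [assoc, hι₁, total_d_totalX hij hjk rfl, ← cancel_mono (S.f.f _), assoc, hx,
        Preadditive.comp_neg, reassoc_of% hp₁, assoc, ← S.f.comm]
      simp
    · rw [assoc, hι₂, hp₁, total_d_totalY hij hjk]
    · rw [assoc, hι₃, hp₂, total_d_totalZ hij]
  -- The map to the cycles is the base change along `b` of the deflation with components `g` and
  -- `d`, from the second and third coordinates in degree `i`.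
  · refine isDeflation_of_isPullback
      (g := biprod.lift (totalY S i j hij) (totalZ S i)) (f := b) ?_
      (isDeflation_biprod_desc (hdefl j) (S.X₃.d i j))
    refine isPullback_of_exists_lift (by rw [biprod.lift_desc, hp₂]) (fun {W} u v huv => ?_)
      (fun {W} s t h₁ h₂ => ?_)
    · have hv : v ≫ b = u ≫ biprod.fst ≫ S.g.f j + u ≫ biprod.snd ≫ S.X₃.d i j := by
        rw [← huv, biprod.desc_eq, Preadditive.comp_add]
      obtain ⟨x', hx'⟩ := hker (-(v ≫ a + u ≫ biprod.fst ≫ S.X₂.d j k)) (by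
        have : v ≫ a ≫ S.g.f k = -(u ≫ biprod.fst ≫ S.g.f j ≫ S.X₃.d j k) := by
          rw [sqw, Preadditive.comp_neg, reassoc_of% hv]
          simp
        rw [Preadditive.neg_comp, Preadditive.add_comp, assoc, this]
        simp)
      obtain ⟨t, ht₁, ht₂, ht₃⟩ :=
        exists_total_lift hij hjk x' (u ≫ biprod.fst) (u ≫ biprod.snd)
      refine ⟨t, by ext <;> simp [ht₂, ht₃], sq.hom_ext ?_ ?_⟩
      · rw [assoc, hp₁, Preadditive.comp_sub, Preadditive.comp_neg, reassoc_of% ht₁,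
          reassoc_of% ht₂, hx']
        abel
      · rw [assoc, hp₂, Preadditive.comp_add, reassoc_of% ht₂, reassoc_of% ht₃, hv]
    · have hY : s ≫ totalY S i j hij = t ≫ totalY S i j hij := by
        simpa using h₁ =≫ biprod.fst
      refine total_hom_ext hij hjk ?_ hY (by simpa using h₁ =≫ biprod.snd)
      have := h₂ =≫ a
      simp only [assoc, hp₁, Preadditive.comp_sub, Preadditive.comp_neg, reassoc_of% hY,
        sub_left_inj, neg_inj] at this
      rw [← cancel_mono (S.f.f k), assoc, assoc, this]
  · have hX' : t ≫ totalX S j k _ hjk rfl ≫ S.f.f (k + 1) =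
        -(t ≫ totalY S j k hjk ≫ S.X₂.d k (k + 1)) := by
      have := ht =≫ totalY S k (k + 1) rfl
      rw [assoc, total_d_totalY hjk rfl, zero_comp, Preadditive.comp_sub,
        Preadditive.comp_neg, sub_eq_zero] at this
      rw [← this, neg_neg]
    have hZ' : t ≫ totalY S j k hjk ≫ S.g.f k = -(t ≫ totalZ S j ≫ S.X₃.d j k) := by
      have := ht =≫ totalZ S k
      rwa [assoc, total_d_totalZ hjk, zero_comp, Preadditive.comp_add,
        add_eq_zero_iff_eq_neg] at this
    obtain ⟨l, hl₁, hl₂⟩ : ∃ l : T ⟶ Z, l ≫ a = t ≫ totalY S j k hjk ∧ l ≫ b = t ≫ totalZ S j :=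
      ⟨sq.lift _ _ (by simp [hZ']), sq.lift_fst _ _ _, sq.lift_snd _ _ _⟩
    refine ⟨l, total_hom_ext hjk rfl ?_ ?_ ?_⟩
    · rw [assoc, hι₁, ← cancel_mono (S.f.f _), assoc, hx, Preadditive.comp_neg,
        reassoc_of% hl₁, assoc, hX']
    · rw [assoc, hι₂, hl₁]
    · rw [assoc, hι₃, hl₂]

end Acyclic

/-! ### Coacyclic and contraacyclic complexes are acyclic up to retracts -/

section AcyclicProducts

variable {C : Type u} [Category.{v} C] [Preadditive C] [HasZeroObject C] [HasBinaryBiproducts C]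
  [ExactCategory C]

/-- Exactness of coproducts enters here: the coproducts of the splicing conflations splice the
coproduct. -/
lemma IsAcyclic.sigma [HasCoproducts.{w} C] [HasExactCoproducts.{w} C] {J : Type w}
    (K : J → CochainComplex C ℤ) (hK : ∀ j, IsAcyclic (K j)) : IsAcyclic (∐ K) := by
  choose Z i p w h fac using hK
  have hc (n : ℤ) := isColimitCofanMkObjOfIsColimit
    (HomologicalComplex.eval C (ComplexShape.up ℤ) n) _ _ (coproductIsCoproduct K)
  let e (n : ℤ) : (∐ fun j => (K j).X n) ≅ (∐ K).X n :=
    (coproductIsCoproduct fun j => (K j).X n).coconePointUniqueUpToIso (hc n)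
  have he (n : ℤ) (j : J) : Sigma.ι (fun j => (K j).X n) j ≫ (e n).hom = (Sigma.ι K j).f n :=
    (coproductIsCoproduct fun j => (K j).X n).comp_coconePointUniqueUpToIso_hom (hc n) ⟨j⟩
  refine ⟨fun n => ∐ fun j => Z j n, fun n => Limits.Sigma.map (fun j => i j n) ≫ (e n).hom,
    fun n => (e n).inv ≫ Limits.Sigma.map (fun j => p j n), fun n => ?_, fun n => ?_, fun n => ?_⟩
  · ext j
    simp [reassoc_of% w]
  · refine ExactCategory.conflation_of_iso ?_
      (HasExactCoproducts.exact (fun j => ShortComplex.mk (i j n) (p j n) (w j n)) fun j => h j n)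
    exact ShortComplex.isoMk (Iso.refl _) (e n) (Iso.refl _) (by simp) (by simp)
  · rw [← cancel_epi (e n).hom]
    ext j
    have := (Sigma.ι K j).comm n (n + 1)
    simp [reassoc_of% he, he, this, reassoc_of% fac]

lemma IsAcyclic.pi [HasProducts.{w} C] [HasExactProducts.{w} C] {J : Type w}
    (K : J → CochainComplex C ℤ) (hK : ∀ j, IsAcyclic (K j)) : IsAcyclic (∏ᶜ K) := by
  choose Z i p w h fac using hK
  have hc (n : ℤ) := isLimitFanMkObjOfIsLimit
    (HomologicalComplex.eval C (ComplexShape.up ℤ) n) _ _ (productIsProduct K)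
  let e (n : ℤ) : (∏ᶜ fun j => (K j).X n) ≅ (∏ᶜ K).X n :=
    (productIsProduct fun j => (K j).X n).conePointUniqueUpToIso (hc n)
  have he (n : ℤ) (j : J) : (e n).inv ≫ Pi.π (fun j => (K j).X n) j = (Pi.π K j).f n :=
    (productIsProduct fun j => (K j).X n).conePointUniqueUpToIso_inv_comp (hc n) ⟨j⟩
  refine ⟨fun n => ∏ᶜ fun j => Z j n, fun n => Limits.Pi.map (fun j => i j n) ≫ (e n).hom,
    fun n => (e n).inv ≫ Limits.Pi.map (fun j => p j n), fun n => ?_, fun n => ?_, fun n => ?_⟩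
  · ext j
    simp [w]
  · refine ExactCategory.conflation_of_iso ?_
      (HasExactProducts.exact (fun j => ShortComplex.mk (i j n) (p j n) (w j n)) fun j => h j n)
    exact ShortComplex.isoMk (Iso.refl _) (e n) (Iso.refl _) (by simp) (by simp)
  · rw [← cancel_mono (e (n + 1)).inv]
    ext j
    simp [reassoc_of% he, he, fac]

variable (C)

/-- The retracts, in the homotopy category, of acyclic complexes. -/
abbrev acyclicRetracts : ObjectProperty (Hot C) := (acyclicComplexes C).retractClosure

variable {C}

lemma acyclicRetracts_iff (X : Hot C) : acyclicRetracts C X ↔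
    ∃ (K : CochainComplex C ℤ) (_ : IsAcyclic K), Nonempty (Retract X ((hotQ C).obj K)) := by
  constructor
  · rintro ⟨_, ⟨K, hK, rfl⟩, r⟩
    exact ⟨K, hK, r⟩
  · rintro ⟨K, hK, r⟩
    exact ⟨_, ⟨K, hK, rfl⟩, r⟩

/-- The middle term of a triangle with acyclic ends is isomorphic to the cone of a morphism of
complexes between acyclic complexes. -/
lemma extensionProduct_acyclicComplexes_le :
    ObjectProperty.extensionProduct (acyclicComplexes C) (acyclicComplexes C) ≤
      (acyclicComplexes C).isoClosure := by
  rintro X ⟨_, _, f, g, h, hT, ⟨K, hK, rfl⟩, ⟨L, hL, rfl⟩⟩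
  have hT' := inv_rot_of_distTriang _ hT
  let e : ((hotQ C).obj L)⟦(-1 : ℤ)⟧ ≅ (hotQ C).obj (L⟦(-1 : ℤ)⟧) :=
    (((hotQ C).commShiftIso (-1 : ℤ)).app L).symm
  let m : ((hotQ C).obj L)⟦(-1 : ℤ)⟧ ⟶ (hotQ C).obj K := (Triangle.mk f g h).invRotate.mor₁
  obtain ⟨φ, hφ⟩ := (hotQ C).map_surjective (e.inv ≫ m)
  let e' := isoTriangleOfIso₁₂ _ _ hT' (hotQ_mappingCone_distinguished φ) e (Iso.refl _) (by
    have : m = e.hom ≫ (hotQ C).map φ := by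
      rw [hφ, Iso.hom_inv_id_assoc]
    exact (comp_id _).trans this)
  exact ⟨_, ⟨_, IsAcyclic.mappingCone φ (hL.shift _) hK, rfl⟩, ⟨Triangle.π₃.mapIso e'⟩⟩

/-- An extension of retracts is a retract of an extension, so extension closure passes from acyclic
complexes to their retracts. -/
instance : (acyclicRetracts C).IsTriangulated where
  exists_zero := (inferInstance : (acyclicRetracts C).ContainsZero).exists_zero
  isStableUnderShiftBy n := ⟨by
    rintro X ⟨_, ⟨K, hK, rfl⟩, ⟨r⟩⟩
    refine ⟨_, ⟨_, hK.shift n, rfl⟩, ⟨(r.map (shiftFunctor (Hot C) n)).trans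
      (Retract.ofIso (((hotQ C).commShiftIso n).app K).symm)⟩⟩⟩
  toIsTriangulatedClosed₂ := ObjectProperty.IsTriangulatedClosed₂.mk' fun T hT h₁ h₃ => by
    have := ObjectProperty.extensionProduct_retractClosure_retractClosure_le
      (acyclicComplexes C) (acyclicComplexes C) T.obj₂ ⟨_, _, T.mor₁, T.mor₂, T.mor₃, hT, h₁, h₃⟩
    rw [acyclicRetracts, ← ObjectProperty.retractClosure_isoClosure]
    exact ObjectProperty.monotone_retractClosure extensionProduct_acyclicComplexes_le _ this

lemma acyclicRetracts_le_triangEnvelope :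
    acyclicRetracts C ≤ (acyclicComplexes C).triangEnvelope := by
  rw [ObjectProperty.retractClosure_le_iff]
  exact ObjectProperty.le_triangEnvelope _

lemma totalComplexes_le_acyclicRetracts : totalComplexes C ≤ acyclicRetracts C := by
  rintro _ ⟨S, hS, rfl⟩
  exact ObjectProperty.le_retractClosure _ _ ⟨_, IsAcyclic.total hS, rfl⟩

lemma acyclicRetracts_isClosedUnderColimitsOfShape [HasCoproducts.{w} C]
    [HasExactCoproducts.{w} C] (J : Type w) :
    (acyclicRetracts C).IsClosedUnderColimitsOfShape (Discrete J) :=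
  hot_isClosedUnderColimitsOfShape _ fun K hK => by
    simp only [acyclicRetracts_iff] at hK ⊢
    choose L hL r using hK
    refine ⟨∐ L, IsAcyclic.sigma L hL, ⟨?_⟩⟩
    have hcK := (nonempty_isColimit_hotQ_cofan (coproductIsCoproduct K)).some
    have hcL := (nonempty_isColimit_hotQ_cofan (coproductIsCoproduct L)).some
    exact
      { i := Cofan.IsColimit.desc hcK fun j => (r j).some.i ≫ (hotQ C).map (Sigma.ι L j)
        r := Cofan.IsColimit.desc hcL fun j => (r j).some.r ≫ (hotQ C).map (Sigma.ι K j)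
        retract := Cofan.IsColimit.hom_ext hcK _ _ fun j => by
          rw [Cofan.IsColimit.fac_assoc, assoc]
          refine ((r j).some.i ≫= Cofan.IsColimit.fac hcL _ j).trans ?_
          rw [Retract.retract_assoc]
          exact (comp_id _).symm }

lemma acyclicRetracts_isClosedUnderLimitsOfShape [HasProducts.{w} C]
    [HasExactProducts.{w} C] (J : Type w) :
    (acyclicRetracts C).IsClosedUnderLimitsOfShape (Discrete J) :=
  hot_isClosedUnderLimitsOfShape _ fun K hK => by
    simp only [acyclicRetracts_iff] at hK ⊢
    choose L hL r using hK
    refine ⟨∏ᶜ L, IsAcyclic.pi L hL, ⟨?_⟩⟩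
    have hcK := (nonempty_isLimit_hotQ_fan (productIsProduct K)).some
    have hcL := (nonempty_isLimit_hotQ_fan (productIsProduct L)).some
    exact
      { i := Fan.IsLimit.lift hcL fun j => (hotQ C).map (Pi.π K j) ≫ (r j).some.i
        r := Fan.IsLimit.lift hcK fun j => (hotQ C).map (Pi.π L j) ≫ (r j).some.r
        retract := Fan.IsLimit.hom_ext hcK _ _ fun j => by
          rw [assoc, Fan.IsLimit.fac]
          refine (assoc _ _ _).symm.trans ((Fan.IsLimit.fac hcL _ j =≫ _).trans ?_)
          rw [assoc, Retract.retract, comp_id]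
          exact (id_comp _).symm }

/-- Retracts of acyclic complexes form a localizing subcategory containing the total complexes, and
they lie in the thick envelope. -/
lemma coacyclic_le_triangEnvelope [HasCoproducts.{w} C] [HasExactCoproducts.{w} C] :
    coacyclic.{w} C ≤ (acyclicComplexes C).triangEnvelope :=
  fun _ hX => acyclicRetracts_le_triangEnvelope _ (hX _
    ⟨⟨inferInstance, inferInstance, acyclicRetracts_isClosedUnderColimitsOfShape⟩,
      totalComplexes_le_acyclicRetracts⟩)

lemma contraacyclic_le_triangEnvelope [HasProducts.{w} C] [HasExactProducts.{w} C] :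
    contraacyclic.{w} C ≤ (acyclicComplexes C).triangEnvelope :=
  fun _ hX => acyclicRetracts_le_triangEnvelope _ (hX _
    ⟨⟨inferInstance, inferInstance, acyclicRetracts_isClosedUnderLimitsOfShape⟩,
      totalComplexes_le_acyclicRetracts⟩)

end AcyclicProducts

/-! ### Acyclic complexes over the subcategory -/

section AcyclicInclusion

variable {C : Type u} [Category.{v} C] [Preadditive C] [HasZeroObject C]
  [HasBinaryBiproducts C] [ExactCategory C] (E : ObjectProperty C) [IsExtensionClosed E]

variable {E} in
lemma IsAcyclic.chInclusion {K : CochainComplex E.FullSubcategory ℤ} (hK : IsAcyclic K) :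
    IsAcyclic ((chInclusion E).obj K) := by
  obtain ⟨Z, i, p, w, h, fac⟩ := hK
  exact ⟨fun n => (Z n).obj, fun n => (i n).hom, fun n => (p n).hom,
    fun n => congrArg (fun f => f.hom) (w n), h, fun n => congrArg (fun f => f.hom) (fac n)⟩

lemma triangEnvelope_acyclicComplexes_le :
    (acyclicComplexes E.FullSubcategory).triangEnvelope ≤
      (acyclicComplexes C).triangEnvelope.inverseImage (hotInclusion E) := by
  have : ((acyclicComplexes C).triangEnvelope.inverseImage
      (hotInclusion E)).IsStableUnderRetracts :=
    ⟨fun r h => (acyclicComplexes C).triangEnvelope.prop_of_retract (r.map _) h⟩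
  rw [ObjectProperty.triangEnvelope_le_iff]
  rintro _ ⟨K, hK, rfl⟩
  exact ObjectProperty.le_triangEnvelope _ _ ⟨_, hK.chInclusion, rfl⟩

end AcyclicInclusion

/-! ### Null-homotopy criteria for maps from and to a total complex -/

section NullHomotopic

open CochainComplex HomComplex

variable {C : Type u} [Category.{v} C] [Preadditive C]

lemma hotQ_map_eq_zero {K L : CochainComplex C ℤ} (f : K ⟶ L)
    (h : ∀ n m : ℤ, m + 1 = n → (K.X n ⟶ L.X m))
    (H : ∀ (n m k : ℤ) (hm : m + 1 = n) (hk : n + 1 = k),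
      K.d n k ≫ h k n hk + h n m hm ≫ L.d m n = f.f n) : (hotQ C).map f = 0 := by
  refine (HomotopyCategory.quotient_map_eq_zero_iff _).2 ⟨
    { hom := fun n m => if hm : m + 1 = n then h n m hm else 0
      zero := fun n m hnm => dif_neg hnm
      comm := fun n => ?_ }⟩
  rw [dNext_eq _ (show (ComplexShape.up ℤ).Rel n (n + 1) from rfl),
    prevD_eq _ (show (ComplexShape.up ℤ).Rel (n - 1) n from sub_add_cancel n 1),
    dif_pos rfl, dif_pos (sub_add_cancel n 1), H, HomologicalComplex.zero_f, add_zero]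

variable [HasBinaryBiproducts C] {S : ShortComplex (CochainComplex C ℤ)}

variable (S) in
lemma exists_total_inclusions : ∃ (a : ∀ (n j k : ℤ) (_ : n + 1 = j) (_ : j + 1 = k),
      S.X₁.X k ⟶ (total S).X n)
    (b : ∀ (n j : ℤ) (_ : n + 1 = j), S.X₂.X j ⟶ (total S).X n)
    (c : ∀ n : ℤ, S.X₃.X n ⟶ (total S).X n),
    (∀ (n j k : ℤ) (hj : n + 1 = j) (hk : j + 1 = k),
      a n j k hj hk ≫ totalX S n j k hj hk = 𝟙 _ ∧ a n j k hj hk ≫ totalY S n j hj = 0 ∧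
        a n j k hj hk ≫ totalZ S n = 0) ∧
    (∀ (n j k : ℤ) (hj : n + 1 = j) (hk : j + 1 = k),
      b n j hj ≫ totalX S n j k hj hk = 0 ∧ b n j hj ≫ totalY S n j hj = 𝟙 _ ∧
        b n j hj ≫ totalZ S n = 0) ∧
    (∀ (n j k : ℤ) (hj : n + 1 = j) (hk : j + 1 = k),
      c n ≫ totalX S n j k hj hk = 0 ∧ c n ≫ totalY S n j hj = 0 ∧
        c n ≫ totalZ S n = 𝟙 _) := by
  choose a ha using fun (n j k : ℤ) (hj : n + 1 = j) (hk : j + 1 = k) =>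
    exists_total_lift (S := S) hj hk (𝟙 (S.X₁.X k)) 0 0
  choose b hb using fun (n j : ℤ) (hj : n + 1 = j) =>
    exists_total_lift (S := S) hj rfl 0 (𝟙 (S.X₂.X j)) 0
  choose c hc using fun (n : ℤ) => exists_total_lift (S := S) (n := n) rfl rfl 0 0 (𝟙 (S.X₃.X n))
  exact ⟨a, b, c, ha, by rintro n j _ hj rfl; exact hb n j hj, by rintro n _ _ rfl rfl; exact hc n⟩

/-- The inclusion of the first complex in the total complex. -/
noncomputable def totalιX (S : ShortComplex (CochainComplex C ℤ)) (n j k : ℤ) (hj : n + 1 = j)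
    (hk : j + 1 = k) : S.X₁.X k ⟶ (total S).X n :=
  (exists_total_inclusions S).choose n j k hj hk

/-- The inclusion of the second complex in the total complex. -/
noncomputable def totalιY (S : ShortComplex (CochainComplex C ℤ)) (n j : ℤ) (hj : n + 1 = j) :
    S.X₂.X j ⟶ (total S).X n :=
  (exists_total_inclusions S).choose_spec.choose n j hj

/-- The inclusion of the third complex in the total complex. -/
noncomputable def totalιZ (S : ShortComplex (CochainComplex C ℤ)) (n : ℤ) :
    S.X₃.X n ⟶ (total S).X n :=
  (exists_total_inclusions S).choose_spec.choose_spec.choose n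

section

variable {n j k : ℤ} (hj : n + 1 = j) (hk : j + 1 = k)

@[simp] lemma totalιX_X : totalιX S n j k hj hk ≫ totalX S n j k hj hk = 𝟙 _ :=
  ((exists_total_inclusions S).choose_spec.choose_spec.choose_spec.1 n j k hj hk).1

@[simp] lemma totalιX_Y : totalιX S n j k hj hk ≫ totalY S n j hj = 0 :=
  ((exists_total_inclusions S).choose_spec.choose_spec.choose_spec.1 n j k hj hk).2.1

@[simp] lemma totalιX_Z : totalιX S n j k hj hk ≫ totalZ S n = 0 :=
  ((exists_total_inclusions S).choose_spec.choose_spec.choose_spec.1 n j k hj hk).2.2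

@[simp] lemma totalιY_X : totalιY S n j hj ≫ totalX S n j k hj hk = 0 :=
  ((exists_total_inclusions S).choose_spec.choose_spec.choose_spec.2.1 n j k hj hk).1

@[simp] lemma totalιY_Y : totalιY S n j hj ≫ totalY S n j hj = 𝟙 _ :=
  ((exists_total_inclusions S).choose_spec.choose_spec.choose_spec.2.1 n j (j + 1) hj rfl).2.1

@[simp] lemma totalιY_Z : totalιY S n j hj ≫ totalZ S n = 0 :=
  ((exists_total_inclusions S).choose_spec.choose_spec.choose_spec.2.1 n j (j + 1) hj rfl).2.2

@[simp] lemma totalιZ_X : totalιZ S n ≫ totalX S n j k hj hk = 0 :=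
  ((exists_total_inclusions S).choose_spec.choose_spec.choose_spec.2.2 n j k hj hk).1

@[simp] lemma totalιZ_Y : totalιZ S n ≫ totalY S n j hj = 0 :=
  ((exists_total_inclusions S).choose_spec.choose_spec.choose_spec.2.2 n j (j + 1) hj rfl).2.1

@[simp] lemma totalιZ_Z : totalιZ S n ≫ totalZ S n = 𝟙 _ :=
  ((exists_total_inclusions S).choose_spec.choose_spec.choose_spec.2.2 n (n + 1) _ rfl rfl).2.2

@[simp] lemma totalιX_X_assoc {W : C} (w : S.X₁.X k ⟶ W) :
    totalιX S n j k hj hk ≫ totalX S n j k hj hk ≫ w = w := by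
  rw [← assoc, totalιX_X, id_comp]

@[simp] lemma totalιX_Y_assoc {W : C} (w : S.X₂.X j ⟶ W) :
    totalιX S n j k hj hk ≫ totalY S n j hj ≫ w = 0 := by
  rw [← assoc, totalιX_Y, zero_comp]

@[simp] lemma totalιX_Z_assoc {W : C} (w : S.X₃.X n ⟶ W) :
    totalιX S n j k hj hk ≫ totalZ S n ≫ w = 0 := by
  rw [← assoc, totalιX_Z, zero_comp]

@[simp] lemma totalιY_X_assoc {W : C} (w : S.X₁.X k ⟶ W) :
    totalιY S n j hj ≫ totalX S n j k hj hk ≫ w = 0 := by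
  rw [← assoc, totalιY_X, zero_comp]

@[simp] lemma totalιY_Y_assoc {W : C} (w : S.X₂.X j ⟶ W) :
    totalιY S n j hj ≫ totalY S n j hj ≫ w = w := by
  rw [← assoc, totalιY_Y, id_comp]

@[simp] lemma totalιY_Z_assoc {W : C} (w : S.X₃.X n ⟶ W) :
    totalιY S n j hj ≫ totalZ S n ≫ w = 0 := by
  rw [← assoc, totalιY_Z, zero_comp]

@[simp] lemma totalιZ_Y_assoc {W : C} (w : S.X₂.X j ⟶ W) :
    totalιZ S n ≫ totalY S n j hj ≫ w = 0 := by
  rw [← assoc, totalιZ_Y, zero_comp]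

@[simp] lemma totalιZ_Z_assoc {W : C} (w : S.X₃.X n ⟶ W) :
    totalιZ S n ≫ totalZ S n ≫ w = w := by
  rw [← assoc, totalιZ_Z, id_comp]

lemma total_id : totalX S n j k hj hk ≫ totalιX S n j k hj hk + totalY S n j hj ≫ totalιY S n j hj +
    totalZ S n ≫ totalιZ S n = 𝟙 _ := by
  apply total_hom_ext hj hk <;> simp [Preadditive.add_comp]

include hk in
lemma total_hom_ext_of_inclusions {W : C} {s t : (total S).X n ⟶ W}
    (hX : totalιX S n j k hj hk ≫ s = totalιX S n j k hj hk ≫ t)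
    (hY : totalιY S n j hj ≫ s = totalιY S n j hj ≫ t)
    (hZ : totalιZ S n ≫ s = totalιZ S n ≫ t) : s = t := by
  rw [← id_comp s, ← id_comp t, ← total_id hj hk]
  simp only [Preadditive.add_comp, assoc, hX, hY, hZ]

lemma totalιX_d {l : ℤ} (hl : k + 1 = l) : totalιX S n j k hj hk ≫ (total S).d n j =
    S.X₁.d k l ≫ totalιX S j k l hk hl - S.f.f k ≫ totalιY S j k hk := by
  apply total_hom_ext hk hl
  · rw [assoc, total_d_totalX hj hk hl, reassoc_of% totalιX_X]
    simp [Preadditive.sub_comp]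
  · rw [assoc, total_d_totalY hj hk, Preadditive.comp_sub, Preadditive.comp_neg,
      reassoc_of% totalιX_X, reassoc_of% totalιX_Y]
    simp [Preadditive.sub_comp]
  · rw [assoc, total_d_totalZ hj, Preadditive.comp_add, reassoc_of% totalιX_Y,
      reassoc_of% totalιX_Z]
    simp [Preadditive.sub_comp]

lemma totalιY_d : totalιY S n j hj ≫ (total S).d n j =
    -(S.X₂.d j k ≫ totalιY S j k hk) + S.g.f j ≫ totalιZ S j := by
  apply total_hom_ext hk rfl
  · rw [assoc, total_d_totalX hj hk rfl, reassoc_of% totalιY_X]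
    simp [Preadditive.add_comp]
  · rw [assoc, total_d_totalY hj hk, Preadditive.comp_sub, Preadditive.comp_neg,
      reassoc_of% totalιY_X, reassoc_of% totalιY_Y]
    simp [Preadditive.add_comp]
  · rw [assoc, total_d_totalZ hj, Preadditive.comp_add, reassoc_of% totalιY_Y,
      reassoc_of% totalιY_Z]
    simp [Preadditive.add_comp]

include hj in
lemma totalιZ_d : totalιZ S n ≫ (total S).d n j = S.X₃.d n j ≫ totalιZ S j := by
  apply total_hom_ext rfl rfl
  · rw [assoc, total_d_totalX hj rfl rfl, reassoc_of% totalιZ_X]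
    simp
  · rw [assoc, total_d_totalY hj rfl, Preadditive.comp_sub, Preadditive.comp_neg,
      reassoc_of% totalιZ_X, reassoc_of% totalιZ_Y]
    simp
  · rw [assoc, total_d_totalZ hj, Preadditive.comp_add, reassoc_of% totalιZ_Y,
      reassoc_of% totalιZ_Z]
    simp

end

variable [HasZeroObject C] [ExactCategory C]

/-- A morphism from the total complex of a short exact sequence `X ⟶ Y ⟶ Z` is null-homotopic
if its components on `X` extend to `Y`. -/
lemma hotQ_map_eq_zero_of_extension (hS : IsShortExact S) {F : CochainComplex C ℤ}
    (f : total S ⟶ F)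
    (h : ∀ (n j k : ℤ) (hj : n + 1 = j) (hk : j + 1 = k), ∃ e : S.X₂.X k ⟶ F.X n,
      S.f.f k ≫ e = totalιX S n j k hj hk ≫ f.f n) : (hotQ C).map f = 0 := by
  choose e he using h
  have hcok (n : ℤ) := (ExactCategory.isCokernel _ (hS n)).some
  have hepi (n : ℤ) : Epi (S.g.f n) := Cofork.IsColimit.epi (hcok n)
  -- Correcting by the homotopy built from `e` kills the component on the first complex. What is
  -- left on the second vanishes on the first, so it descends along `g` to `r`, the rest of the
  -- homotopy.
  have hr (n j : ℤ) (hj : n + 1 = j) : ∃ r : S.X₃.X j ⟶ F.X n, ∀ (m k : ℤ) (hm : m + 1 = n)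
      (hk : j + 1 = k), S.g.f j ≫ r = totalιY S n j hj ≫ f.f n -
        S.X₂.d j k ≫ e n j k hj hk + e m n j hm hj ≫ F.d m n := by
    obtain ⟨m, hm⟩ : ∃ m : ℤ, m + 1 = n := ⟨n - 1, by omega⟩
    have : S.f.f j ≫ (totalιY S n j hj ≫ f.f n -
        S.X₂.d j (j + 1) ≫ e n j (j + 1) hj rfl + e m n j hm hj ≫ F.d m n) = 0 := by
      have h₁ := totalιX_d (S := S) hm hj rfl =≫ f.f n
      have h₂ := reassoc_of% (he m n j hm hj)
      have h₃ : S.f.f j ≫ S.X₂.d j (j + 1) ≫ e n j (j + 1) hj rfl =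
          S.X₁.d j (j + 1) ≫ totalιX S n j (j + 1) hj rfl ≫ f.f n := by rw [S.f.comm_assoc, he]
      rw [assoc] at h₁
      rw [Preadditive.comp_add, Preadditive.comp_sub, h₂, h₃, f.comm, h₁,
        Preadditive.sub_comp, assoc, assoc]
      abel
    obtain ⟨l, hl⟩ := CokernelCofork.IsColimit.desc' (hcok j) _ this
    refine ⟨l, fun m' k hm' hk => ?_⟩
    obtain rfl : m' = m := by omega
    subst hk
    exact hl
  choose r hr using hr
  refine hotQ_map_eq_zero f (fun n m hm => -(totalY S n _ rfl ≫ e m n _ hm rfl) +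
    totalZ S n ≫ r m n hm) ?_
  rintro n m _ hm rfl
  apply total_hom_ext_of_inclusions rfl rfl
  · rw [Preadditive.comp_add, reassoc_of% (totalιX_d (S := S) (n := n) rfl rfl rfl),
      Preadditive.add_comp, Preadditive.comp_add]
    simp [Preadditive.sub_comp, he]
  · rw [Preadditive.comp_add, reassoc_of% (totalιY_d (S := S) (n := n) rfl rfl),
      Preadditive.add_comp, Preadditive.comp_add]
    simp [Preadditive.add_comp, hr n _ rfl m _ hm rfl]
    abel
  -- On the third complex nothing further has to be chosen: since `g` is epi, the identity follows
  -- from the one on the second.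
  · obtain ⟨q, hq⟩ : ∃ q : ℤ, q + 1 = m := ⟨m - 1, by omega⟩
    rw [Preadditive.comp_add, reassoc_of% (totalιZ_d (S := S) (n := n) rfl),
      Preadditive.add_comp, Preadditive.comp_add, ← cancel_epi (S.g.f n)]
    have h₁ := S.g.comm_assoc n (n + 1) (r n (n + 1) rfl)
    have h₂ := totalιY_d (S := S) hm rfl =≫ f.f n
    rw [assoc] at h₂
    simp [h₁, hr n _ rfl m _ hm rfl, reassoc_of% (hr m _ hm q _ hq rfl), Preadditive.sub_comp,
      Preadditive.add_comp, h₂]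

/-- A morphism to the total complex of a short exact sequence `X ⟶ Y ⟶ Z` is null-homotopic
if its components with values in `Z` lift to `Y`. -/
lemma hotQ_map_eq_zero_of_lift (hS : IsShortExact S) {F : CochainComplex C ℤ}
    (f : F ⟶ total S)
    (h : ∀ n : ℤ, ∃ l : F.X n ⟶ S.X₂.X n, l ≫ S.g.f n = f.f n ≫ totalZ S n) :
    (hotQ C).map f = 0 := by
  choose l hl using h
  have hker (n : ℤ) := (ExactCategory.isKernel _ (hS n)).some
  have hmono (n : ℤ) : Mono (S.f.f n) := Fork.IsLimit.mono (hker n)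
  -- After correcting by `l`, the component in the second complex is killed by `g`, so it lifts to
  -- the first and supplies the other half of the homotopy.
  have hr (n j : ℤ) (hj : n + 1 = j) : ∃ r : F.X n ⟶ S.X₁.X j, r ≫ S.f.f j =
      F.d n j ≫ l j - l n ≫ S.X₂.d n j - f.f n ≫ totalY S n j hj := by
    have : (F.d n j ≫ l j - l n ≫ S.X₂.d n j - f.f n ≫ totalY S n j hj) ≫ S.g.f j = 0 := by
      have h₁ := f.f n ≫= total_d_totalZ (S := S) hj
      have h₂ := reassoc_of% (hl n)
      rw [f.comm_assoc, Preadditive.comp_add] at h₁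
      rw [Preadditive.sub_comp, Preadditive.sub_comp, assoc, assoc, assoc, hl, h₁, ← S.g.comm, h₂]
      abel
    obtain ⟨k, hk⟩ := KernelFork.IsLimit.lift' (hker j) _ this
    exact ⟨k, hk⟩
  choose r hr using hr
  refine hotQ_map_eq_zero f (fun n m hm => l n ≫ totalιY S m n hm +
    r n _ rfl ≫ totalιX S m n _ hm rfl) ?_
  rintro n m _ hm rfl
  apply total_hom_ext rfl rfl
  · rw [Preadditive.add_comp, assoc, assoc, total_d_totalX hm rfl rfl]
    have h₁ := f.f n ≫= total_d_totalY (S := S) (n := n) rfl rfl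
    rw [f.comm_assoc, Preadditive.comp_sub, Preadditive.comp_neg] at h₁
    rw [← cancel_mono (S.f.f _)]
    have h₂ := reassoc_of% (hr n _ rfl)
    simp only [Preadditive.add_comp, assoc, totalιY_X, totalιX_X, totalιY_X_assoc, totalιX_X_assoc,
      comp_zero, comp_id, zero_add, hr, ← S.f.comm, h₂, Preadditive.sub_comp]
    rw [Preadditive.comp_sub, h₁]
    simp
    abel
  · rw [Preadditive.add_comp, assoc, assoc, total_d_totalY hm rfl]
    simp [Preadditive.add_comp, hr]
    abel
  · rw [Preadditive.add_comp, assoc, assoc, total_d_totalZ hm]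
    simp [Preadditive.add_comp, hl]

end NullHomotopic

/-! ### Objects whose morphisms to or from the subcategory become zero -/

section Killed

variable {T : Type u} [Category.{v} T] [Preadditive T] [HasZeroObject T] [HasShift T ℤ]
  [∀ n : ℤ, (shiftFunctor T n).Additive] [Pretriangulated T] [IsTriangulated T]
  {T' : Type u'} [Category.{v'} T'] [Preadditive T'] [HasZeroObject T'] [HasShift T' ℤ]
  [∀ n : ℤ, (shiftFunctor T' n).Additive] [Pretriangulated T']
  (Φ : T ⥤ T') [Φ.CommShift ℤ] [Φ.IsTriangulated] (N : ObjectProperty T) [N.IsTriangulated]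

/-- The objects `K` such that each morphism `K ⟶ Φ.obj Z` is annihilated by the image of a
morphism with cone in `N`. -/
def rightKilled : ObjectProperty T' := fun K =>
  ∀ (Z : T) (f : K ⟶ Φ.obj Z), ∃ (Z' : T) (φ : Z ⟶ Z') (_ : N.trW φ), f ≫ Φ.map φ = 0

/-- The objects `K` such that each morphism `Φ.obj Z ⟶ K` is annihilated by the image of a
morphism with cone in `N`. -/
def leftKilled : ObjectProperty T' := fun K =>
  ∀ (Z : T) (f : Φ.obj Z ⟶ K), ∃ (Z' : T) (φ : Z' ⟶ Z) (_ : N.trW φ), Φ.map φ ≫ f = 0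

instance : (rightKilled Φ N).IsClosedUnderIsomorphisms where
  of_iso e hX Z f := by
    obtain ⟨Z', φ, hφ, h⟩ := hX Z (e.hom ≫ f)
    refine ⟨Z', φ, hφ, ?_⟩
    rw [← cancel_epi e.hom, ← assoc, h, comp_zero]

instance : (leftKilled Φ N).IsClosedUnderIsomorphisms where
  of_iso e hX Z f := by
    obtain ⟨Z', φ, hφ, h⟩ := hX Z (f ≫ e.inv)
    refine ⟨Z', φ, hφ, ?_⟩
    rw [← cancel_mono e.inv, assoc, h, zero_comp]

/-- For extensions, first kill the restriction to the left end of the triangle, factor what remains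
through the right end, and kill again. Shifts use that `Φ` commutes with them. -/
instance : (rightKilled Φ N).IsTriangulated where
  exists_zero := ⟨0, isZero_zero _, fun Z f => ⟨Z, 𝟙 Z, N.trW.id_mem Z,
    (isZero_zero T').eq_of_src _ _⟩⟩
  isStableUnderShiftBy n := ⟨fun K hK Z f => by
    let e : (Z⟦-n⟧)⟦n⟧ ≅ Z := (shiftFunctorCompIsoId T (-n) n (by omega)).app Z
    obtain ⟨g, hg⟩ := (shiftFunctor T' n).map_surjective
      (f ≫ Φ.map e.inv ≫ (Φ.commShiftIso n).hom.app (Z⟦-n⟧))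
    obtain ⟨Z', φ, hφ, h⟩ := hK _ g
    refine ⟨Z'⟦n⟧, e.inv ≫ φ⟦n⟧', MorphismProperty.RespectsIso.precomp _ _ _ (hφ.shift n), ?_⟩
    have h' := (shiftFunctor T' n).map_comp g (Φ.map φ)
    rw [h, Functor.map_zero, hg] at h'
    have := (Φ.commShiftIso n).hom.naturality φ
    rw [← cancel_mono ((Φ.commShiftIso n).hom.app Z'), zero_comp, Functor.map_comp, assoc, assoc]
    refine Eq.trans ?_ h'.symm
    rw [assoc, assoc]
    congr 2⟩
  toIsTriangulatedClosed₂ := ObjectProperty.IsTriangulatedClosed₂.mk' fun A hA h₁ h₃ Z f => by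
    obtain ⟨Z₁, φ₁, hφ₁, e₁⟩ := h₁ Z (A.mor₁ ≫ f)
    obtain ⟨g, hg⟩ := Triangle.yoneda_exact₂ _ hA (f ≫ Φ.map φ₁) (by rw [← assoc, e₁])
    obtain ⟨Z₂, φ₂, hφ₂, e₂⟩ := h₃ Z₁ g
    exact ⟨Z₂, φ₁ ≫ φ₂, N.trW.comp_mem _ _ hφ₁ hφ₂, by
      rw [Functor.map_comp, reassoc_of% hg, e₂, comp_zero]⟩

instance : (leftKilled Φ N).IsTriangulated where
  exists_zero := ⟨0, isZero_zero _, fun Z f => ⟨Z, 𝟙 Z, N.trW.id_mem Z,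
    (isZero_zero T').eq_of_tgt _ _⟩⟩
  isStableUnderShiftBy n := ⟨fun K hK Z f => by
    let e : (Z⟦-n⟧)⟦n⟧ ≅ Z := (shiftFunctorCompIsoId T (-n) n (by omega)).app Z
    obtain ⟨g, hg⟩ := (shiftFunctor T' n).map_surjective
      ((Φ.commShiftIso n).inv.app (Z⟦-n⟧) ≫ Φ.map e.hom ≫ f)
    obtain ⟨Z', φ, hφ, h⟩ := hK _ g
    refine ⟨Z'⟦n⟧, φ⟦n⟧' ≫ e.hom, MorphismProperty.RespectsIso.postcomp _ _ _ (hφ.shift n), ?_⟩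
    have h' := (shiftFunctor T' n).map_comp (Φ.map φ) g
    rw [h, Functor.map_zero, hg] at h'
    rw [← cancel_epi ((Φ.commShiftIso n).inv.app Z'), comp_zero, Functor.map_comp, assoc]
    refine Eq.trans ?_ h'.symm
    rw [← assoc, ← assoc, ← assoc]
    simp⟩
  toIsTriangulatedClosed₂ := ObjectProperty.IsTriangulatedClosed₂.mk' fun A hA h₁ h₃ Z f => by
    obtain ⟨Z₁, φ₁, hφ₁, e₁⟩ := h₃ Z (f ≫ A.mor₂)
    obtain ⟨g, hg⟩ := Triangle.coyoneda_exact₂ _ hA (Φ.map φ₁ ≫ f) (by rw [assoc, e₁])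
    obtain ⟨Z₂, φ₂, hφ₂, e₂⟩ := h₁ Z₁ g
    exact ⟨Z₂, φ₂ ≫ φ₁, N.trW.comp_mem _ _ hφ₂ hφ₁, by
      rw [Functor.map_comp, assoc, hg, reassoc_of% e₂, zero_comp]⟩

/-- To be killed by a morphism with cone in `N` is to factor through the image of an object of `N`.
The factorizations on the summands combine through the coproduct of these objects, which is again in
`N`; the cone of its map to `Z` then kills the whole morphism. -/
lemma rightKilled_isClosedUnderColimitsOfShape (J : Type w) [HasCoproductsOfShape J T]
    [N.IsClosedUnderColimitsOfShape (Discrete J)] :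
    (rightKilled Φ N).IsClosedUnderColimitsOfShape (Discrete J) where
  colimitsOfShape_le := by
    rintro K ⟨hK⟩ Z f
    choose Z' φ hφ h using fun j : J => hK.prop_diag_obj ⟨j⟩ Z (hK.ι.app ⟨j⟩ ≫ f)
    choose M a b hT hM using fun j => (N.trW_iff' (φ j)).1 (hφ j)
    have hg (j : J) : ∃ g : hK.diag.obj ⟨j⟩ ⟶ Φ.obj (M j), hK.ι.app ⟨j⟩ ≫ f = g ≫ Φ.map (a j) :=
      Triangle.coyoneda_exact₂ _ (Φ.map_distinguished _ (hT j)) _ (h j)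
    choose g hg using hg
    obtain ⟨Z'', ψ, γ, hT'⟩ := distinguished_cocone_triangle (Sigma.desc a)
    have hN : N (∐ M) := N.prop_of_isColimit (coproductIsCoproduct M) fun ⟨j⟩ => hM j
    refine ⟨Z'', ψ, (N.trW_iff' _).2 ⟨_, _, _, hT', hN⟩, ?_⟩
    let c : Cocone hK.diag := ⟨Φ.obj (∐ M), Discrete.natTrans fun j =>
      g j.as ≫ Φ.map (Sigma.ι M j.as)⟩
    have hc : hK.isColimit.desc c ≫ Φ.map (Sigma.desc a) = f := hK.isColimit.hom_ext fun ⟨j⟩ => by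
      rw [hK.isColimit.fac_assoc]
      show (g j ≫ Φ.map (Sigma.ι M j)) ≫ Φ.map (Sigma.desc a) = _
      rw [assoc, ← Functor.map_comp, Sigma.ι_desc]
      exact (hg j).symm
    have h0 : Sigma.desc a ≫ ψ = 0 := comp_distTriang_mor_zero₁₂ _ hT'
    rw [← hc, assoc, ← Functor.map_comp, h0, Functor.map_zero, comp_zero]

lemma leftKilled_isClosedUnderLimitsOfShape (J : Type w) [HasProductsOfShape J T]
    [N.IsClosedUnderLimitsOfShape (Discrete J)] :
    (leftKilled Φ N).IsClosedUnderLimitsOfShape (Discrete J) where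
  limitsOfShape_le := by
    rintro K ⟨hK⟩ Z f
    choose Z' φ hφ h using fun j : J => hK.prop_diag_obj ⟨j⟩ Z (f ≫ hK.π.app ⟨j⟩)
    choose M a b hT hM using fun j => (N.trW_iff (φ j)).1 (hφ j)
    have hg (j : J) : ∃ g : Φ.obj (M j) ⟶ hK.diag.obj ⟨j⟩, f ≫ hK.π.app ⟨j⟩ = Φ.map (a j) ≫ g :=
      Triangle.yoneda_exact₂ _ (Φ.map_distinguished _ (hT j)) _ (h j)
    choose g hg using hg
    obtain ⟨Z'', ψ, γ, hT'⟩ := distinguished_cocone_triangle₁ (Pi.lift a)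
    have hN : N (∏ᶜ M) := N.prop_of_isLimit (productIsProduct M) fun ⟨j⟩ => hM j
    refine ⟨Z'', ψ, (N.trW_iff _).2 ⟨_, _, _, hT', hN⟩, ?_⟩
    let c : Cone hK.diag := ⟨Φ.obj (∏ᶜ M), Discrete.natTrans fun j =>
      Φ.map (Pi.π M j.as) ≫ g j.as⟩
    have hc : Φ.map (Pi.lift a) ≫ hK.isLimit.lift c = f := hK.isLimit.hom_ext fun ⟨j⟩ => by
      rw [assoc, hK.isLimit.fac]
      show Φ.map (Pi.lift a) ≫ Φ.map (Pi.π M j) ≫ g j = _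
      rw [← assoc, ← Functor.map_comp, Pi.lift_π]
      exact (hg j).symm
    have h0 : ψ ≫ Pi.lift a = 0 := comp_distTriang_mor_zero₁₂ _ hT'
    rw [← hc, ← assoc, ← Functor.map_comp, h0, Functor.map_zero, zero_comp]

variable [Φ.Faithful] [N.IsStableUnderRetracts]

/-- Killing the identity of `Φ.obj Z` forces the killing morphism out of `Z` to be zero, because `Φ`
is faithful. -/
lemma inverseImage_rightKilled_le : (rightKilled Φ N).inverseImage Φ ≤ N := fun Z hZ => by
  obtain ⟨Z', φ, hφ, h⟩ := hZ Z (𝟙 _)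
  obtain rfl : φ = 0 := Φ.map_injective (by rw [← id_comp (Φ.map φ), h, Functor.map_zero])
  exact prop_of_trW_zero N hφ

lemma inverseImage_leftKilled_le : (leftKilled Φ N).inverseImage Φ ≤ N := fun Z hZ => by
  obtain ⟨Z', φ, hφ, h⟩ := hZ Z (𝟙 _)
  obtain rfl : φ = 0 := Φ.map_injective (by rw [← comp_id (Φ.map φ), h, Functor.map_zero])
  obtain ⟨Y, g, k, hT, hY⟩ := hφ
  -- With zero first morphism, `Z` is a retract of the cone.
  obtain ⟨s, hs⟩ := Triangle.yoneda_exact₂ _ hT (𝟙 Z) zero_comp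
  exact N.prop_of_retract ⟨g, s, hs.symm⟩ hY

end Killed

/-! ### Comparing a suspension with a cone when the middle complex is contractible -/

section ToShiftCone

open CochainComplex HomComplex

variable {C : Type u} [Category.{v} C] [Preadditive C] [HasBinaryBiproducts C]

lemma isZero_hotQ_contractible (G : ℤ → C) : IsZero ((hotQ C).obj (contractible G)) := by
  rw [IsZero.iff_id_eq_zero, ← (hotQ C).map_id]
  refine hotQ_map_eq_zero _ (fun n m hm => by
    subst hm
    exact (biprod.fst ≫ biprod.inr : G (m + 1) ⊞ G (m + 1 + 1) ⟶ G m ⊞ G (m + 1))) ?_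
  rintro _ m _ rfl rfl
  rw [contractible_d, contractible_d]
  show (biprod.snd ≫ biprod.inl : G (m + 1) ⊞ G (m + 1 + 1) ⟶ _) ≫
      (biprod.fst ≫ biprod.inr : _ ⟶ G (m + 1) ⊞ G (m + 1 + 1)) +
      (biprod.fst ≫ biprod.inr : G (m + 1) ⊞ G (m + 1 + 1) ⟶ G m ⊞ G (m + 1)) ≫
      (biprod.snd ≫ biprod.inl : _ ⟶ G (m + 1) ⊞ G (m + 1 + 1)) = 𝟙 _
  ext <;> simp

variable {X Y Z : CochainComplex C ℤ} (i : X ⟶ Y) (p : Y ⟶ Z) (w : i ≫ p = 0)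

lemma shiftComponent_coneδ (n : ℤ) :
    shiftComponent (coneδ i) n = -(mappingCone.fst i).1.v n (n + 1) rfl := by
  refine (mappingCone.ext_from_iff i (n + 1) n rfl _ _).2 ⟨?_, ?_⟩
  · rw [inl_v_shiftComponent_coneδ]
    simp
  · rw [inr_f_shiftComponent_coneδ]
    simp

variable {i p}

/-- The morphism `X⟦1⟧ ⟶ mappingCone p` induced by `i : X ⟶ Y` when `i ≫ p = 0`. -/
noncomputable def toShiftCone (w : i ≫ p = 0) : X⟦(1 : ℤ)⟧ ⟶ mappingCone p where
  f n := (i.f (n + 1) ≫ (mappingCone.inl p).v (n + 1) n (by omega) :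
    X.X (n + 1) ⟶ (mappingCone p).X n)
  comm' := by
    rintro n _ rfl
    rw [CochainComplex.shiftFunctor_obj_d', Int.negOnePow_one, Units.neg_smul, one_smul]
    have h : i.f (n + 1) ≫ p.f (n + 1) = 0 := by
      rw [← HomologicalComplex.comp_f, w, HomologicalComplex.zero_f]
    have : (i.f (n + 1) ≫ (mappingCone.inl p).v (n + 1) n (by omega)) ≫
        (mappingCone p).d n (n + 1) = (-X.d (n + 1) (n + 1 + 1)) ≫
        i.f (n + 1 + 1) ≫ (mappingCone.inl p).v (n + 1 + 1) (n + 1) (by omega) := by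
      rw [assoc, mappingCone.inl_v_d p (n + 1) n (n + 1 + 1) (by omega) (by omega),
        Preadditive.comp_sub, reassoc_of% h]
      simp
    exact this

/-- The two sides are the two ways from the cone of `i` to the cone of `p`; the homotopy between
them is the identity of the common summand `Y`. -/
lemma hotQ_desc_inr :
    (hotQ C).map (mappingCone.desc i 0 p (perturbation_condition w)) ≫
        (hotQ C).map (mappingCone.inr p) =
      (hotQ C).map (coneδ i) ≫ (hotQ C).map (toShiftCone w) := by
  rw [← sub_eq_zero, ← Functor.map_comp, ← Functor.map_comp, ← Functor.map_sub]
  refine hotQ_map_eq_zero _ (fun n m hm => (mappingCone.snd i).v n n (add_zero n) ≫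
    (mappingCone.inl p).v n m (by omega)) ?_
  rintro n m _ hm rfl
  have h₁ : (mappingCone.desc i 0 p (perturbation_condition w)).f n =
      (mappingCone.snd i).v n n (add_zero n) ≫ p.f n := by
    rw [mappingCone.desc_f _ _ _ _ n (n + 1) rfl]
    simp
  have h₂ : (coneδ i ≫ toShiftCone w).f n = -((mappingCone.fst i).1.v n (n + 1) rfl ≫
      i.f (n + 1) ≫ (mappingCone.inl p).v (n + 1) n (by omega)) := by
    have : (coneδ i ≫ toShiftCone w).f n = shiftComponent (coneδ i) n ≫
      i.f (n + 1) ≫ (mappingCone.inl p).v (n + 1) n (by omega) := rfl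
    rw [this, shiftComponent_coneδ, Preadditive.neg_comp]
  rw [HomologicalComplex.sub_f_apply, h₂, HomologicalComplex.comp_f, h₁,
    reassoc_of% (mappingCone.d_snd_v i n (n + 1) rfl), assoc, 
    mappingCone.inl_v_d p n m (n + 1) (by omega) (by omega)]
  simp only [Preadditive.add_comp, Preadditive.comp_sub, assoc]
  abel

variable [HasZeroObject C] [ExactCategory C]

/-- If `Y` is contractible, `coneδ i` and the inclusion of `Z` in the cone of `p` are homotopy
equivalences. Conjugating by them turns `toShiftCone` into the comparison whose cone is the total
complex. -/
lemma trW_toShiftCone (N : ObjectProperty (Hot C)) [N.IsTriangulated]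
    [N.IsClosedUnderIsomorphisms] (hN : totalComplexes C ≤ N)
    (h : IsShortExact (ShortComplex.mk i p w)) (hY : IsZero ((hotQ C).obj Y)) :
    N.trW ((hotQ C).map (toShiftCone w)) := by
  have h₁ : IsIso ((hotQ C).map (mappingCone.inr p)) :=
    (Triangle.isZero₁_iff_isIso₂ _ (hotQ_mappingCone_distinguished p)).1 hY
  have h₂ : IsIso ((hotQ C).map (coneδ i) ≫ ((hotQ C).commShiftIso (1 : ℤ)).hom.app X) :=
    (Triangle.isZero₂_iff_isIso₃ _ (hotQ_mappingCone_distinguished i)).1 hY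
  have h₃ : IsIso ((hotQ C).map (coneδ i)) := IsIso.of_isIso_comp_right _
    (((hotQ C).commShiftIso (1 : ℤ)).hom.app X)
  have : (hotQ C).map (toShiftCone w) = inv ((hotQ C).map (coneδ i)) ≫
      (hotQ C).map (mappingCone.desc i 0 p (perturbation_condition w)) ≫
        (hotQ C).map (mappingCone.inr p) := by
    rw [hotQ_desc_inr, IsIso.inv_hom_id_assoc]
  rw [this]
  exact MorphismProperty.RespectsIso.precomp _ _ _ (MorphismProperty.RespectsIso.postcomp _ _ _
    (trW_desc_of_isShortExact N hN w h))

end ToShiftCone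

/-! ### Enlarging objects of the subcategory to solve extension and lifting problems -/

section Factorizations

variable {C : Type u} [Category.{v} C] [Preadditive C] [HasZeroObject C]
  [HasBinaryBiproducts C] [ExactCategory C] (E : ObjectProperty C)

/-- Two successive pushouts solve the two extension problems, and an embedding into `E` follows.
Closure under cokernels makes the composite an inflation of `E` itself. -/
lemma exists_inflation_extension [IsCoresolving E] (M : E.FullSubcategory) {X₁ Y₁ X₂ Y₂ : C}
    {s₁ : X₁ ⟶ Y₁} {s₂ : X₂ ⟶ Y₂} (h₁ : IsInflation (conflation C) s₁)
    (h₂ : IsInflation (conflation C) s₂) (a₁ : X₁ ⟶ M.obj) (a₂ : X₂ ⟶ M.obj) :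
    ∃ (G : E.FullSubcategory) (j : M ⟶ G), IsInflation (conflation E.FullSubcategory) j ∧
      (∃ u₁ : Y₁ ⟶ G.obj, s₁ ≫ u₁ = a₁ ≫ j.hom) ∧
      ∃ u₂ : Y₂ ⟶ G.obj, s₂ ≫ u₂ = a₂ ≫ j.hom := by
  obtain ⟨P₁, g₁, i₁, sq₁, hi₁⟩ := ExactCategory.inflation_pushout s₁ a₁ h₁
  obtain ⟨P₂, g₂, i₂, sq₂, hi₂⟩ := ExactCategory.inflation_pushout s₂ (a₂ ≫ i₁) h₂
  obtain ⟨G, hG, i₃, hi₃⟩ := IsCoresolving.cogenerating (P := E) P₂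
  obtain ⟨Q, q, wq, hq⟩ := ExactCategory.inflation_comp _ _ hi₁
    (ExactCategory.inflation_comp _ _ hi₂ hi₃)
  refine ⟨⟨G, hG⟩, ObjectProperty.homMk (i₁ ≫ i₂ ≫ i₃), ?_, ⟨g₁ ≫ i₂ ≫ i₃, ?_⟩, ⟨g₂ ≫ i₃, ?_⟩⟩
  · exact (IsExtensionClosed.isInflation_iff _).2
      ⟨Q, IsCoresolving.coker (P := E) _ hq M.property hG, q, wq, hq⟩
  · exact sq₁.w_assoc _
  · exact (sq₂.w_assoc _).trans (by simp)

lemma exists_deflation_lift [IsResolving E] (M : E.FullSubcategory) {Y₁ Z₁ Y₂ Z₂ : C}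
    {t₁ : Y₁ ⟶ Z₁} {t₂ : Y₂ ⟶ Z₂} (h₁ : IsDeflation (conflation C) t₁)
    (h₂ : IsDeflation (conflation C) t₂) (c₁ : M.obj ⟶ Z₁) (c₂ : M.obj ⟶ Z₂) :
    ∃ (G : E.FullSubcategory) (b : G ⟶ M), IsDeflation (conflation E.FullSubcategory) b ∧
      (∃ v₁ : G.obj ⟶ Y₁, v₁ ≫ t₁ = b.hom ≫ c₁) ∧
      ∃ v₂ : G.obj ⟶ Y₂, v₂ ≫ t₂ = b.hom ≫ c₂ := by
  obtain ⟨P₁, g₁, p₁, sq₁, hp₁⟩ := ExactCategory.deflation_pullback t₁ c₁ h₁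
  obtain ⟨P₂, g₂, p₂, sq₂, hp₂⟩ := ExactCategory.deflation_pullback t₂ (p₁ ≫ c₂) h₂
  obtain ⟨G, hG, p₃, hp₃⟩ := IsResolving.generating (P := E) P₂
  obtain ⟨K, k, wk, hk⟩ := ExactCategory.deflation_comp _ _ hp₃
    (ExactCategory.deflation_comp _ _ hp₂ hp₁)
  refine ⟨⟨G, hG⟩, ObjectProperty.homMk (p₃ ≫ p₂ ≫ p₁), ?_, ⟨p₃ ≫ p₂ ≫ g₁, ?_⟩, ⟨p₃ ≫ g₂, ?_⟩⟩
  · exact (IsExtensionClosed.isDeflation_iff _).2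
      ⟨K, IsResolving.ker (P := E) _ hk hG M.property, k, wk, hk⟩
  · show _ = (p₃ ≫ p₂ ≫ p₁) ≫ c₁
    rw [assoc, assoc, assoc, assoc, sq₁.w]
  · show _ = (p₃ ≫ p₂ ≫ p₁) ≫ c₂
    rw [assoc, assoc, assoc, sq₂.w]

end Factorizations

/-! ### Total complexes over the ambient category are killed -/

section Killing

open CochainComplex HomComplex

variable {C : Type u} [Category.{v} C] [Preadditive C] [HasZeroObject C]
  [HasBinaryBiproducts C] [ExactCategory C] (E : ObjectProperty C)

lemma IsShortExact.isInflation {S : ShortComplex (CochainComplex C ℤ)} (hS : IsShortExact S)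
    (n : ℤ) : IsInflation (conflation C) (S.f.f n) := ⟨_, _, _, hS n⟩

lemma IsShortExact.isDeflation {S : ShortComplex (CochainComplex C ℤ)} (hS : IsShortExact S)
    (n : ℤ) : IsDeflation (conflation C) (S.g.f n) := ⟨_, _, _, hS n⟩

/-- Cover `M` by a contractible complex over `E` fine enough that the composites to the third
complex lift to the second. The cone of the inclusion of the kernel maps to `M` by a morphism in
`N.trW`, and `hotQ_map_eq_zero_of_lift` applies to the composite. -/
lemma totalComplexes_le_leftKilled [IsResolving E] (N : ObjectProperty (Hot E.FullSubcategory))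
    [N.IsTriangulated] [N.IsClosedUnderIsomorphisms] (hN : totalComplexes E.FullSubcategory ≤ N) :
    totalComplexes C ≤ leftKilled (hotInclusion E) N := by
  rintro _ ⟨S, hS, rfl⟩ M f
  obtain ⟨M, rfl⟩ := HomotopyCategory.quotient_obj_surjective M
  obtain ⟨f', hf'⟩ := (hotQ C).map_surjective (X := (chInclusion E).obj M) f
  let c (k : ℤ) : (M.X k).obj ⟶ S.X₃.X k := f'.f k ≫ totalZ S k
  -- `G m` covers `M` in degree `m - 1`. In the contractible complex it occurs in degree `m - 1`
  -- directly and in degree `m` through the differential, hence two lifting problems.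
  have hG (m : ℤ) : ∃ G : E.FullSubcategory, ∀ k : ℤ, k + 1 = m →
      ∃ b : G ⟶ M.X k, IsDeflation (conflation E.FullSubcategory) b ∧
        (∃ v : G.obj ⟶ S.X₂.X k, v ≫ S.g.f k = b.hom ≫ c k) ∧
        ∃ v : G.obj ⟶ S.X₂.X m, v ≫ S.g.f m = b.hom ≫ (M.d k m).hom ≫ c m := by
    obtain ⟨G, b, h⟩ := exists_deflation_lift E (M.X (m - 1)) (hS.isDeflation (m - 1))
      (hS.isDeflation m) (c (m - 1)) ((M.d (m - 1) m).hom ≫ c m)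
    refine ⟨G, fun k hk => ?_⟩
    obtain rfl : k = m - 1 := by omega
    exact ⟨b, h⟩
  choose G b hb hv hv' using hG
  choose v hv using hv
  choose v' hv' using hv'
  obtain ⟨K, i, w, h⟩ := exists_isShortExact_of_isDeflation (ofContractible fun k m hk => b m k hk)
    (isDeflation_ofContractible fun k => hb _ k rfl)
  refine ⟨_, _, trW_desc_of_isShortExact N hN w h, ?_⟩
  rw [← hf']
  let φ := mappingCone.desc i 0 (ofContractible fun k m hk => b m k hk) (perturbation_condition w)
  refine (Functor.map_comp (hotQ C) ((chInclusion E).map φ) f').symm.trans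
    (hotQ_map_eq_zero_of_lift hS _ fun n => ?_)
  have hφ : φ.f n = (mappingCone.snd i).v n n (add_zero n) ≫
      (biprod.fst ≫ b n (n - 1) (by omega) ≫ M.d (n - 1) n +
        biprod.snd ≫ b (n + 1) n rfl) := by
    refine (mappingCone.desc_f _ _ _ _ n (n + 1) rfl).trans ?_
    rw [Cochain.zero_v, comp_zero, zero_add]
    have hb' : (ofContractible fun k m hk => b m k hk).f n =
        (biprod.fst ≫ b n (n - 1) (by omega) ≫ M.d (n - 1) n + biprod.snd ≫ b (n + 1) n rfl :
          G n ⊞ G (n + 1) ⟶ M.X n) := biprod.desc_eq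
    exact congrArg (fun t => (mappingCone.snd i).v n n (add_zero n) ≫ t) hb'
  let s : ((mappingCone i).X n).obj ⟶ (G n ⊞ G (n + 1)).obj :=
    ((mappingCone.snd i).v n n (add_zero n)).hom
  refine ⟨s ≫ ((biprod.fst : G n ⊞ G (n + 1) ⟶ G n).hom ≫ v' n (n - 1) (by omega) +
    (biprod.snd : G n ⊞ G (n + 1) ⟶ G (n + 1)).hom ≫ v (n + 1) n rfl), ?_⟩
  have hφ' : (φ.f n).hom = s ≫ ((biprod.fst : G n ⊞ G (n + 1) ⟶ G n).hom ≫
      (b n (n - 1) (by omega)).hom ≫ (M.d (n - 1) n).hom +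
        (biprod.snd : G n ⊞ G (n + 1) ⟶ G (n + 1)).hom ≫ (b (n + 1) n rfl).hom) :=
    congrArg (fun f => f.hom) hφ
  have : (φ.f n).hom ≫ c n = (s ≫ ((biprod.fst : G n ⊞ G (n + 1) ⟶ G n).hom ≫
      v' n (n - 1) (by omega) +
      (biprod.snd : G n ⊞ G (n + 1) ⟶ G (n + 1)).hom ≫ v (n + 1) n rfl)) ≫ S.g.f n := by
    rw [hφ']
    have e₁ : s ≫ ((biprod.fst : G n ⊞ G (n + 1) ⟶ G n).hom ≫
      v' n (n - 1) (by omega) +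
      (biprod.snd : G n ⊞ G (n + 1) ⟶ G (n + 1)).hom ≫ v (n + 1) n rfl) ≫ S.g.f n = 
      s ≫ ((biprod.fst : G n ⊞ G (n + 1) ⟶ G n).hom ≫
      (b n (n - 1) (by omega)).hom ≫ (M.d (n - 1) n).hom ≫ c n +
        (biprod.snd : G n ⊞ G (n + 1) ⟶ G (n + 1)).hom ≫ (b (n + 1) n rfl).hom ≫ c n) := by
      rw [Preadditive.add_comp, assoc, assoc, hv, hv']
    refine Eq.trans ?_ (e₁.symm.trans (assoc _ _ _).symm)
    refine (assoc _ _ _).trans ?_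
    rw [Preadditive.add_comp, assoc, assoc, assoc]
  refine this.symm.trans ?_
  exact (assoc _ _ _).symm

/-- Embed the target in a contractible complex over `E` large enough that the components on the
first complex extend to the second. The suspension then maps to the cone of the cokernel projection
by a morphism in `N.trW`, and `hotQ_map_eq_zero_of_extension` applies. -/
lemma totalComplexes_le_rightKilled [IsCoresolving E]
    (N : ObjectProperty (Hot E.FullSubcategory))
    [N.IsTriangulated] [N.IsClosedUnderIsomorphisms] (hN : totalComplexes E.FullSubcategory ≤ N) :
    totalComplexes C ≤ rightKilled (hotInclusion E) N := by
  rintro _ ⟨S, hS, rfl⟩ M₀ f₀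
  obtain ⟨M₀, rfl⟩ := HomotopyCategory.quotient_obj_surjective M₀
  -- The target is written as a suspension because `toShiftCone` starts from one.
  obtain ⟨M, ⟨e⟩⟩ : ∃ M : CochainComplex E.FullSubcategory ℤ, Nonempty (M₀ ≅ M⟦(1 : ℤ)⟧) :=
    ⟨M₀⟦(-1 : ℤ)⟧, ⟨((shiftFunctorCompIsoId _ (-1 : ℤ) 1 (by omega)).app M₀).symm⟩⟩
  obtain ⟨f', hf'⟩ := (hotQ C).map_surjective (Y := (chInclusion E).obj (M⟦(1 : ℤ)⟧))
    (f₀ ≫ (hotInclusion E).map ((hotQ _).map e.hom))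
  let c (n k : ℤ) (hk : n + 1 = k) : (total S).X n ⟶ (M.X k).obj := by
    subst hk
    exact f'.f n
  -- `G k` receives both `j` in degree `k` and the differential followed by `j` from degree `k - 1`.
  -- The corresponding components start from the first complex in degrees `k + 1` and `k`.
  have hG (k : ℤ) : ∃ (G : E.FullSubcategory) (j : M.X k ⟶ G),
      IsInflation (conflation E.FullSubcategory) j ∧
        (∀ (n l : ℤ) (hk : n + 1 = k) (hl : k + 1 = l), ∃ u : S.X₂.X l ⟶ G.obj,
          S.f.f l ≫ u = totalιX S n k l hk hl ≫ c n k hk ≫ j.hom) ∧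
        ∀ (n m : ℤ) (hm : n + 1 = m) (hk : m + 1 = k), ∃ u : S.X₂.X k ⟶ G.obj,
          S.f.f k ≫ u = totalιX S n m k hm hk ≫ c n m hm ≫ (M.d m k).hom ≫ j.hom := by
    obtain ⟨n, hn⟩ : ∃ n : ℤ, n + 1 = k := ⟨k - 1, by omega⟩
    obtain ⟨m, hm⟩ : ∃ m : ℤ, m + 1 = n := ⟨n - 1, by omega⟩
    obtain ⟨G, j, hj, ⟨u₁, hu₁⟩, u₂, hu₂⟩ := exists_inflation_extension E (M.X k)
      (hS.isInflation (k + 1)) (hS.isInflation k) (totalιX S n k (k + 1) hn rfl ≫ c n k hn)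
      (totalιX S m n k hm hn ≫ c m n hm ≫ (M.d n k).hom)
    refine ⟨G, j, hj, fun n' l hk hl => ?_, fun n' m' hm' hk => ?_⟩
    · obtain rfl : n' = n := by omega
      subst hl
      exact ⟨u₁, by simpa using hu₁⟩
    · obtain rfl : m' = n := by omega
      obtain rfl : n' = m := by omega
      exact ⟨u₂, by simpa using hu₂⟩
  choose G j hj hu hu' using hG
  choose u hu using hu
  choose u' hu' using hu'
  obtain ⟨Q, p, w, h⟩ := exists_isShortExact_of_isInflation (toContractible j)
    (isInflation_toContractible hj)
  have hφ := trW_toShiftCone w N hN h (isZero_hotQ_contractible G)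
  refine ⟨_, (hotQ _).map e.hom ≫ (hotQ _).map (toShiftCone w),
    MorphismProperty.RespectsIso.precomp _ _ _ hφ, ?_⟩
  refine (congrArg (fun t => f₀ ≫ t) ((hotInclusion E).map_comp _ _)).trans
    ((assoc _ _ _).symm.trans
      ((congrArg (fun t => t ≫ (hotInclusion E).map ((hotQ _).map (toShiftCone w)))
        hf'.symm).trans ?_))
  refine (Functor.map_comp (hotQ C) f' ((chInclusion E).map (toShiftCone w))).symm.trans
    (hotQ_map_eq_zero_of_extension hS _ ?_)
  rintro n _ _ rfl rfl
  let t : (G (n + 1) ⊞ G (n + 1 + 1)).obj ⟶ ((mappingCone p).X n).obj :=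
    ((mappingCone.inl p).v (n + 1) n (by omega)).hom
  have hφ' : ((toShiftCone w).f n).hom = ((j (n + 1)).hom ≫
      (biprod.inl : G (n + 1) ⟶ G (n + 1) ⊞ G (n + 1 + 1)).hom +
      (M.d (n + 1) (n + 1 + 1)).hom ≫ (j (n + 1 + 1)).hom ≫
      (biprod.inr : G (n + 1 + 1) ⟶ G (n + 1) ⊞ G (n + 1 + 1)).hom) ≫ t := by
    have : (toShiftCone w).f n = (j (n + 1) ≫ biprod.inl +
      M.d (n + 1) (n + 1 + 1) ≫ j (n + 1 + 1) ≫ biprod.inr :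
        M.X (n + 1) ⟶ G (n + 1) ⊞ G (n + 1 + 1)) ≫
        (mappingCone.inl p).v (n + 1) n (by omega) := by
      rw [← assoc (M.d _ _), ← biprod.lift_eq]
      rfl
    exact congrArg (fun f => f.hom) this
  refine ⟨(u (n + 1) n _ rfl rfl ≫ (biprod.inl : G (n + 1) ⟶ G (n + 1) ⊞ G (n + 1 + 1)).hom +
    u' (n + 1 + 1) n _ rfl rfl ≫
      (biprod.inr : G (n + 1 + 1) ⟶ G (n + 1) ⊞ G (n + 1 + 1)).hom) ≫ t, ?_⟩
  have e₁ := hu (n + 1) n _ rfl rfl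
  have e₂ := hu' (n + 1 + 1) n _ rfl rfl
  have : S.f.f (n + 1 + 1) ≫
      (u (n + 1) n _ rfl rfl ≫ (biprod.inl : G (n + 1) ⟶ G (n + 1) ⊞ G (n + 1 + 1)).hom +
    u' (n + 1 + 1) n _ rfl rfl ≫
      (biprod.inr : G (n + 1 + 1) ⟶ G (n + 1) ⊞ G (n + 1 + 1)).hom) ≫ t =
      totalιX S n (n + 1) (n + 1 + 1) rfl rfl ≫ c n (n + 1) rfl ≫ ((j (n + 1)).hom ≫
      (biprod.inl : G (n + 1) ⟶ G (n + 1) ⊞ G (n + 1 + 1)).hom +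
      (M.d (n + 1) (n + 1 + 1)).hom ≫ (j (n + 1 + 1)).hom ≫
      (biprod.inr : G (n + 1 + 1) ⟶ G (n + 1) ⊞ G (n + 1 + 1)).hom) ≫ t := by
    simp only [Preadditive.add_comp, Preadditive.comp_add, reassoc_of% e₁, reassoc_of% e₂, assoc]
  refine this.trans ?_
  rw [← hφ']
  rfl

end Killing

/-! ### Comparing coacyclic complexes over the subcategory and over the ambient category -/

section Inclusion

open CochainComplex HomComplex

variable {C : Type u} [Category.{v} C] [Preadditive C] [HasZeroObject C]
  [HasBinaryBiproducts C] [ExactCategory C] (E : ObjectProperty C)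

/-- The inclusion is additive, so it commutes with cones; the comparison is made for the morphism
whose cone is the total complex. -/
lemma totalComplexes_fullSubcategory_le [IsExtensionClosed E] (N : ObjectProperty (Hot C))
    [N.IsTriangulated] [N.IsClosedUnderIsomorphisms] (hN : totalComplexes C ≤ N) :
    totalComplexes E.FullSubcategory ≤ N.inverseImage (hotInclusion E) := by
  rintro _ ⟨S, hS, rfl⟩
  let g := mappingCone.desc S.f 0 S.g (perturbation_condition S.zero)
  refine (trW_hotQ_iff (N.inverseImage (hotInclusion E)) g).1 ?_
  rw [ObjectProperty.inverseImage_trW_iff]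
  show N.trW ((hotQ C).map ((chInclusion E).map g))
  let a := (chInclusion E).map S.f
  let b := (chInclusion E).map S.g
  have w : a ≫ b = 0 := by rw [← Functor.map_comp, S.zero, Functor.map_zero]
  have e : (mappingCone.mapHomologicalComplexIso S.f E.ι).hom ≫
      mappingCone.desc a 0 b (perturbation_condition w) = (chInclusion E).map g := by
    ext n
    have e₁ : (mappingCone.mapHomologicalComplexIso S.f E.ι).hom.f n =
        E.ι.map ((mappingCone.fst S.f).1.v n (n + 1) rfl) ≫
          (mappingCone.inl a).v (n + 1) n (by omega) +
        E.ι.map ((mappingCone.snd S.f).v n n (add_zero n)) ≫ (mappingCone.inr a).f n :=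
      congrArg Iso.hom (mappingCone.mapHomologicalComplexXIso_eq S.f E.ι n (n + 1) rfl)
    have e₂ : ((chInclusion E).map g).f n =
        E.ι.map ((mappingCone.snd S.f).v n n (add_zero n)) ≫ b.f n := by
      refine (congrArg E.ι.map
        (mappingCone.desc_f S.f 0 S.g (perturbation_condition S.zero) n (n + 1) rfl)).trans ?_
      rw [Cochain.zero_v, comp_zero, zero_add]
      rfl
    rw [e₂]
    have e₃ {X : C} (p : X ⟶ ((chInclusion E).obj S.X₁).X (n + 1))
        (q : X ⟶ ((chInclusion E).obj S.X₂).X n) :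
        (p ≫ (mappingCone.inl a).v (n + 1) n (by omega) + q ≫ (mappingCone.inr a).f n) ≫
          (mappingCone.desc a 0 b (perturbation_condition w)).f n = q ≫ b.f n := by
      rw [Preadditive.add_comp, assoc, assoc, mappingCone.inl_v_desc_f, mappingCone.inr_f_desc_f,
        Cochain.zero_v, comp_zero, zero_add]
    exact (e₁ =≫ _).trans (e₃ _ _)
  rw [← e, Functor.map_comp]
  exact MorphismProperty.RespectsIso.precomp _ _ _ (trW_desc_of_isShortExact N hN w hS)

/-- One inclusion holds because the functor preserves total complexes and coproducts. For the other,
`rightKilled` is a localizing subcategory containing the total complexes over `C`, and its objects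
coming from `E` are coacyclic over `E`. -/
lemma coacyclic_fullSubcategory [IsCoresolving E] [HasCoproducts.{w} C]
    [∀ J : Type w, E.IsClosedUnderColimitsOfShape (Discrete J)] :
    coacyclic.{w} E.FullSubcategory = (coacyclic.{w} C).inverseImage (hotInclusion E) := by
  have : HasCoproductsOfShape ℕ (Hot E.FullSubcategory) :=
    hasColimitsOfShape_of_equivalence (Discrete.equivalence Equiv.ulift.{w})
  have := isStableUnderRetracts_of_coproducts (coacyclic.{w} E.FullSubcategory)
  apply le_antisymm
  · exact fun X hX => hX _ ⟨⟨inferInstance, inferInstance, fun J =>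
      inverseImage_hotInclusion_isClosedUnderColimitsOfShape E _ J⟩,
      totalComplexes_fullSubcategory_le E _ (totalComplexes_le_coacyclic C)⟩
  · refine le_trans (fun X hX => ?_) (inverseImage_rightKilled_le (hotInclusion E) _)
    exact hX _ ⟨⟨inferInstance, inferInstance, fun J =>
      rightKilled_isClosedUnderColimitsOfShape _ _ J⟩,
      totalComplexes_le_rightKilled E _ (totalComplexes_le_coacyclic _)⟩

lemma contraacyclic_fullSubcategory [IsResolving E] [HasProducts.{w} C]
    [∀ J : Type w, E.IsClosedUnderLimitsOfShape (Discrete J)] :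
    contraacyclic.{w} E.FullSubcategory =
      (contraacyclic.{w} C).inverseImage (hotInclusion E) := by
  have : HasProductsOfShape ℕ (Hot E.FullSubcategory) :=
    hasLimitsOfShape_of_equivalence (Discrete.equivalence Equiv.ulift.{w})
  have := isStableUnderRetracts_of_products (contraacyclic.{w} E.FullSubcategory)
  apply le_antisymm
  · exact fun X hX => hX _ ⟨⟨inferInstance, inferInstance, fun J =>
      inverseImage_hotInclusion_isClosedUnderLimitsOfShape E _ J⟩,
      totalComplexes_fullSubcategory_le E _ (totalComplexes_le_contraacyclic C)⟩
  · refine le_trans (fun X hX => ?_) (inverseImage_leftKilled_le (hotInclusion E) _)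
    exact hX _ ⟨⟨inferInstance, inferInstance, fun J =>
      leftKilled_isClosedUnderLimitsOfShape _ _ J⟩,
      totalComplexes_le_leftKilled E _ (totalComplexes_le_contraacyclic _)⟩

end Inclusion

end ExactCat

/-! ### The proposition -/

open ExactCat

theorem proposition4p2 :
    (∀ (A : Type u) [Category.{v} A] [Preadditive A] [HasZeroObject A] [HasBinaryBiproducts A]
      [ExactCat.ExactCategory A] [IsIdempotentComplete A]
      [HasCoproducts.{w} A] [ExactCat.HasExactCoproducts.{w} A]
      (E : ObjectProperty A) [ExactCat.IsCoresolving E]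
      (_ : ∀ J : Type w, E.IsClosedUnderColimitsOfShape (Discrete J)),
      (Nonempty (ExactCat.CoderivedInclusion.{w} E) ∧
        ∀ F : ExactCat.CoderivedInclusion.{w} E, F.functor.IsEquivalence) ∧
      (Nonempty (ExactCat.DerivedInclusion E) ∧
        ∀ G : ExactCat.DerivedInclusion E, ExactCat.IsVerdierQuotientFunctor G.functor)) ∧
    (∀ (B : Type u') [Category.{v'} B] [Preadditive B] [HasZeroObject B] [HasBinaryBiproducts B]
      [ExactCat.ExactCategory B] [IsIdempotentComplete B]
      [HasProducts.{w} B] [ExactCat.HasExactProducts.{w} B]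
      (F : ObjectProperty B) [ExactCat.IsResolving F]
      (_ : ∀ J : Type w, F.IsClosedUnderLimitsOfShape (Discrete J)),
      (Nonempty (ExactCat.ContraderivedInclusion.{w} F) ∧
        ∀ H : ExactCat.ContraderivedInclusion.{w} F, H.functor.IsEquivalence) ∧
      (Nonempty (ExactCat.DerivedInclusion F) ∧
        ∀ G : ExactCat.DerivedInclusion F, ExactCat.IsVerdierQuotientFunctor G.functor)) := by
  constructor
  · intro A _ _ _ _ _ _ _ _ E _ hE
    have h := coacyclic_fullSubcategory.{w} E
    have h' := triangEnvelope_acyclicComplexes_le E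
    have hX := exists_trW_coacyclic.{w} E
    refine ⟨⟨nonempty_inducedFunctor _ _ _ h.le, fun F => ?_⟩,
      nonempty_inducedFunctor _ _ _ h', fun G => ?_⟩
    · have := isLocalization_of_trW_right (hotInclusion E) (coacyclic.{w} A) hX
      -- The class inverted on Hot(E) is identified with the one defining its coderived category.
      simp only [← h] at this
      exact isEquivalence_inducedFunctor F
    -- Resolutions modulo coacyclic complexes are also resolutions modulo the thick envelope of the
    -- acyclic ones.
    · have := isLocalization_of_trW_right (hotInclusion E) (acyclicComplexes A).triangEnvelope
        fun X => by
          obtain ⟨Z, s, hs⟩ := hX X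
          exact ⟨Z, s, ObjectProperty.trW_monotone (coacyclic_le_triangEnvelope.{w}) _ hs⟩
      exact isVerdierQuotientFunctor_inducedFunctor G h'
  · intro B _ _ _ _ _ _ _ _ E _ hE
    have h := contraacyclic_fullSubcategory.{w} E
    have h' := triangEnvelope_acyclicComplexes_le E
    have hX := exists_trW_contraacyclic.{w} E
    refine ⟨⟨nonempty_inducedFunctor _ _ _ h.le, fun F => ?_⟩,
      nonempty_inducedFunctor _ _ _ h', fun G => ?_⟩
    · have := isLocalization_of_trW_left (hotInclusion E) (contraacyclic.{w} B) hX
      simp only [← h] at this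
      exact isEquivalence_inducedFunctor F
    · have := isLocalization_of_trW_left (hotInclusion E) (acyclicComplexes B).triangEnvelope
        fun X => by
          obtain ⟨Z, s, hs⟩ := hX X
          exact ⟨Z, s, ObjectProperty.trW_monotone (contraacyclic_le_triangEnvelope.{w}) _ hs⟩
      exact isVerdierQuotientFunctor_inducedFunctor G h'
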